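/- Let $k$ be a field of characteristic $0$ and let $Q$ be a quiver with vertex set $I$. Let $\overline Q$ be its double, obtained by adding a reverse edge $e^*$ for each $e\in Q$, with $(e^*)^*=e$; $t(a)$ and $h(a)$ denote the tail and head of $a\in\overline Q$. Put $[a,b]=1$ if $a\in Q$, $b=a^*$, $[a,b]=-1$ if $b\in Q$, $a=b^*$, and $[a,b]=0$ otherwise. Let $P$ be the path algebra of $\overline Q$ and $L=P/[P,P]$, with basis the *necklaces*: closed paths in $\overline Q$ up to choice of the starting edge, including the vertex idempotents. A *collection of necklaces* is a monomial of $\mathrm{Sym}\,L$, written $a_{11}\cdots a_{1l_1}\,\&\cdots\&\,a_{k1}\cdots a_{kl_k}\,\&\,v_1\,\&\cdots\&\,v_q$; its set $X$ of abstract edges is the set of indices $(i,j)$, with the label map $\mathrm{pr}_X:X\to\overline Q$ and the successor map $x\mapsto x+1$ along each closed path. **The algebra $A_h(Q)$.** A collection with heights is a collection whose $N$ abstract edges carry distinct heights $1,\dots,N$. These form a $k[h]$-basis of an algebra in which $XY$ is obtained by stacking $Y$ above $X$ (all edges of $X$ get smaller heights than those of $Y$). $A_h(Q)$ is the quotient by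 the relations $X=X'+h\,[a,b]\,X''$, where $a,b$ are the labels in $X$ of the edges of two consecutive heights $i,i+1$, $X'$ is $X$ with these two heights interchanged, and (if $b=a^*$) $X''$ is $X$ with these two edges deleted and their end points glued. **The product.** For collections $P,R$ with sets of abstract edges $X,Y$, $$P*_hR=\sum_{(I_X,I_Y,\phi)}\Big(\frac h2\Big)^{\#I_X}(-1)^{\#(I_Y\cap \mathrm{pr}_Y^{-1}(Q))}\,PR_{I_X,I_Y,\phi},$$ summed over $I_X\subset X$, $I_Y\subset Y$ and bijections $\phi:I_X\to I_Y$ with $\mathrm{pr}_Y(\phi(x))=\mathrm{pr}_X(x)^*$. Here $PR_{I_X,I_Y,\phi}$ is the result of cutting and gluing: extend $\phi$ by $\phi^{-1}$ to $I_Y$, let $f(z)=z+1$ for $z\notin I_X\sqcup I_Y$ and $f(z)=\phi(z)+1$ otherwise; the orbits of $f$ on $X\sqcup Y$, with the edges in $I_X\sqcup I_Y$ deleted, are the new necklaces (an orbit consisting of deleted edges only gives a vertex idempotent), and the idempotents of $P$ and $R$ are kept. Extend $k[h]$-bilinearly to $(\mathrm{Sym}\,L)[h]$. **The symmetrization map.**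 $\Phi_W:(\mathrm{Sym}\,L)[h]\to A_h(Q)$ is the $k[h]$-linear map with $\Phi_W(P)=\frac1{N!}\sum_H P_H$ for every collection $P$ with $N$ abstract edges, where $H$ runs over all bijections $X\to\{1,\dots,N\}$ and $P_H$ is $P$ with the heights $H$. **Representations.** For $\mathbf l\in\mathbb Z_{\ge0}^I$ let $\mathrm{Rep}_{\mathbf l}$ be the space of representations of dimension vector $\mathbf l$, with coordinates $(M_a)_{ij}$, $i\le l_{t(a)}$, $j\le l_{h(a)}$. Let $\mathrm{tr}_{\mathbf l}:\mathrm{Sym}\,L\to k[\mathrm{Rep}_{\mathbf l}(\overline Q)]$ be the algebra map with $a_1\cdots a_m\mapsto \mathrm{tr}(M_{a_1}\cdots M_{a_m})$ and $v\mapsto l_v$ for vertex idempotents, and $\mathrm{tr}_{\mathbf l}[h]$ its $k[h]$-linear extension. Let $\iota(e)_{ij}=(M_e)_{ij}$ and $\iota(e^*)_{ij}=-h\,\partial/\partial(M_e)_{ji}$ for $e\in Q$, acting on $k[h][\mathrm{Rep}_{\mathbf l}(Q)]$, and let $D_Q$ be the $k[h]$-algebra of operators they generate. Let $\phi_W:k[h][\mathrm{Rep}_{\mathbf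 l}(\overline Q)]\to D_Q$ be the $k[h]$-linear map sending a product of coordinates $(M_a)_{ij}$ to the average of the products of the operators $\iota(a)_{ij}$ over all orderings of the factors. **Theorem.** 1. $*_h$ and $\Phi_W$ are well defined on all collections of necklaces by the above formulas. $*_h$ is an associative product on $(\mathrm{Sym}\,L)[h]$ with unit $1$, and $$\Phi_W(P*_hR)=\Phi_W(P)\,\Phi_W(R)\quad\text{for all }P,R\in(\mathrm{Sym}\,L)[h].$$ Moreover $\Phi_W(1)=1$ and $\Phi_W$ is bijective. Hence $\Phi_W$ is an isomorphism of $k[h]$-algebras $((\mathrm{Sym}\,L)[h],*_h)\to A_h(Q)$. 2. There is a ring homomorphism $\mathrm{pr}:A_h(Q)\to\mathrm{Sym}\,L$ that forgets heights and sends $h$ to $0$, and $\mathrm{pr}\circ\Phi_W$ is the specialization $h=0$. 3. For every $\mathbf l\in\mathbb Z_{\ge0}^I$ there are a $k[h]$-algebra homomorphism $\rho^h_{\mathbf l}:A_h(Q)\to D_Q$, sending a collection with heights to $\prod_r l_{v_r}\cdot\sum\prod_x\iota(\mathrm{pr}_X(x))_{i_x\,i_{x+1}}$ (sum over all index functions $x\mapsto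 i_x\in\{1,\dots,l_{t(x)}\}$, where $t(x)$ is the tail of $\mathrm{pr}_X(x)$; factors in the order of increasing heights), and a ring homomorphism $\mathrm{symb}:D_Q\to k[\mathrm{Rep}_{\mathbf l}(\overline Q)]$ with $\iota(a)_{ij}\mapsto(M_a)_{ij}$, $h\mapsto0$, that is the identity on $k$. The map $\phi_W$ is bijective, and the diagram of the trace representations commutes: $$\rho^h_{\mathbf l}\circ\Phi_W=\phi_W\circ\mathrm{tr}_{\mathbf l}[h],\qquad \mathrm{symb}\circ\rho^h_{\mathbf l}=\mathrm{tr}_{\mathbf l}\circ\mathrm{pr},$$ $$\mathrm{tr}_{\mathbf l}[h]\big|_{h=0}=\mathrm{tr}_{\mathbf l}\circ(\,\cdot\,)\big|_{h=0},\qquad \mathrm{symb}\circ\phi_W=(\,\cdot\,)\big|_{h=0}.$$ -/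

import Mathlib

open scoped Nat

noncomputable section

namespace NecklaceMoyal

universe u v w

/-! ### The double quiver and necklaces -/

section Quivers

variable (V : Type u) [Quiver.{v} V]

/-- The edges of the double `Q̄` of the quiver `Q` (with vertex type `V`): the arrows of `Q`
together with a reverse arrow for each of them.  `a.left` is the tail `t(a)` and `a.right` the
head `h(a)`. -/
abbrev DEdge : Type (max u v) := Quiver.Total (Quiver.Symmetrify V)

variable {V}

/-- Edge reversal `e ↦ e*`, with `(e*)* = e`. -/
def DEdge.rev (a : DEdge V) : DEdge V := ⟨a.right, a.left, Quiver.reverse a.hom⟩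

/-- `a` is an edge of the original quiver `Q` (as opposed to a reverse `e*` of one). -/
def DEdge.IsForward (a : DEdge V) : Prop := Sum.isLeft a.hom = true

open Classical in
/-- The number `[a, a*]`: it is `1` if `a ∈ Q` and `-1` if `a* ∈ Q`. -/
def DEdge.sign (R : Type w) [Ring R] (a : DEdge V) : R := if a.IsForward then 1 else -1

theorem DEdge.rev_rev (a : DEdge V) : a.rev.rev = a := by
  obtain ⟨x, y, f⟩ := a
  simp only [DEdge.rev, Quiver.reverse_reverse]

theorem DEdge.rev_left (a : DEdge V) : a.rev.left = a.right := rfl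

theorem DEdge.rev_right (a : DEdge V) : a.rev.right = a.left := rfl

variable (V)

/-- Closed paths in the double quiver (of length `≥ 0`) with a marked starting point. -/
abbrev ClosedPath : Type (max u v) := Σ a : Quiver.Symmetrify V, Quiver.Path a a

variable {V}

/-- Two closed paths are related by moving the starting point: `pq ~ qp`. -/
def ClosedPath.Rot (x y : ClosedPath V) : Prop :=
  ∃ (p : Quiver.Path x.1 y.1) (q : Quiver.Path y.1 x.1), x.2 = p.comp q ∧ y.2 = q.comp p

variable (V)

/-- Necklaces: closed paths in the double quiver up to the choice of the starting point.  The
trivial paths, i.e. the vertex idempotents, are included.  Necklaces form a basis of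
`L = P / [P, P]`, where `P` is the path algebra of the double quiver. -/
def Necklace : Type (max u v) := Quot (ClosedPath.Rot (V := V))

variable {V}

def Necklace.mk (x : ClosedPath V) : Necklace V := Quot.mk _ x

/-- The necklace of the vertex idempotent `1_a`. -/
def Necklace.vertex (a : Quiver.Symmetrify V) : Necklace V := Necklace.mk ⟨a, Quiver.Path.nil⟩

variable (V)

/-- `Sym L` over the coefficient ring `R`: polynomials in the necklaces.  For `R = k[h]` this is
`(Sym L)[h]`.  Monomials are collections (multisets) of necklaces. -/
abbrev SymL (R : Type w) [CommSemiring R] : Type (max u v w) := MvPolynomial (Necklace V) R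

end Quivers

/-! ### Collections of necklaces with a set of abstract edges -/

/-- A collection of closed paths in the double quiver, with set `X` of abstract edges: `edge` is
the projection of the abstract edges to `Q̄`, `next` sends an abstract edge to its successor
(`x ↦ x + 1`) on its closed path, and `verts` lists the vertex idempotents of the collection.  The
closed paths of positive length are the cycles of `next`. -/
structure Diagram (V : Type u) [Quiver.{v} V] (X : Type w) where
  edge : X → DEdge V
  next : Equiv.Perm X
  comp : ∀ x, (edge x).right = (edge (next x)).left
  verts : Multiset (Quiver.Symmetrify V)

namespace Diagram

variable {V : Type u} [Quiver.{v} V] {X : Type*} {Y : Type*}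

/-- Transport of a collection along a bijection of the sets of abstract edges. -/
def relabel (D : Diagram V X) (e : X ≃ Y) : Diagram V Y where
  edge y := D.edge (e.symm y)
  next := (e.symm.trans D.next).trans e
  comp y := by simpa using D.comp (e.symm y)
  verts := D.verts

/-- The product `P & R` of two collections. -/
def disjUnion (D : Diagram V X) (D' : Diagram V Y) : Diagram V (X ⊕ Y) where
  edge := Sum.elim D.edge D'.edge
  next := Equiv.sumCongr D.next D'.next
  comp := by
    rintro (x | y)
    · exact D.comp x
    · exact D'.comp y
  verts := D.verts + D'.verts

/-- The path which starts at the tail of the abstract edge `x` and runs through `n` edges. -/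
def walk (D : Diagram V X) (x : X) :
    (n : ℕ) → Quiver.Path (D.edge x).left (D.edge (D.next^[n] x)).left
  | 0 => Quiver.Path.nil
  | n + 1 => ((D.walk x n).cons (D.edge (D.next^[n] x)).hom).cast rfl
      ((D.comp _).trans (by rw [Function.iterate_succ_apply']))

/-- The closed path of the collection on which the abstract edge `x` lies, starting at `x`. -/
def closedPath (D : Diagram V X) (x : X) : ClosedPath V :=
  ⟨(D.edge x).left, (D.walk x (Function.minimalPeriod D.next x)).cast rfl
    (by rw [Function.iterate_minimalPeriod])⟩

/-- The cycles (orbits on the set of abstract edges) of a permutation. -/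
abbrev Orbit (f : Equiv.Perm X) : Type _ := Quotient (Equiv.Perm.SameCycle.setoid f)

open Classical in
/-- The multiset of necklaces of a collection: one for each orbit of `next`, and one for each
vertex idempotent. -/
def necklaces [Fintype X] (D : Diagram V X) : Multiset (Necklace V) :=
  (Finset.univ : Finset (Orbit D.next)).val.map (fun c => Necklace.mk (D.closedPath c.out))
    + D.verts.map Necklace.vertex

/-- The collection as a monomial of `Sym L`. -/
def sym (R : Type w) [CommSemiring R] [Fintype X] (D : Diagram V X) : SymL V R :=
  (D.necklaces.map MvPolynomial.X).prod

/-! ### Cutting and gluing -/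

/-- `τ` describes a set of cutting edges `I` with a fixed point free involution `φ` of `I` such
that `φ x` is always labelled by the reverse of the label of `x`: `I` consists of the points moved
by `τ`, and `φ` is the restriction of `τ` to `I`. -/
def IsGluing (D : Diagram V X) (τ : Equiv.Perm X) : Prop :=
  (∀ x, τ (τ x) = x) ∧ ∀ x, τ x ≠ x → D.edge (τ x) = (D.edge x).rev

theorem exists_return [Finite X] (f : Equiv.Perm X) (S : Set X) (x : S) :
    ∃ n : ℕ, f^[n + 1] x ∈ S := by
  have h : 0 < Function.minimalPeriod f (x : X) :=
    Function.minimalPeriod_pos_of_mem_periodicPts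
      ((Function.Injective.mem_periodicPts f.injective) (x : X))
  obtain ⟨n, hn⟩ := Nat.exists_eq_succ_of_ne_zero h.ne'
  refine ⟨n, ?_⟩
  have h2 := Function.iterate_minimalPeriod (f := f) (x := (x : X))
  rw [hn] at h2
  rw [show n + 1 = n.succ from rfl, h2]
  exact x.2

open Classical in
/-- First return map to `S`: the first point of `f x, f (f x), …` which lies in `S`. -/
def returnFun [Finite X] (f : Equiv.Perm X) (S : Set X) (x : S) : S :=
  ⟨f^[Nat.find (exists_return f S x) + 1] x, Nat.find_spec (exists_return f S x)⟩

theorem returnFun_injective [Finite X] (f : Equiv.Perm X) (S : Set X) :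
    Function.Injective (returnFun f S) := by
  classical
  have key : ∀ x y : S, Nat.find (exists_return f S x) ≤ Nat.find (exists_return f S y) →
      returnFun f S x = returnFun f S y → x = y := by
    intro x y hle h
    have h1 : f^[Nat.find (exists_return f S x) + 1] (x : X)
        = f^[Nat.find (exists_return f S y) + 1] (y : X) := congrArg Subtype.val h
    obtain ⟨d, hd⟩ := Nat.exists_eq_add_of_le hle
    rw [hd, add_right_comm, Function.iterate_add_apply f _ d (y : X)] at h1
    have h2 : (x : X) = f^[d] (y : X) := (f.injective.iterate _) h1
    rcases d with _ | d
    · exact Subtype.ext h2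
    · exfalso
      have h3 : f^[d + 1] (y : X) ∈ S := h2 ▸ x.2
      have h4 := Nat.find_min' (exists_return f S y) h3
      omega
  intro x y h
  rcases le_total (Nat.find (exists_return f S x)) (Nat.find (exists_return f S y)) with hle | hle
  · exact key x y hle h
  · exact (key y x hle h.symm).symm

/-- The permutation induced by `f` on the points of `S`, skipping the points outside `S`. -/
def returnPerm [Finite X] (f : Equiv.Perm X) (S : Set X) : Equiv.Perm S :=
  Equiv.ofBijective (returnFun f S)
    (Finite.injective_iff_bijective.mp (returnFun_injective f S))

theorem glue_left (D : Diagram V X) {τ : Equiv.Perm X} (hτ : D.IsGluing τ) (x : X)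
    (hx : τ x ≠ x) : (D.edge (D.next (τ x))).left = (D.edge x).left := by
  rw [← D.comp, hτ.2 x hx, DEdge.rev_right]

theorem glue_iterate (D : Diagram V X) {τ : Equiv.Perm X} (hτ : D.IsGluing τ) (x : X)
    (hx : τ x = x) (n : ℕ) (hn : ∀ m < n, ¬ τ ((τ.trans D.next)^[m + 1] x) =
      (τ.trans D.next)^[m + 1] x) :
    (D.edge x).right = (D.edge ((τ.trans D.next)^[n + 1] x)).left := by
  induction n with
  | zero => simpa [hx] using D.comp x
  | succ n ih =>
    rw [ih (fun m hm => hn m (by omega)), Function.iterate_succ_apply' _ (n + 1)]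
    exact (D.glue_left hτ _ (hn n (by omega))).symm

open Classical in
/-- The result of cutting the collection along the cutting edges `I` (the points moved by `τ`) and
gluing the end points.  With `f x = x + 1` for `x ∉ I` and `f x = φ x + 1` for `x ∈ I`, the closed
paths of the result are the orbits of `f`, the edges in `I` being deleted; an orbit which is
contained in `I` becomes a vertex idempotent, and the old idempotents are untouched. -/
def cut [Fintype X] (D : Diagram V X) (τ : Equiv.Perm X) (hτ : D.IsGluing τ) :
    Diagram V {x : X // τ x = x} where
  edge x := D.edge x
  next := returnPerm (τ.trans D.next) {x : X | τ x = x}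
  comp x := D.glue_iterate hτ x x.2 _
    (fun _ hm => Nat.find_min (exists_return (τ.trans D.next) {x : X | τ x = x} x) hm)
  verts := D.verts +
    ((Finset.univ : Finset (Orbit (τ.trans D.next))).filter
      (fun c => ∀ x : X, Quotient.mk _ x = c → τ x ≠ x)).val.map (fun c => (D.edge c.out).left)

theorem isGluing_swap [DecidableEq X] (D : Diagram V X) (i j : X)
    (h : D.edge j = (D.edge i).rev) : D.IsGluing (Equiv.swap i j) := by
  refine ⟨fun x => Equiv.swap_apply_self i j x, fun x hx => ?_⟩
  by_cases hi : x = i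
  · subst hi; simpa using h
  · by_cases hj : x = j
    · subst hj; simp [h, DEdge.rev_rev]
    · exact absurd (Equiv.swap_apply_of_ne_of_ne hi hj) hx

end Diagram

/-! ### Collections with heights -/

/-- A collection of necklaces with heights: the abstract edges have pairwise distinct heights, only
the order of which matters, so that the abstract edge of height `i` may be identified with the
element `i` of `Fin size` (heights start from `0` here). -/
structure HDiagram (V : Type u) [Quiver.{v} V] where
  size : ℕ
  diag : Diagram V (Fin size)

namespace HDiagram

variable {V : Type u} [Quiver.{v} V]

theorem ext' {D D' : HDiagram V} (h : D.size = D'.size)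
    (he : ∀ i : Fin D.size, D.diag.edge i = D'.diag.edge (Fin.cast h i))
    (hn : ∀ i : Fin D.size, (D.diag.next i : ℕ) = D'.diag.next (Fin.cast h i))
    (hv : D.diag.verts = D'.diag.verts) : D = D' := by
  obtain ⟨n, ⟨e, s, c, vs⟩⟩ := D
  obtain ⟨n', ⟨e', s', c', vs'⟩⟩ := D'
  dsimp only at h
  subst h
  obtain rfl : e = e' := funext he
  obtain rfl : s = s' := Equiv.ext fun i => Fin.ext (hn i)
  dsimp only at hv
  subst hv
  rfl

/-- The product `P R`: the collection `R` is stacked above the collection `P`, i.e. all edges of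
`P` get smaller heights than those of `R`. -/
def mul (D D' : HDiagram V) : HDiagram V :=
  ⟨D.size + D'.size, (D.diag.disjUnion D'.diag).relabel finSumFinEquiv⟩

/-- The empty collection. -/
def one : HDiagram V := ⟨0, ⟨finZeroElim, Equiv.refl _, finZeroElim, 0⟩⟩

theorem edge_mul_left (D D' : HDiagram V) (m : ℕ) (h : m < D.size) (h' : m < (mul D D').size) :
    (mul D D').diag.edge ⟨m, h'⟩ = D.diag.edge ⟨m, h⟩ := by
  have key : finSumFinEquiv.symm (⟨m, h'⟩ : Fin (D.size + D'.size)) = Sum.inl ⟨m, h⟩ := by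
    rw [Equiv.symm_apply_eq]; rfl
  exact congrArg (Sum.elim D.diag.edge D'.diag.edge) key

theorem edge_mul_right (D D' : HDiagram V) (m : ℕ) (h : m < D'.size)
    (h' : D.size + m < (mul D D').size) :
    (mul D D').diag.edge ⟨D.size + m, h'⟩ = D'.diag.edge ⟨m, h⟩ := by
  have key : finSumFinEquiv.symm (⟨D.size + m, h'⟩ : Fin (D.size + D'.size)) =
      Sum.inr ⟨m, h⟩ := by
    rw [Equiv.symm_apply_eq]; rfl
  exact congrArg (Sum.elim D.diag.edge D'.diag.edge) key

theorem next_mul_left (D D' : HDiagram V) (m : ℕ) (h : m < D.size) (h' : m < (mul D D').size) :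
    ((mul D D').diag.next ⟨m, h'⟩ : ℕ) = D.diag.next ⟨m, h⟩ := by
  have key : finSumFinEquiv.symm (⟨m, h'⟩ : Fin (D.size + D'.size)) = Sum.inl ⟨m, h⟩ := by
    rw [Equiv.symm_apply_eq]; rfl
  exact congrArg (fun z => ((finSumFinEquiv (Equiv.sumCongr D.diag.next D'.diag.next z) :
    Fin (D.size + D'.size)) : ℕ)) key

theorem next_mul_right (D D' : HDiagram V) (m : ℕ) (h : m < D'.size)
    (h' : D.size + m < (mul D D').size) :
    ((mul D D').diag.next ⟨D.size + m, h'⟩ : ℕ) = D.size + D'.diag.next ⟨m, h⟩ := by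
  have key : finSumFinEquiv.symm (⟨D.size + m, h'⟩ : Fin (D.size + D'.size)) =
      Sum.inr ⟨m, h⟩ := by
    rw [Equiv.symm_apply_eq]; rfl
  exact congrArg (fun z => ((finSumFinEquiv (Equiv.sumCongr D.diag.next D'.diag.next z) :
    Fin (D.size + D'.size)) : ℕ)) key

theorem edge_congr (D : HDiagram V) {m m' : ℕ} (e : m = m') (h : m < D.size) :
    D.diag.edge ⟨m, h⟩ = D.diag.edge ⟨m', e ▸ h⟩ := by subst e; rfl

theorem next_congr (D : HDiagram V) {m m' : ℕ} (e : m = m') (h : m < D.size) :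
    (D.diag.next ⟨m, h⟩ : ℕ) = D.diag.next ⟨m', e ▸ h⟩ := by subst e; rfl

theorem mul_assoc' (D E F : HDiagram V) : mul (mul D E) F = mul D (mul E F) := by
  have hs : (mul (mul D E) F).size = D.size + E.size + F.size := rfl
  have hs' : (mul D (mul E F)).size = D.size + (E.size + F.size) := rfl
  have hDE : (mul D E).size = D.size + E.size := rfl
  have hEF : (mul E F).size = E.size + F.size := rfl
  refine ext' (Nat.add_assoc _ _ _) ?_ ?_ (add_assoc _ _ _)
  all_goals
    rintro ⟨m, hm⟩
    rw [hs] at hm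
    rcases lt_or_ge m D.size with h1 | h1
    · first
      | exact (edge_mul_left _ F m (by omega) _).trans ((edge_mul_left D E m h1 _).trans
          (edge_mul_left D (mul E F) m h1 _).symm)
      | exact (next_mul_left _ F m (by omega) _).trans ((next_mul_left D E m h1 _).trans
          (next_mul_left D (mul E F) m h1 _).symm)
    · obtain ⟨m, rfl⟩ := Nat.exists_eq_add_of_le h1
      rcases lt_or_ge m E.size with h2 | h2
      · first
        | exact (edge_mul_left _ F _ (by omega) _).trans ((edge_mul_right D E m h2 _).trans
            ((edge_mul_right D (mul E F) m (by omega) _).trans (edge_mul_left E F m h2 _)).symm)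
        | exact (next_mul_left _ F _ (by omega) _).trans ((next_mul_right D E m h2 _).trans
            ((next_mul_right D (mul E F) m (by omega) _).trans
              (congrArg (D.size + ·) (next_mul_left E F m h2 _))).symm)
      · obtain ⟨m, rfl⟩ := Nat.exists_eq_add_of_le h2
        have h3 : D.size + (E.size + m) = (mul D E).size + m := by omega
        first
        | exact (edge_congr _ h3 _).trans ((edge_mul_right (mul D E) F m (by omega) _).trans
            ((edge_mul_right D (mul E F) _ (by omega) _).trans
              (edge_mul_right E F m (by omega) _)).symm)
        | exact (next_congr _ h3 _).trans ((next_mul_right (mul D E) F m (by omega) _).trans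
            ((Nat.add_assoc _ _ _).trans ((next_mul_right D (mul E F) _ (by omega) _).trans
              (congrArg (D.size + ·) (next_mul_right E F m (by omega) _))).symm))

/-- Collections with heights form a monoid under stacking. -/
instance : Monoid (HDiagram V) where
  mul := mul
  one := one
  one_mul D := by
    refine ext' (Nat.zero_add D.size) ?_ ?_ (zero_add _)
    · rintro ⟨m, hm⟩
      exact (edge_congr (mul one D) (Nat.zero_add m).symm hm).trans
        (edge_mul_right one D m _ _)
    · rintro ⟨m, hm⟩
      exact (next_congr (mul one D) (Nat.zero_add m).symm hm).trans
        ((next_mul_right one D m _ _).trans (Nat.zero_add _))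
  mul_one D := by
    refine ext' (Nat.add_zero D.size) ?_ ?_ (add_zero _)
    · rintro ⟨m, hm⟩
      exact edge_mul_left D one m hm _
    · rintro ⟨m, hm⟩
      exact next_mul_left D one m hm _
  mul_assoc := mul_assoc'

/-- A collection on a linearly ordered set of abstract edges, with heights given by the order. -/
def ofOrdered {X : Type*} [Fintype X] [LinearOrder X] (D : Diagram V X) : HDiagram V :=
  ⟨Fintype.card X, D.relabel (monoEquivOfFin X rfl).symm.toEquiv⟩

/-- The edges of a path, in the order in which they are traversed. -/
def arrows {a : Quiver.Symmetrify V} : {b : Quiver.Symmetrify V} → Quiver.Path a b → List (DEdge V)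
  | _, Quiver.Path.nil => []
  | _, Quiver.Path.cons p e => arrows p ++ [⟨_, _, e⟩]

theorem arrows_spec {a b : Quiver.Symmetrify V} (p : Quiver.Path a b) :
    (∀ (i : ℕ) (h : i + 1 < (arrows p).length),
      ((arrows p)[i]'(by omega)).right = ((arrows p)[i + 1]).left) ∧
    (∀ h : 0 < (arrows p).length, ((arrows p)[0]).left = a) ∧
    (∀ (i : ℕ) (h : i + 1 = (arrows p).length), ((arrows p)[i]'(by omega)).right = b) ∧
    ((arrows p).length = 0 → a = b) := by
  induction p with
  | nil => simp [arrows]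
  | @cons b c p e ih =>
    obtain ⟨h1, h2, h3, h4⟩ := ih
    refine ⟨fun i h => ?_, fun h => ?_, fun i h => ?_, fun h => ?_⟩
    · simp only [arrows, List.length_append, List.length_singleton] at h
      simp only [arrows]
      rw [List.getElem_append_left (by omega)]
      by_cases hi : i + 1 < (arrows p).length
      · rw [List.getElem_append_left hi]
        exact h1 i hi
      · rw [List.getElem_append_right (by omega)]
        simpa using h3 i (by omega)
    · simp only [arrows]
      by_cases hp : 0 < (arrows p).length
      · rw [List.getElem_append_left hp]
        exact h2 hp
      · rw [List.getElem_append_right (by omega)]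
        simpa using (h4 (by omega)).symm
    · simp only [arrows, List.length_append, List.length_singleton] at h
      simp only [arrows]
      rw [List.getElem_append_right (by omega)]
      simp
    · simp [arrows] at h

theorem list_closed {a : Quiver.Symmetrify V} (L : List (DEdge V))
    (h1 : ∀ (i : ℕ) (h : i + 1 < L.length), (L[i]'(by omega)).right = (L[i + 1]).left)
    (h2 : ∀ h : 0 < L.length, (L[0]).left = a)
    (h3 : ∀ (i : ℕ) (h : i + 1 = L.length), (L[i]'(by omega)).right = a) (i : Fin L.length) :
    (L.get i).right = (L.get (finRotate _ i)).left := by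
  cases L with
  | nil => exact i.elim0
  | cons x xs =>
    by_cases hi : (i : ℕ) = xs.length
    · have e : i = Fin.last xs.length := Fin.ext hi
      have e2 : finRotate (xs.length + 1) i = 0 := by rw [e, finRotate_last]
      have e3 : (finRotate (x :: xs).length i) = ⟨0, Nat.succ_pos _⟩ := e2
      rw [e3]
      exact (h3 i (by simp [hi])).trans (h2 (Nat.succ_pos _)).symm
    · have hlt : (i : ℕ) < xs.length := lt_of_le_of_ne (Nat.lt_succ_iff.mp i.2) hi
      have e3 : finRotate (x :: xs).length i = ⟨i + 1, Nat.succ_lt_succ hlt⟩ :=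
        finRotate_of_lt hlt
      rw [e3]
      exact h1 i (Nat.succ_lt_succ hlt)

theorem arrows_closed {a : Quiver.Symmetrify V} (p : Quiver.Path a a)
    (i : Fin (arrows p).length) :
    ((arrows p).get i).right = ((arrows p).get (finRotate _ i)).left :=
  list_closed _ (arrows_spec p).1 (arrows_spec p).2.1 (arrows_spec p).2.2.1 i

open Classical in
/-- The collection consisting of one closed path `a₁ a₂ ⋯ aₙ`, with heights `1, 2, …, n`; a trivial
path gives a vertex idempotent. -/
def ofClosedPath (x : ClosedPath V) : HDiagram V where
  size := (arrows x.2).length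
  diag :=
    { edge := (arrows x.2).get
      next := finRotate _
      comp := arrows_closed x.2
      verts := if arrows x.2 = [] then {x.1} else 0 }

/-- A representative of a monomial of `Sym L`: the collection of its necklaces, listed in some
order, each with some choice of starting point. -/
def ofMonomial (m : Necklace V →₀ ℕ) : HDiagram V :=
  ((Finsupp.toMultiset m).toList.map (fun n => ofClosedPath (Quot.out n))).prod

end HDiagram

/-! ### The Moyal product -/

section Moyal

variable {V : Type u} [Quiver.{v} V] (k : Type w) [Field k]

namespace Diagram

variable {X : Type*} {Y : Type*} [Fintype X] [Fintype Y]

/-- The triples `(I_X, I_Y, φ)` of subsets `I_X ⊆ X`, `I_Y ⊆ Y` and a bijection `φ : I_X → I_Y`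
such that `φ x` is always labelled by the reverse of the label of `x`.  Such a triple is encoded by
the involution `τ` of `X ⊔ Y` which is `φ` on `I_X`, `φ⁻¹` on `I_Y` and the identity elsewhere. -/
def CrossGluing (D : Diagram V X) (D' : Diagram V Y) : Type _ :=
  {τ : Equiv.Perm (X ⊕ Y) // (D.disjUnion D').IsGluing τ ∧
    ∀ z, τ z ≠ z → (τ z).isLeft = !z.isLeft}

noncomputable instance (D : Diagram V X) (D' : Diagram V Y) : Fintype (D.CrossGluing D') := by
  classical
  unfold CrossGluing
  exact Fintype.ofFinite _

open Classical in
/-- `∑ (h/2)^#I_X · (-1)^#(I_Y ∩ pr⁻¹ Q) · PR_{I_X, I_Y, φ}`, the sum over all triples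
`(I_X, I_Y, φ)`, where `PR_{I_X, I_Y, φ}` is the result of cutting and gluing. -/
def moyal (D : Diagram V X) (D' : Diagram V Y) : SymL V (Polynomial k) :=
  ∑ τ : D.CrossGluing D',
    ((Polynomial.C (1 / 2 : k) * Polynomial.X) ^
        (Finset.univ.filter fun x : X => τ.1 (Sum.inl x) ≠ Sum.inl x).card *
      (-1) ^ (Finset.univ.filter fun y : Y =>
        τ.1 (Sum.inr y) ≠ Sum.inr y ∧ (D'.edge y).IsForward).card) •
    ((D.disjUnion D').cut τ.1 τ.2.1).sym (Polynomial k)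

end Diagram

/-- The Moyal product `*_h` on `(Sym L)[h]`: the `k[h]`-bilinear map which is given on
collections of necklaces by the sum over all ways to cut and glue them. -/
def star : SymL V (Polynomial k) →ₗ[Polynomial k]
    SymL V (Polynomial k) →ₗ[Polynomial k] SymL V (Polynomial k) :=
  (MvPolynomial.basisMonomials (Necklace V) (Polynomial k)).constr (Polynomial k) fun m =>
    (MvPolynomial.basisMonomials (Necklace V) (Polynomial k)).constr (Polynomial k) fun m' =>
      (HDiagram.ofMonomial m).diag.moyal k (HDiagram.ofMonomial m').diag

/-! ### The algebra `A_h(Q)` and the symmetrization map -/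

/-- `k[h]`-linear combinations of collections with heights, with the stacking product. -/
abbrev HeightAlgebra (V : Type u) [Quiver.{v} V] : Type (max u v w) :=
  MonoidAlgebra (Polynomial k) (HDiagram V)

/-- The collection with heights `D`, as an element of the algebra of collections with heights. -/
def HDiagram.toAlg (D : HDiagram V) : HeightAlgebra k V := MonoidAlgebra.of (Polynomial k) _ D

/-- The relations `X = X' + h [a, b] X''` of `A_h(Q)`.  Here `a` and `b` are the edges of `X` of
two consecutive heights `i < j`, `X'` is obtained from `X` by interchanging the heights of these
two abstract edges, and `X''` by deleting them and joining their end points, keeping the order of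
the other heights.  The number `[a, b]` is zero unless `b = a*`. -/
inductive HRel : HeightAlgebra k V → HeightAlgebra k V → Prop
  | commute {N : ℕ} (D : Diagram V (Fin N)) (i j : Fin N) (hij : (i : ℕ) + 1 = j)
      (h : D.edge j ≠ (D.edge i).rev) :
      HRel (HDiagram.toAlg k ⟨N, D⟩) (HDiagram.toAlg k ⟨N, D.relabel (Equiv.swap i j)⟩)
  | glue {N : ℕ} (D : Diagram V (Fin N)) (i j : Fin N) (hij : (i : ℕ) + 1 = j)
      (h : D.edge j = (D.edge i).rev) :
      HRel (HDiagram.toAlg k ⟨N, D⟩)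
        (HDiagram.toAlg k ⟨N, D.relabel (Equiv.swap i j)⟩ +
          (Polynomial.X * (D.edge i).sign (Polynomial k)) •
            HDiagram.toAlg k
              (HDiagram.ofOrdered (D.cut (Equiv.swap i j) (D.isGluing_swap i j h))))

/-- Schedler's algebra `A_h(Q)`. -/
abbrev Ah (V : Type u) [Quiver.{v} V] : Type (max u v w) := RingQuot (HRel (V := V) k)

/-- The class in `A_h(Q)` of a collection with heights. -/
def HDiagram.toAh (D : HDiagram V) : Ah k V :=
  RingQuot.mkAlgHom (Polynomial k) (HRel k) (D.toAlg k)

open Classical in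
/-- The average `1/N! ∑_H P_H` over all height assignments `H : X → {1, …, N}` of a collection `P`
with set `X` of abstract edges, `N = #X`. -/
def Diagram.average {X : Type*} [Fintype X] (D : Diagram V X) : Ah k V :=
  Polynomial.C (((Fintype.card X)! : k)⁻¹) •
    ∑ H : X ≃ Fin (Fintype.card X), HDiagram.toAh k ⟨Fintype.card X, D.relabel H⟩

/-- The symmetrization map `Φ_W : (Sym L)[h] → A_h(Q)`. -/
def PhiW : SymL V (Polynomial k) →ₗ[Polynomial k] Ah k V :=
  (MvPolynomial.basisMonomials (Necklace V) (Polynomial k)).constr (Polynomial k) fun m =>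
    (HDiagram.ofMonomial m).diag.average k

end Moyal

/-! ### Trace representations -/

section Representations

variable {V : Type u} [Quiver.{v} V] (l : V → ℕ)

/-- The matrix coordinates on `Rep_l(Q̄)`: the entries `(M_a)_{ij}`, `a ∈ Q̄`, `i ≤ l(t(a))`,
`j ≤ l(h(a))`. -/
abbrev DCoord : Type (max u v) := Σ a : DEdge V, Fin (l a.left) × Fin (l a.right)

/-- The matrix coordinates on `Rep_l(Q)`. -/
abbrev Coord : Type (max u v) := Σ e : Quiver.Total V, Fin (l e.left) × Fin (l e.right)

/-- The generic matrix `M_a`. -/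
def genericMatrix (R : Type w) [CommSemiring R] (a : DEdge V) :
    Matrix (Fin (l a.left)) (Fin (l a.right)) (MvPolynomial (DCoord l) R) :=
  fun i j => MvPolynomial.X ⟨a, i, j⟩

/-- The product `M_{a₁} M_{a₂} ⋯ M_{aₙ}` of the generic matrices along a path. -/
def pathMatrix (R : Type w) [CommSemiring R] {a : Quiver.Symmetrify V} :
    {b : Quiver.Symmetrify V} → Quiver.Path a b →
      Matrix (Fin (l a)) (Fin (l b)) (MvPolynomial (DCoord l) R)
  | _, Quiver.Path.nil => 1
  | _, Quiver.Path.cons p e => pathMatrix R p * genericMatrix l R ⟨_, _, e⟩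

theorem pathMatrix_comp (R : Type w) [CommSemiring R] {a b c : Quiver.Symmetrify V}
    (p : Quiver.Path a b) (q : Quiver.Path b c) :
    pathMatrix l R (p.comp q) = pathMatrix l R p * pathMatrix l R q := by
  induction q with
  | nil => simp [pathMatrix]
  | cons q e ih => simp only [Quiver.Path.comp_cons, pathMatrix, ih, Matrix.mul_assoc]

/-- The trace function of a necklace. -/
def traceNecklace (R : Type w) [CommSemiring R] (n : Necklace V) : MvPolynomial (DCoord l) R :=
  Quot.lift (fun x : ClosedPath V => (pathMatrix l R x.2).trace) (by
    rintro ⟨a, p⟩ ⟨b, q⟩ ⟨r, s, h1, h2⟩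
    dsimp only at r s h1 h2 ⊢
    rw [h1, h2, pathMatrix_comp, pathMatrix_comp, Matrix.trace_mul_comm]) n

/-- The trace map `tr_l : Sym L → R[Rep_l(Q̄)]`, over the coefficient ring `R`. -/
def traceMap (R : Type w) [CommSemiring R] :
    SymL V R →ₐ[R] MvPolynomial (DCoord l) R :=
  MvPolynomial.aeval (traceNecklace l R)

variable (k : Type w) [Field k]

/-- The `k[h]`-linear operators on `k[h][Rep_l(Q)]`. -/
abbrev Operators : Type (max u v w) :=
  Module.End (Polynomial k) (MvPolynomial (Coord l) (Polynomial k))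

/-- The operator attached to a matrix coordinate of the double quiver: multiplication by
`(M_e)_{ij}` for `e ∈ Q`, and `-h ∂/∂(M_e)_{ji}` for the entry `ij` at `e*`. -/
def coordOp : DCoord l → Operators l k
  | ⟨⟨a, b, Sum.inl e⟩, i, j⟩ =>
      LinearMap.mulLeft (Polynomial k) (MvPolynomial.X (⟨⟨a, b, e⟩, i, j⟩ : Coord l))
  | ⟨⟨a, b, Sum.inr e⟩, i, j⟩ =>
      (-Polynomial.X : Polynomial k) •
        (MvPolynomial.pderiv (⟨⟨b, a, e⟩, j, i⟩ : Coord l)).toLinearMap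

/-- The algebra `D_Q` of differential operators on `Rep_l(Q)` generated over `k[h]` by the
operators `(M_e)_{ij}` and `-h ∂/∂(M_e)_{ji}`. -/
def DQ : Subalgebra (Polynomial k) (Operators l k) :=
  Algebra.adjoin (Polynomial k) (Set.range (coordOp l k))

/-- The generators of `D_Q`: the entry `ij` of the matrix `ι(a)`. -/
def coord (a : DEdge V) (i : Fin (l a.left)) (j : Fin (l a.right)) : DQ l k :=
  ⟨coordOp l k ⟨a, i, j⟩, Algebra.subset_adjoin ⟨_, rfl⟩⟩

/-- The operator `∑ ∏ ι(a_r)_{i_r, i_{r + 1}}` of a collection with heights.  There is one summation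
index for each abstract edge `x` (at the tail of `x`), the factors are multiplied in the order of
increasing heights, and a vertex idempotent `v` contributes the factor `l_v`. -/
def rhoDiagram (D : HDiagram V) : DQ l k :=
  (D.diag.verts.map l).prod •
    ∑ i : ((x : Fin D.size) → Fin (l (D.diag.edge x).left)),
      (List.ofFn fun x : Fin D.size => coord l k (D.diag.edge x) (i x)
        (Fin.cast (congrArg l (D.diag.comp x).symm) (i (D.diag.next x)))).prod

/-- The Weyl symmetrization map `φ_W : k[h][Rep_l(Q̄)] → D_Q`, which sends a product
`y₁ y₂ ⋯ y_N` of coordinates to the average of the products of the corresponding generators of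
`D_Q` over all orderings of the factors. -/
def phiW : MvPolynomial (DCoord l) (Polynomial k) →ₗ[Polynomial k] DQ l k :=
  (MvPolynomial.basisMonomials (DCoord l) (Polynomial k)).constr (Polynomial k) fun m =>
    let L : List (DCoord l) := (Finsupp.toMultiset m).toList
    Polynomial.C ((L.length ! : k)⁻¹) •
      ∑ σ : Equiv.Perm (Fin L.length),
        (List.ofFn fun r => coord l k (L.get (σ r)).1 (L.get (σ r)).2.1 (L.get (σ r)).2.2).prod

end Representations

/-- Specialization `h = 0` of polynomials with coefficients in `k[h]`. -/
def atZero (k : Type w) [Field k] (σ : Type*) :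
    MvPolynomial σ (Polynomial k) →+* MvPolynomial σ k :=
  MvPolynomial.map (Polynomial.evalRingHom 0)

end NecklaceMoyal
end

namespace NecklaceMoyal

universe u v w

section

/-! ### Necklaces as cyclic words -/

section Words

variable {V : Type u} [Quiver.{v} V]

open HDiagram (arrows)

/-! The inverse of the symmetrization map can be written down explicitly, as in Wick's theorem. For
a collection with heights, `Diagram.wick` sums over all gluings, that is, all partial matchings of
abstract edges with edges of reversed label. A gluing contributes the cut and glued collection,
weighted by `± h/2` for each matched pair, with the sign of the lower edge.

Exchange two edges of consecutive heights. A gluing that does not match them keeps its weight, and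
one that does match them changes sign. The difference is therefore `2 · (h/2) = h` times a sum over
gluings of the collection in which this pair is already glued. This is the defining relation of
`A_h(Q)` (`Diagram.wick_swap`), so the Wick sums descend to `wickMap` on `A_h(Q)`.

In the average over all heights every nontrivial gluing cancels, because exchanging the heights of
one of its pairs reverses the sign. Hence `wickMap` is a left inverse of `PhiW`
(`Diagram.wickMap_average`). Surjectivity of `PhiW` is an induction on the number of edges: modulo
shorter collections the heights may be permuted freely, so a collection equals its average. For a
product of two averages the same cancellation leaves only the gluings between the two collections.
Their weight does not depend on the heights and is the coefficient in the Moyal formula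
(`Diagram.wickMap_average_mul`). So `star` is the product of `A_h(Q)` transported by `PhiW`, and
associativity and the unit follow. Independence of representatives rests on
`Diagram.iso_of_necklaces_eq`: necklaces determine a collection up to renaming of edges.

The representation `rho` respects the relations because the commutator of two matrix entries is `±
h` times Kronecker deltas, and these impose exactly the index identifications of the glued
collection; an orbit that disappears leaves one free index, hence a factor `l v`
(`Diagram.indexSum_cut`). For `phiW`, left multiplication by a generator `u` corresponds to `X_u ±
(h/2) ∂`, and the commutator with it to `± h ∂`, the derivative being taken along the coordinate
reverse to `u` (`gen_mul_phiW`, `phiW_commutator`). The first formula gives surjectivity and the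
second injectivity, by induction on the degree. The symbol is the inverse of `phiW` followed by `h =
0`; its multiplicativity is the first formula at `h = 0`. The square `rho_PhiW` holds summand by
summand over index functions, since orderings of the factors are height assignments. -/

theorem arrows_comp {a b c : Quiver.Symmetrify V} (p : Quiver.Path a b) (q : Quiver.Path b c) :
    arrows (p.comp q) = arrows p ++ arrows q := by
  induction q with
  | nil => simp [arrows]
  | cons q e ih => simp [arrows, ih]

theorem arrows_cast {a b a' b' : Quiver.Symmetrify V} (ha : a = a') (hb : b = b')
    (p : Quiver.Path a b) : arrows (p.cast ha hb) = arrows p := by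
  subst ha hb; rfl

theorem eq_of_arrows_eq_nil {a b : Quiver.Symmetrify V} (p : Quiver.Path a b)
    (h : arrows p = []) : a = b := by
  cases p with
  | nil => rfl
  | cons p e => simp [arrows] at h

theorem eq_nil_of_arrows_eq_nil {a : Quiver.Symmetrify V} (p : Quiver.Path a a)
    (h : arrows p = []) : p = Quiver.Path.nil := by
  cases p with
  | nil => rfl
  | cons p e => simp [arrows] at h

/-- A path is determined by its starting point and the list of its edges. -/
theorem sigma_ext_of_arrows_eq {a b c : Quiver.Symmetrify V} (p : Quiver.Path a b)
    (q : Quiver.Path a c) (h : arrows p = arrows q) :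
    (⟨b, p⟩ : Σ b, Quiver.Path a b) = ⟨c, q⟩ := by
  induction p generalizing c with
  | nil =>
    cases q with
    | nil => rfl
    | cons q e => simp [arrows] at h
  | cons p e ih =>
    cases q with
    | nil => simp [arrows] at h
    | cons q e' =>
      simp only [arrows] at h
      obtain ⟨h1, h2⟩ := List.append_inj' h rfl
      have := ih q h1
      cases this
      simp only [List.cons.injEq, and_true] at h2
      cases h2
      rfl

theorem left_eq_of_arrows_eq {a b a' b' : Quiver.Symmetrify V} (p : Quiver.Path a b)
    (q : Quiver.Path a' b') (h : arrows p = arrows q) (hne : arrows p ≠ []) : a = a' := by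
  have h1 := (HDiagram.arrows_spec p).2.1 (List.length_pos_iff.mpr hne)
  have h2 := (HDiagram.arrows_spec q).2.1 (List.length_pos_iff.mpr (h ▸ hne))
  rw [← h1, ← h2]
  congr 1
  simp only [h]

theorem exists_comp_of_arrows_eq_append {a b : Quiver.Symmetrify V} (p : Quiver.Path a b)
    (l l' : List (DEdge V)) (h : arrows p = l ++ l') :
    ∃ (c : Quiver.Symmetrify V) (r : Quiver.Path a c) (s : Quiver.Path c b),
      p = r.comp s ∧ arrows r = l ∧ arrows s = l' := by
  induction p generalizing l' with
  | nil =>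
    simp only [arrows, List.nil_eq, List.append_eq_nil_iff] at h
    exact ⟨a, .nil, .nil, rfl, h.1.symm, h.2.symm⟩
  | @cons b c p e ih =>
    simp only [arrows] at h
    rcases List.eq_nil_or_concat' l' with rfl | ⟨l₀, x, rfl⟩
    · refine ⟨c, p.cons e, .nil, rfl, ?_, rfl⟩
      simpa [arrows] using h
    · rw [← List.append_assoc] at h
      obtain ⟨h1, h2⟩ := List.append_inj' h rfl
      obtain ⟨d, r, s, hp, hr, hs⟩ := ih l₀ h1
      refine ⟨d, r, s.cons e, ?_, hr, ?_⟩
      · rw [hp, Quiver.Path.comp_cons]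
      · simp only [arrows, hs, h2]

open Classical in
/-- The cyclic word of a closed path; a trivial path is recorded by its vertex. -/
noncomputable def ClosedPath.word (x : ClosedPath V) : Cycle (DEdge V) ⊕ Quiver.Symmetrify V :=
  if arrows x.2 = [] then Sum.inr x.1 else Sum.inl (arrows x.2 : Cycle (DEdge V))

/-- The cyclic word of a necklace. -/
noncomputable def Necklace.word : Necklace V → Cycle (DEdge V) ⊕ Quiver.Symmetrify V :=
  Quot.lift ClosedPath.word (by
    rintro ⟨a, p⟩ ⟨b, q⟩ ⟨r, s, h1, h2⟩
    dsimp only at r s h1 h2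
    subst h1 h2
    by_cases h : arrows r ++ arrows s = []
    · have hr := (List.append_eq_nil_iff.mp h).1
      have h' : arrows s ++ arrows r = [] := by simp_all
      simp only [ClosedPath.word, arrows_comp, h, h', if_true, eq_of_arrows_eq_nil r hr]
    · have h' : ¬ arrows s ++ arrows r = [] := by simpa [and_comm] using h
      simp only [ClosedPath.word, arrows_comp, h, h', if_false, Sum.inl.injEq]
      exact Cycle.coe_eq_coe.mpr List.isRotated_append)

/-- Paths carry their end points in their types. Cyclic words do not, so through this injection
equalities of necklaces become equalities of cyclic lists. -/
theorem Necklace.word_injective : Function.Injective (Necklace.word (V := V)) := by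
  rintro ⟨a, p⟩ ⟨b, q⟩ h
  change ClosedPath.word ⟨a, p⟩ = ClosedPath.word ⟨b, q⟩ at h
  unfold ClosedPath.word at h
  dsimp only at h
  split_ifs at h with h1 h2 h2
  · obtain rfl := Sum.inr_injective h
    rw [eq_nil_of_arrows_eq_nil p h1, eq_nil_of_arrows_eq_nil q h2]
  · obtain ⟨n, hn⟩ := Cycle.coe_eq_coe.mp (Sum.inl_injective h)
    rw [← List.rotate_mod] at hn
    have hlt : n % (arrows p).length < (arrows p).length :=
      Nat.mod_lt _ (List.length_pos_iff.mpr h1)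
    rw [List.rotate_eq_drop_append_take hlt.le] at hn
    -- Reducing the rotation modulo the length keeps the second piece non-empty, and a non-empty
    -- list of edges determines the starting vertex of its path.
    have hne : (arrows p).drop (n % (arrows p).length) ≠ [] := by
      rw [Ne, List.drop_eq_nil_iff]; omega
    obtain ⟨c, r, s, rfl, hr, hs⟩ := exists_comp_of_arrows_eq_append p _ _
      (List.take_append_drop (n % (arrows p).length) (arrows p)).symm
    obtain ⟨d, s', r', rfl, hs', hr'⟩ := exists_comp_of_arrows_eq_append q _ _ hn.symm
    obtain rfl := left_eq_of_arrows_eq s s' (hs.trans hs'.symm) (hs ▸ hne)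
    obtain ⟨rfl, e1⟩ := Sigma.mk.inj (sigma_ext_of_arrows_eq s s' (hs.trans hs'.symm))
    obtain ⟨_, e2⟩ := Sigma.mk.inj (sigma_ext_of_arrows_eq r r' (hr.trans hr'.symm))
    obtain rfl := eq_of_heq e1
    obtain rfl := eq_of_heq e2
    exact Quot.sound ⟨r, s, rfl, rfl⟩

theorem Necklace.word_vertex (a : Quiver.Symmetrify V) :
    (Necklace.vertex a).word = Sum.inr a := by
  change ClosedPath.word _ = _
  simp [ClosedPath.word, arrows]

end Words

/-! ### Necklaces of a collection as labelled orbits; invariance under renaming of edges -/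

namespace Diagram

variable {V : Type u} [Quiver.{v} V] {X : Type*} {Y : Type*}

theorem ext' {D D' : Diagram V X} (he : ∀ x, D.edge x = D'.edge x)
    (hn : ∀ x, D.next x = D'.next x) (hv : D.verts = D'.verts) : D = D' := by
  obtain ⟨e, n, c, v⟩ := D
  obtain ⟨e', n', c', v'⟩ := D'
  obtain rfl : e = e' := funext he
  obtain rfl : n = n' := Equiv.ext hn
  dsimp only at hv
  subst hv
  rfl

theorem mem_periodicPts [Finite X] (f : Equiv.Perm X) (x : X) :
    x ∈ Function.periodicPts f :=
  (Function.Injective.mem_periodicPts f.injective) x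

theorem arrows_walk (D : Diagram V X) (x : X) (n : ℕ) :
    HDiagram.arrows (D.walk x n) = (List.range n).map fun i => D.edge (D.next^[i] x) := by
  induction n with
  | zero => rfl
  | succ n ih =>
    rw [List.range_succ, List.map_append, ← ih, walk, arrows_cast]
    rfl

/-- Eliminates the dependent types of `walk`: closed paths become periodic orbits of `next`. The
word is never a vertex, because every point of a permutation of a finite set has positive minimal
period. -/
theorem word_closedPath [Finite X] (D : Diagram V X) (x : X) :
    (Necklace.mk (D.closedPath x)).word =
      Sum.inl ((Function.periodicOrbit D.next x).map D.edge) := by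
  have h : HDiagram.arrows (D.closedPath x).2 =
      (List.range (Function.minimalPeriod D.next x)).map fun i => D.edge (D.next^[i] x) := by
    rw [closedPath, arrows_cast, arrows_walk]
  have hne : HDiagram.arrows (D.closedPath x).2 ≠ [] := by
    rw [h]
    have := Function.minimalPeriod_pos_of_mem_periodicPts (mem_periodicPts D.next x)
    simp [this.ne']
  change ClosedPath.word _ = _
  rw [ClosedPath.word, if_neg hne, h, Function.periodicOrbit]
  rw [Cycle.map_coe, List.map_map]
  rfl

theorem periodicOrbit_of_semiconj {f : X → X} {g : Y → Y} {e : X → Y}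
    (he : Function.Injective e) (h : ∀ x, g (e x) = e (f x)) (x : X) :
    Function.periodicOrbit g (e x) = (Function.periodicOrbit f x).map e := by
  have hi : ∀ n, g^[n] (e x) = e (f^[n] x) := fun n =>
    ((Function.Semiconj.iterate_right (f := e) (ga := f) (gb := g)
      (fun x => (h x).symm) n).eq x).symm
  have hp : Function.minimalPeriod g (e x) = Function.minimalPeriod f x := by
    rw [Function.minimalPeriod_eq_minimalPeriod_iff]
    intro n
    simp only [Function.IsPeriodicPt, Function.IsFixedPt, hi, he.eq_iff]
  rw [Function.periodicOrbit, hp, Function.periodicOrbit, Cycle.map_coe, List.map_map]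
  congr 2
  funext n
  exact hi n

theorem mk_closedPath_of_semiconj [Finite X] [Finite Y] (D : Diagram V X) (D' : Diagram V Y)
    {e : X → Y} (he : Function.Injective e) (h : ∀ x, D'.next (e x) = e (D.next x))
    (h' : ∀ x, D'.edge (e x) = D.edge x) (x : X) :
    Necklace.mk (D'.closedPath (e x)) = Necklace.mk (D.closedPath x) := by
  apply Necklace.word_injective
  rw [word_closedPath, word_closedPath, periodicOrbit_of_semiconj he h]
  congr 1
  induction Function.periodicOrbit D.next x using Quotient.inductionOn with
  | _ l =>
    change Cycle.map _ (Cycle.map _ (l : Cycle X)) = Cycle.map _ (l : Cycle X)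
    rw [Cycle.map_coe, Cycle.map_coe, Cycle.map_coe, List.map_map]
    congr 2
    funext x
    exact h' x

theorem mk_closedPath_congr [Finite X] (D : Diagram V X) {x y : X}
    (h : D.next.SameCycle x y) :
    Necklace.mk (D.closedPath x) = Necklace.mk (D.closedPath y) := by
  apply Necklace.word_injective
  rw [word_closedPath, word_closedPath]
  obtain ⟨n, -, -, rfl⟩ := h.exists_pow_eq''
  rw [Equiv.Perm.coe_pow, Function.periodicOrbit_apply_iterate_eq (mem_periodicPts _ _)]

/-- The necklace of an orbit of the successor permutation. -/
noncomputable def orbitNecklace [Finite X] (D : Diagram V X) : Orbit D.next → Necklace V :=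
  Quotient.lift (fun x => Necklace.mk (D.closedPath x)) fun _ _ h => D.mk_closedPath_congr h

/-- Replaces the arbitrary representatives `c.out` by a function on the orbits themselves, which can
be transported along bijections of orbits. -/
theorem necklaces_eq [Fintype X] (D : Diagram V X) [Fintype (Orbit D.next)] :
    D.necklaces = (Finset.univ : Finset (Orbit D.next)).val.map D.orbitNecklace +
      D.verts.map Necklace.vertex := by
  rw [necklaces]
  congr 1
  have : (fun c : Orbit D.next => Necklace.mk (D.closedPath c.out)) = D.orbitNecklace := by
    funext c
    conv_rhs => rw [← Quotient.out_eq c]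
    rfl
  rw [this]
  congr!

theorem map_univ_equiv {A B C : Type*} [Fintype A] [Fintype B] (e : A ≃ B) (g : B → C) :
    (Finset.univ : Finset A).val.map (fun a => g (e a)) = (Finset.univ : Finset B).val.map g := by
  rw [← Finset.map_univ_equiv e, Finset.map_val, Multiset.map_map]
  rfl

/-- Two collections are isomorphic if they differ by a renaming of the abstract edges. -/
def Iso (D : Diagram V X) (D' : Diagram V Y) : Prop := ∃ e : X ≃ Y, D.relabel e = D'

theorem relabel_eq {D : Diagram V X} {D' : Diagram V Y} (e : X ≃ Y)
    (h : ∀ x, D'.next (e x) = e (D.next x)) (h' : ∀ x, D'.edge (e x) = D.edge x)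
    (hv : D.verts = D'.verts) : D.relabel e = D' := by
  refine ext' (fun y => ?_) (fun y => ?_) hv
  · obtain ⟨x, rfl⟩ := e.surjective y
    simp [relabel, h']
  · obtain ⟨x, rfl⟩ := e.surjective y
    simp [relabel, h]

theorem Iso.of_equiv {D : Diagram V X} {D' : Diagram V Y} (e : X ≃ Y)
    (h : ∀ x, D'.next (e x) = e (D.next x)) (h' : ∀ x, D'.edge (e x) = D.edge x)
    (hv : D.verts = D'.verts) : D.Iso D' := ⟨e, relabel_eq e h h' hv⟩

theorem relabel_next_apply (D : Diagram V X) (e : X ≃ Y) (x : X) :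
    (D.relabel e).next (e x) = e (D.next x) := by simp [relabel]

theorem relabel_edge_apply (D : Diagram V X) (e : X ≃ Y) (x : X) :
    (D.relabel e).edge (e x) = D.edge x := by simp [relabel]

theorem zpow_apply_of_semiconj {f : Equiv.Perm X} {g : Equiv.Perm Y} {e : X → Y}
    (h : ∀ x, g (e x) = e (f x)) (n : ℤ) (x : X) : (g ^ n) (e x) = e ((f ^ n) x) := by
  have hn : ∀ (n : ℕ) x, (g ^ n) (e x) = e ((f ^ n) x) := fun n x => by
    rw [Equiv.Perm.coe_pow, Equiv.Perm.coe_pow]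
    exact ((Function.Semiconj.iterate_right (f := e) (ga := f) (gb := g)
      (fun x => (h x).symm) n).eq x).symm
  rcases n with n | n
  · exact hn n x
  · rw [zpow_negSucc, zpow_negSucc, Equiv.Perm.inv_eq_iff_eq, hn, ← Equiv.Perm.mul_apply, mul_inv_cancel,
      Equiv.Perm.one_apply]

theorem sameCycle_iff_of_semiconj {f : Equiv.Perm X} {g : Equiv.Perm Y} {e : X → Y}
    (he : Function.Injective e) (h : ∀ x, g (e x) = e (f x)) {x y : X} :
    g.SameCycle (e x) (e y) ↔ f.SameCycle x y := by
  simp only [Equiv.Perm.SameCycle, zpow_apply_of_semiconj h, he.eq_iff]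

/-- The bijection of orbits induced by a bijection which intertwines two permutations. -/
def orbitEquiv {f : Equiv.Perm X} {g : Equiv.Perm Y} (e : X ≃ Y) (h : ∀ x, g (e x) = e (f x)) :
    Orbit f ≃ Orbit g :=
  Quotient.congr e fun _ _ => (sameCycle_iff_of_semiconj e.injective h).symm

theorem necklaces_relabel [Fintype X] [Fintype Y] (D : Diagram V X) (e : X ≃ Y) :
    (D.relabel e).necklaces = D.necklaces := by
  classical
  rw [necklaces_eq, necklaces_eq]
  congr 1
  rw [← map_univ_equiv (orbitEquiv e (D.relabel_next_apply e))]
  congr 1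
  funext c
  induction c using Quotient.inductionOn with
  | _ x =>
    exact mk_closedPath_of_semiconj D (D.relabel e) e.injective (D.relabel_next_apply e)
      (D.relabel_edge_apply e) x

/-- The orbits of a permutation of a disjoint union which preserves the two parts. -/
def orbitSumEquiv (f : Equiv.Perm X) (g : Equiv.Perm Y) :
    Orbit f ⊕ Orbit g ≃ Orbit (Equiv.sumCongr f g) where
  toFun := Sum.elim
    (Quotient.map Sum.inl fun _ _ h =>
      (sameCycle_iff_of_semiconj (g := Equiv.sumCongr f g) Sum.inl_injective fun _ => rfl).mpr h)
    (Quotient.map Sum.inr fun _ _ h =>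
      (sameCycle_iff_of_semiconj (g := Equiv.sumCongr f g) Sum.inr_injective fun _ => rfl).mpr h)
  invFun := Quotient.lift (Sum.elim (fun x => Sum.inl (Quotient.mk _ x))
      (fun y => Sum.inr (Quotient.mk _ y))) (by
    rintro x y ⟨n, rfl⟩
    rcases x with x | x
    · rw [zpow_apply_of_semiconj (f := f) (e := Sum.inl) fun _ => rfl]
      exact congrArg Sum.inl (Quotient.sound ⟨n, rfl⟩)
    · rw [zpow_apply_of_semiconj (f := g) (e := Sum.inr) fun _ => rfl]
      exact congrArg Sum.inr (Quotient.sound ⟨n, rfl⟩))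
  left_inv := by rintro (⟨⟨x⟩⟩ | ⟨⟨y⟩⟩) <;> rfl
  right_inv := by rintro ⟨x | y⟩ <;> rfl

theorem map_univ_sum {A B C : Type*} [Fintype A] [Fintype B] (g : A ⊕ B → C) :
    (Finset.univ : Finset (A ⊕ B)).val.map g =
      (Finset.univ : Finset A).val.map (fun a => g (Sum.inl a)) +
        (Finset.univ : Finset B).val.map (fun b => g (Sum.inr b)) := by
  rw [← Finset.univ_disjSum_univ, Finset.val_disjSum, Multiset.disjSum, Multiset.map_add,
    Multiset.map_map, Multiset.map_map]
  rfl

theorem necklaces_disjUnion [Fintype X] [Fintype Y] (D : Diagram V X) (D' : Diagram V Y) :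
    (D.disjUnion D').necklaces = D.necklaces + D'.necklaces := by
  classical
  rw [necklaces_eq, necklaces_eq, necklaces_eq]
  have h := map_univ_equiv (orbitSumEquiv D.next D'.next) (D.disjUnion D').orbitNecklace
  rw [map_univ_sum] at h
  have hl : (fun c => (D.disjUnion D').orbitNecklace (orbitSumEquiv D.next D'.next (Sum.inl c))) =
      D.orbitNecklace := by
    funext c
    induction c using Quotient.inductionOn with
    | _ x =>
      exact mk_closedPath_of_semiconj D (D.disjUnion D') Sum.inl_injective
        (fun _ => rfl) (fun _ => rfl) x
  have hr : (fun c => (D.disjUnion D').orbitNecklace (orbitSumEquiv D.next D'.next (Sum.inr c))) =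
      D'.orbitNecklace := by
    funext c
    induction c using Quotient.inductionOn with
    | _ x =>
      exact mk_closedPath_of_semiconj D' (D.disjUnion D') Sum.inr_injective
        (fun _ => rfl) (fun _ => rfl) x
  rw [hl, hr] at h
  have h2 : (D.disjUnion D').verts = D.verts + D'.verts := rfl
  rw [h2, Multiset.map_add, add_add_add_comm, h]
  congr!

end Diagram

end

section

namespace Diagram

variable {V : Type u} [Quiver.{v} V] {X : Type*} {Y : Type*}

/-! ### A collection is determined by its necklaces up to isomorphism -/

/-- Equal multisets of values have fibres of equal size, and bijections between the fibres assemble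
to one bijection. -/
theorem exists_equiv_of_map_univ_eq {A B C : Type*} [Fintype A] [Fintype B] (g : A → C)
    (g' : B → C) (h : (Finset.univ : Finset A).val.map g = (Finset.univ : Finset B).val.map g') :
    ∃ e : A ≃ B, ∀ a, g' (e a) = g a := by
  classical
  have hc : ∀ c, Nonempty ({a // g a = c} ≃ {b // g' b = c}) := by
    intro c
    refine Fintype.card_eq.mp ?_
    have := congrArg (Multiset.count c) h
    rw [Multiset.count_map, Multiset.count_map] at this
    rw [Fintype.card_subtype, Fintype.card_subtype]
    simpa [eq_comm, Finset.card_def] using this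
  exact ⟨Equiv.ofFiberEquiv fun c => (hc c).some, fun a => Equiv.ofFiberEquiv_map _ a⟩

theorem iterate_eq_iterate_iff [Finite X] (f : Equiv.Perm X) (x : X) (m n : ℕ) :
    f^[m] x = f^[n] x ↔ m ≡ n [MOD Function.minimalPeriod f x] := by
  have hp := Function.minimalPeriod_pos_of_mem_periodicPts (mem_periodicPts f x)
  rw [← Function.iterate_mod_minimalPeriod_eq (n := m),
    ← Function.iterate_mod_minimalPeriod_eq (n := n),
    Function.iterate_eq_iterate_iff_of_lt_minimalPeriod (Nat.mod_lt _ hp) (Nat.mod_lt _ hp)]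
  rfl

/-- If two orbits carry the same cyclic word, then the word of the first can be read off the
second one from a suitable starting point. -/
theorem exists_start_of_cycle_eq {A : Type*} [Finite X] [Finite Y] (f : Equiv.Perm X)
    (g : Equiv.Perm Y) (a : X → A) (b : Y → A) (x : X) (y : Y)
    (h : (Function.periodicOrbit f x).map a = (Function.periodicOrbit g y).map b) :
    ∃ m : ℕ, Function.minimalPeriod f x = Function.minimalPeriod g (g^[m] y) ∧
      ∀ i, b (g^[i] (g^[m] y)) = a (f^[i] x) := by
  have hp := Function.minimalPeriod_pos_of_mem_periodicPts (mem_periodicPts f x)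
  rw [Function.periodicOrbit, Function.periodicOrbit, Cycle.map_coe, Cycle.map_coe,
    Cycle.coe_eq_coe] at h
  have hl : Function.minimalPeriod f x = Function.minimalPeriod g y := by
    simpa using h.perm.length_eq
  obtain ⟨m, hm⟩ := h.symm
  have hm' : ∀ m, Function.minimalPeriod g (g^[m] y) = Function.minimalPeriod g y :=
    fun m => Function.minimalPeriod_apply_iterate (mem_periodicPts g y) m
  refine ⟨m, hl.trans (hm' m).symm, ?_⟩
  have key : ∀ i < Function.minimalPeriod f x, b (g^[i] (g^[m] y)) = a (f^[i] x) := by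
    intro i hi
    have h2 := congrArg (fun l => l[i]?) hm
    rw [List.getElem?_rotate (by simpa [← hl] using hi)] at h2
    simp only [List.length_map, List.length_range, List.getElem?_map,
      List.getElem?_range (Nat.mod_lt _ (hl ▸ hp)), List.getElem?_range hi,
      Option.map_some, Option.some.injEq,
      Function.iterate_mod_minimalPeriod_eq] at h2
    rwa [← Function.iterate_add_apply]
  intro i
  rw [← Function.iterate_mod_minimalPeriod_eq (x := g^[m] y), hm', ← hl,
    ← Function.iterate_mod_minimalPeriod_eq (x := x)]
  exact key _ (Nat.mod_lt _ hp)

/-- Labelled permutations with the same multiset of cyclic words are conjugate. -/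
theorem exists_equiv_of_orbits_eq {A : Type*} [Fintype X] [Fintype Y] (f : Equiv.Perm X)
    (g : Equiv.Perm Y) (a : X → A) (b : Y → A) [Fintype (Orbit f)] [Fintype (Orbit g)]
    (h : (Finset.univ : Finset (Orbit f)).val.map
        (fun c => (Function.periodicOrbit f c.out).map a) =
      (Finset.univ : Finset (Orbit g)).val.map
        (fun c => (Function.periodicOrbit g c.out).map b)) :
    ∃ e : X ≃ Y, (∀ x, g (e x) = e (f x)) ∧ ∀ x, b (e x) = a x := by
  obtain ⟨σ, hσ⟩ := exists_equiv_of_map_univ_eq _ _ h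
  choose m hm1 hm2 using fun c => exists_start_of_cycle_eq f g a b c.out (σ c).out (hσ c).symm
  have hs : ∀ x : X, ∃ i : ℕ, f^[i] (Quotient.mk (Equiv.Perm.SameCycle.setoid f) x).out = x := by
    intro x
    have : f.SameCycle (Quotient.mk (Equiv.Perm.SameCycle.setoid f) x).out x :=
      Quotient.exact (Quotient.out_eq (Quotient.mk (Equiv.Perm.SameCycle.setoid f) x))
    obtain ⟨n, -, -, hn⟩ := this.exists_pow_eq''
    exact ⟨n, by rwa [Equiv.Perm.coe_pow] at hn⟩
  choose s hs using hs
  let start : Orbit f → Y := fun c => g^[m c] (σ c).out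
  have hstart : ∀ c i, (Quotient.mk (Equiv.Perm.SameCycle.setoid g) (g^[i] (start c))) = σ c := by
    intro c i
    conv_rhs => rw [← Quotient.out_eq (σ c)]
    refine Quotient.sound (Equiv.Perm.SameCycle.symm ⟨(i + m c : ℕ), ?_⟩)
    rw [zpow_natCast, Equiv.Perm.coe_pow, Function.iterate_add_apply]
  -- Each orbit of `f` is wrapped around the matching orbit of `g`, beginning at the point `start c`
  -- from which the labels agree. The exponent `s x` is an arbitrary choice.
  let e : X → Y := fun x => g^[s x] (start (Quotient.mk _ x))
  have hmk : ∀ (c : Orbit f) i, Quotient.mk (Equiv.Perm.SameCycle.setoid f) (f^[i] c.out) = c := by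
    intro c i
    conv_rhs => rw [← Quotient.out_eq c]
    refine Quotient.sound (Equiv.Perm.SameCycle.symm ⟨i, ?_⟩)
    rw [zpow_natCast, Equiv.Perm.coe_pow]
  have he : ∀ (c : Orbit f) i, e (f^[i] c.out) = g^[i] (start c) := by
    intro c i
    have h1 : f^[s (f^[i] c.out)] c.out = f^[i] c.out := by
      have := hs (f^[i] c.out)
      rwa [hmk c i] at this
    -- Two exponents that reach the same point differ by a multiple of the period, and matched
    -- orbits have equal periods; so the choice of `s` does not matter.
    rw [iterate_eq_iterate_iff, hm1 c, ← iterate_eq_iterate_iff] at h1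
    change g^[s (f^[i] c.out)] (start (Quotient.mk _ (f^[i] c.out))) = _
    rw [hmk c i]
    exact h1
  have hx : ∀ x : X, ∃ (c : Orbit f) (i : ℕ), x = f^[i] c.out := fun x => ⟨_, _, (hs x).symm⟩
  have hbij : Function.Bijective e := by
    constructor
    · intro x y hxy
      obtain ⟨c, i, rfl⟩ := hx x
      obtain ⟨d, j, rfl⟩ := hx y
      rw [he, he] at hxy
      have hcd : c = d := σ.injective (by rw [← hstart c i, ← hstart d j, hxy])
      subst hcd
      rw [iterate_eq_iterate_iff] at hxy ⊢
      rwa [hm1 c]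
    · intro y
      set c := σ.symm (Quotient.mk _ y) with hc
      have h1 : g.SameCycle (start c) y := by
        have := hstart c 0
        rw [hc, σ.apply_symm_apply] at this
        exact Quotient.exact this
      obtain ⟨n, -, -, hn⟩ := h1.exists_pow_eq''
      exact ⟨f^[n] c.out, by rw [he, ← hn, Equiv.Perm.coe_pow]⟩
  refine ⟨Equiv.ofBijective e hbij, fun x => ?_, fun x => ?_⟩
  · obtain ⟨c, i, rfl⟩ := hx x
    rw [Equiv.ofBijective_apply, Equiv.ofBijective_apply, ← Function.iterate_succ_apply' f, he,
      he, Function.iterate_succ_apply']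
  · obtain ⟨c, i, rfl⟩ := hx x
    rw [Equiv.ofBijective_apply, he]
    exact hm2 c i

theorem disjSum_inj {A B : Type*} {s s' : Multiset A} {t t' : Multiset B}
    (h : s.map Sum.inl + t.map Sum.inr = s'.map Sum.inl + t'.map Sum.inr) : s = s' ∧ t = t' := by
  have hl := congrArg (Multiset.filterMap Sum.getLeft?) h
  have hr := congrArg (Multiset.filterMap Sum.getRight?) h
  have h1 : ∀ u : Multiset A, Multiset.filterMap (Sum.getLeft? ∘ Sum.inl (β := B)) u = u :=
    fun u => Multiset.filterMap_some u
  have h2 : ∀ u : Multiset B, Multiset.filterMap (Sum.getRight? ∘ Sum.inr (α := A)) u = u :=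
    fun u => Multiset.filterMap_some u
  have h3 : ∀ u : Multiset A, Multiset.filterMap (Sum.getRight? ∘ Sum.inl (β := B)) u = 0 :=
    fun u => Multiset.eq_zero_of_forall_notMem fun b => by simp [Multiset.mem_filterMap]
  have h4 : ∀ u : Multiset B, Multiset.filterMap (Sum.getLeft? ∘ Sum.inr (α := A)) u = 0 :=
    fun u => Multiset.eq_zero_of_forall_notMem fun b => by simp [Multiset.mem_filterMap]
  simp only [Multiset.filterMap_add, Multiset.filterMap_map, h1, h2, h3, h4, add_zero,
    zero_add] at hl hr
  exact ⟨hl, hr⟩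

theorem map_word_necklaces [Fintype X] (D : Diagram V X) [Fintype (Orbit D.next)] :
    D.necklaces.map Necklace.word = ((Finset.univ : Finset (Orbit D.next)).val.map
        fun c => (Function.periodicOrbit D.next c.out).map D.edge).map Sum.inl +
        D.verts.map Sum.inr := by
  rw [necklaces, Multiset.map_add, Multiset.map_map, Multiset.map_map, Multiset.map_map]
  refine congrArg₂ (· + ·) ?_ ?_
  · exact Eq.trans (Multiset.map_congr rfl fun c _ => D.word_closedPath c.out) (by congr!)
  · exact Multiset.map_congr rfl fun a _ => Necklace.word_vertex a

/-- `star` and `PhiW` are defined on one chosen representative of each monomial. This lemma is what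
makes their formulas valid for every collection. -/
theorem iso_of_necklaces_eq [Fintype X] [Fintype Y] (D : Diagram V X) (D' : Diagram V Y)
    (h : D.necklaces = D'.necklaces) : D.Iso D' := by
  classical
  have h1 := congrArg (Multiset.map Necklace.word) h
  rw [map_word_necklaces, map_word_necklaces] at h1
  obtain ⟨h2, h3⟩ := disjSum_inj h1
  obtain ⟨e, he, he'⟩ := exists_equiv_of_orbits_eq D.next D'.next D.edge D'.edge h2
  exact Iso.of_equiv e he he' h3

end Diagram

/-! ### Monomials and their representatives -/

section Monomials

variable {V : Type u} [Quiver.{v} V]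

open HDiagram (arrows)

theorem finRotate_iterate_zero (n : ℕ) (i : ℕ) (hi : i < n + 1) :
    (finRotate (n + 1))^[i] 0 = ⟨i, hi⟩ := by
  induction i with
  | zero => rfl
  | succ i ih =>
    rw [Function.iterate_succ_apply', ih (by omega)]
    exact finRotate_of_lt (by omega)

theorem minimalPeriod_finRotate (n : ℕ) :
    Function.minimalPeriod (finRotate (n + 1)) (0 : Fin (n + 1)) = n + 1 := by
  refine le_antisymm (Function.IsPeriodicPt.minimalPeriod_le (by omega) ?_) ?_
  · change (finRotate (n + 1))^[n + 1] 0 = 0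
    rw [Function.iterate_succ_apply', finRotate_iterate_zero n n (by omega)]
    exact finRotate_last'
  · by_contra h
    have hp := Function.minimalPeriod_pos_of_mem_periodicPts
      (Diagram.mem_periodicPts (finRotate (n + 1)) 0)
    have := Function.iterate_minimalPeriod (f := finRotate (n + 1)) (x := (0 : Fin (n + 1)))
    rw [finRotate_iterate_zero n _ (by omega), Fin.ext_iff] at this
    simp at this
    omega

theorem subsingleton_orbit_finRotate (n : ℕ) : Subsingleton (Diagram.Orbit (finRotate (n + 1))) := by
  refine ⟨fun c d => ?_⟩
  have h : ∀ c : Diagram.Orbit (finRotate (n + 1)), Quotient.mk _ 0 = c := by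
    rintro ⟨x⟩
    refine Quotient.sound ⟨(x : ℕ), ?_⟩
    rw [zpow_natCast, Equiv.Perm.coe_pow, finRotate_iterate_zero n x x.2]
  rw [← h c, ← h d]

theorem map_univ_orbit_finRotate {A : Type*} (L : List A) (hL : L ≠ [])
    [Fintype (Diagram.Orbit (finRotate L.length))] :
    (Finset.univ : Finset (Diagram.Orbit (finRotate L.length))).val.map
      (fun c => (Function.periodicOrbit (finRotate L.length) c.out).map L.get) = {(L : Cycle A)} := by
  cases L with
  | nil => exact absurd rfl hL
  | cons a L =>
    have hs := subsingleton_orbit_finRotate L.length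
    let c₀ : Diagram.Orbit (finRotate (a :: L).length) := Quotient.mk _ (0 : Fin (L.length + 1))
    have hu : (Finset.univ : Finset (Diagram.Orbit (finRotate (a :: L).length))) = {c₀} := by
      ext c
      simp only [Finset.mem_univ, Finset.mem_singleton, true_iff]
      exact hs.elim _ _
    rw [hu, Finset.singleton_val, Multiset.map_singleton, Multiset.singleton_inj]
    have hc : (finRotate (L.length + 1)).SameCycle 0 c₀.out :=
      (Quotient.exact (Quotient.out_eq c₀)).symm
    obtain ⟨n, -, -, hn⟩ := hc.exists_pow_eq''
    change Cycle.map _ (Function.periodicOrbit (finRotate (L.length + 1)) _) = _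
    rw [← hn, Equiv.Perm.coe_pow,
      Function.periodicOrbit_apply_iterate_eq (Diagram.mem_periodicPts _ _),
      Function.periodicOrbit, minimalPeriod_finRotate, Cycle.map_coe, List.map_map]
    congr 1
    refine List.ext_getElem (by simp) fun i h1 h2 => ?_
    simp only [List.length_map, List.length_range] at h1
    simp only [List.getElem_map, List.getElem_range, Function.comp_apply]
    rw [finRotate_iterate_zero _ i h1]
    rfl

theorem necklaces_ofClosedPath (x : ClosedPath V) :
    (HDiagram.ofClosedPath x).diag.necklaces = {Necklace.mk x} := by
  classical
  apply Multiset.map_injective Necklace.word_injective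
  rw [Diagram.map_word_necklaces, Multiset.map_singleton]
  have hw : (Necklace.mk x).word = x.word := rfl
  rw [hw, ClosedPath.word]
  obtain ⟨a, p⟩ := x
  split_ifs with h
  · obtain rfl := eq_nil_of_arrows_eq_nil p h
    have : IsEmpty (Diagram.Orbit (HDiagram.ofClosedPath ⟨a, .nil⟩).diag.next) :=
      ⟨fun c => (c.out : Fin 0).elim0⟩
    have hv : (HDiagram.ofClosedPath (⟨a, .nil⟩ : ClosedPath V)).diag.verts = {a} := by
      simp [HDiagram.ofClosedPath, arrows]
    rw [hv, Finset.univ_eq_empty]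
    rfl
  · have hv : (HDiagram.ofClosedPath (⟨a, p⟩ : ClosedPath V)).diag.verts = 0 := if_neg h
    rw [hv, Multiset.map_zero, add_zero]
    exact congrArg (Multiset.map Sum.inl) (map_univ_orbit_finRotate (arrows p) h)

theorem HDiagram.necklaces_mul (D D' : HDiagram V) :
    (D * D').diag.necklaces = D.diag.necklaces + D'.diag.necklaces :=
  (Diagram.necklaces_relabel _ _).trans (Diagram.necklaces_disjUnion _ _)

theorem HDiagram.necklaces_one : (1 : HDiagram V).diag.necklaces = 0 := by
  classical
  have : IsEmpty (Diagram.Orbit (1 : HDiagram V).diag.next) :=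
    ⟨fun c => (c.out : Fin 0).elim0⟩
  rw [Diagram.necklaces_eq, Finset.univ_eq_empty]
  rfl

theorem HDiagram.necklaces_ofMonomial (m : Necklace V →₀ ℕ) :
    (HDiagram.ofMonomial m).diag.necklaces = Finsupp.toMultiset m := by
  have key : ∀ g : Necklace V → HDiagram V, (∀ n, (g n).diag.necklaces = {n}) →
      ∀ L : List (Necklace V), (L.map g).prod.diag.necklaces = (L : Multiset (Necklace V)) := by
    intro g hg L
    induction L with
    | nil => exact necklaces_one
    | cons n L ih =>
      rw [List.map_cons, List.prod_cons, necklaces_mul, ih, hg]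
      rfl
  refine (key (fun n => ofClosedPath (Quot.out n)) (fun n => ?_) _).trans
    (Multiset.coe_toList _)
  rw [necklaces_ofClosedPath]
  exact congrArg _ (Quot.out_eq n)

open Classical in
/-- The exponent of the monomial of `Sym L` given by a collection. -/
noncomputable def Diagram.exponent {X : Type*} [Fintype X] (D : Diagram V X) : Necklace V →₀ ℕ :=
  Multiset.toFinsupp D.necklaces

theorem Diagram.sym_eq_monomial (R : Type w) [CommSemiring R] {X : Type*} [Fintype X]
    (D : Diagram V X) :
    D.sym R = MvPolynomial.monomial D.exponent 1 := by
  classical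
  rw [sym, exponent]
  induction D.necklaces using Multiset.induction with
  | empty => simp
  | cons n s ih =>
    rw [Multiset.map_cons, Multiset.prod_cons, ih, ← Multiset.singleton_add, map_add,
      Multiset.toFinsupp_singleton, MvPolynomial.X, MvPolynomial.monomial_mul, one_mul]

theorem Diagram.sym_relabel (R : Type w) [CommSemiring R] {X Y : Type*} [Fintype X] [Fintype Y]
    (D : Diagram V X) (e : X ≃ Y) : (D.relabel e).sym R = D.sym R := by
  rw [sym, sym, necklaces_relabel]

theorem Diagram.Iso.sym_eq (R : Type w) [CommSemiring R] {X Y : Type*} {_ : Fintype X}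
    {_ : Fintype Y}
    {D : Diagram V X} {D' : Diagram V Y} (h : D.Iso D') : D.sym R = D'.sym R := by
  obtain ⟨e, rfl⟩ := h
  rw [sym_relabel]

theorem HDiagram.sym_ofMonomial (R : Type w) [CommSemiring R] (m : Necklace V →₀ ℕ) :
    (HDiagram.ofMonomial m).diag.sym R = MvPolynomial.monomial m 1 := by
  classical
  rw [Diagram.sym_eq_monomial, Diagram.exponent, necklaces_ofMonomial, Finsupp.toMultiset_toFinsupp]

theorem Diagram.iso_ofMonomial {X : Type*} [Fintype X] (D : Diagram V X) :
    D.Iso (HDiagram.ofMonomial D.exponent).diag :=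
  iso_of_necklaces_eq _ _ (by
    classical rw [HDiagram.necklaces_ofMonomial, exponent, Multiset.toFinsupp_toMultiset])

end Monomials

end

section

namespace Diagram

variable {V : Type u} [Quiver.{v} V] {X : Type*} {Y : Type*}

/-! ### First return maps -/

/-- Together with `returnPerm_eq` this characterizes the first return without reference to
`Nat.find`. -/
theorem returnPerm_spec [Finite X] (f : Equiv.Perm X) (S : Set X) (x : S) :
    ∃ n : ℕ, (returnPerm f S x : X) = f^[n + 1] x ∧ ∀ m < n, f^[m + 1] x ∉ S := by
  classical
  exact ⟨Nat.find (exists_return f S x), by simp only [returnPerm, Equiv.ofBijective_apply,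
    returnFun], fun m hm => Nat.find_min (exists_return f S x) hm⟩

theorem returnPerm_eq [Finite X] (f : Equiv.Perm X) (S : Set X) (x : S) (n : ℕ)
    (hn : f^[n + 1] x ∈ S) (hm : ∀ m < n, f^[m + 1] x ∉ S) :
    (returnPerm f S x : X) = f^[n + 1] x := by
  obtain ⟨k, hk, hk'⟩ := returnPerm_spec f S x
  rw [hk]
  rcases lt_trichotomy k n with h | h | h
  · exact absurd (hk ▸ (returnPerm f S x).2) (hm k h)
  · rw [h]
  · exact absurd hn (hk' n h)

theorem sameCycle_iterate (f : Equiv.Perm X) (x : X) (n : ℕ) : f.SameCycle x (f^[n] x) :=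
  ⟨n, by rw [zpow_natCast, Equiv.Perm.coe_pow]⟩

theorem exists_iterate_of_sameCycle [Finite X] {f : Equiv.Perm X} {x y : X}
    (h : f.SameCycle x y) : ∃ n : ℕ, f^[n] x = y := by
  obtain ⟨n, -, -, hn⟩ := h.exists_pow_eq''
  exact ⟨n, by rwa [Equiv.Perm.coe_pow] at hn⟩

theorem sameCycle_returnPerm_iff [Finite X] (f : Equiv.Perm X) (S : Set X) (x y : S) :
    (returnPerm f S).SameCycle x y ↔ f.SameCycle x y := by
  constructor
  · intro h
    obtain ⟨n, rfl⟩ := exists_iterate_of_sameCycle h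
    induction n with
    | zero => exact Equiv.Perm.SameCycle.refl _ _
    | succ n ih =>
      rw [Function.iterate_succ_apply']
      obtain ⟨k, hk, -⟩ := returnPerm_spec f S ((returnPerm f S)^[n] x)
      rw [hk]
      exact (ih (sameCycle_iterate _ _ _)).trans (sameCycle_iterate _ _ _)
  · intro h
    obtain ⟨n, hn⟩ := exists_iterate_of_sameCycle h
    clear h
    -- Induction on the number of steps of `f` from `x` to `y`: since `y` lies in `S`, the first
    -- return of `x` comes no later, and it uses up at least one step.
    induction n using Nat.strong_induction_on generalizing x with
    | _ n ih =>
      rcases n with _ | n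
      · rw [Subtype.ext (a1 := x) (a2 := y) hn]
      · obtain ⟨k, hk, hk'⟩ := returnPerm_spec f S x
        have hle : k ≤ n := by
          by_contra hlt
          exact hk' n (by omega) (hn ▸ y.2)
        have := ih (n - k) (by omega) (returnPerm f S x) (by
          rw [hk, ← Function.iterate_add_apply, ← hn]
          congr 1
          omega)
        exact (Equiv.Perm.sameCycle_apply_left).mp this

theorem returnPerm_semiconj [Finite X] [Finite Y] (f : Equiv.Perm X) (g : Equiv.Perm Y)
    (e : X → Y) (h : ∀ x, g (e x) = e (f x)) (S : Set X) (T : Set Y)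
    (hST : ∀ x, e x ∈ T ↔ x ∈ S) (x : S) (y : T) (hxy : (y : Y) = e x) :
    (returnPerm g T y : Y) = e (returnPerm f S x) := by
  obtain ⟨n, hn, hm⟩ := returnPerm_spec f S x
  have hi : ∀ n, g^[n] y = e (f^[n] x) := fun n => by
    rw [hxy]
    exact ((Function.Semiconj.iterate_right (f := e) (ga := f) (gb := g)
      (fun x => (h x).symm) n).eq x).symm
  rw [hn, ← hi]
  refine returnPerm_eq g T y n ?_ fun m hmn => ?_
  · rw [hi, hST, ← hn]
    exact (returnPerm f S x).2
  · rw [hi, hST]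
    exact hm m hmn

/-- A first return map of a first return map is a first return map. -/
theorem returnPerm_returnPerm [Finite X] (f : Equiv.Perm X) (Z S : Set X) (T : Set Z)
    (hSZ : S ⊆ Z) (hT : ∀ z : Z, z ∈ T ↔ (z : X) ∈ S) (t : T) (s : S) (hts : (s : X) = t) :
    (returnPerm f S s : X) = (returnPerm (returnPerm f Z) T t : Z) := by
  -- As long as the returns to `Z` stay outside `T`, the path of `f` does not meet `S`: between the
  -- returns it is outside `Z`, which contains `S`.
  have key : ∀ (n : ℕ) (z : Z), (∀ m < n, (returnPerm f Z)^[m + 1] z ∉ T) →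
      ∃ N, ((returnPerm f Z)^[n + 1] z : X) = f^[N + 1] z ∧ ∀ M < N, f^[M + 1] (z : X) ∉ S := by
    intro n z
    induction n with
    | zero =>
      intro _
      obtain ⟨N, hN, hM⟩ := returnPerm_spec f Z z
      exact ⟨N, hN, fun M h h' => hM M h (hSZ h')⟩
    | succ n ih =>
      intro hz
      obtain ⟨N, hN, hM⟩ := ih fun m hm => hz m (by omega)
      obtain ⟨K, hK, hK'⟩ := returnPerm_spec f Z ((returnPerm f Z)^[n + 1] z)
      refine ⟨K + 1 + N, ?_, fun M h => ?_⟩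
      · rw [Function.iterate_succ_apply', hK, hN, ← Function.iterate_add_apply]
        rfl
      · rcases lt_trichotomy M N with h1 | h1 | h1
        · exact hM M h1
        · rw [h1, ← hN, ← hT]
          exact hz n (by omega)
        · intro h2
          refine hK' (M - N - 1) (by omega) (hSZ ?_)
          rw [hN, ← Function.iterate_add_apply]
          convert h2 using 2
          omega
  obtain ⟨n, hn, hm⟩ := returnPerm_spec (returnPerm f Z) T t
  obtain ⟨N, hN, hM⟩ := key n t hm
  rw [hn, hN, ← hts]
  refine returnPerm_eq f S s N ?_ fun M h => ?_
  · rw [hts, ← hN, ← hT, ← hn]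
    exact (returnPerm (returnPerm f Z) T t).2
  · rw [hts]
    exact hM M h

/-! ### Sums over orbits -/

open Classical in
-- Tool for comparing vertex idempotents: `p` and `q` select the orbits that disappear, `F` and `G`
-- read off their vertex. The map `e` needs to match only selected orbits, so it may be an inclusion
-- that misses all others.
theorem sum_orbits_eq {M : Type*} [AddCommMonoid M] {f : Equiv.Perm X} {g : Equiv.Perm Y}
    [Fintype (Orbit f)] [Fintype (Orbit g)] (e : Y → X) (p : X → Prop) (q : Y → Prop)
    (hp : ∀ x x', f.SameCycle x x' → p x → p x') (hq : ∀ y y', g.SameCycle y y' → q y → q y')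
    (he : ∀ y y', q y → q y' → (g.SameCycle y y' ↔ f.SameCycle (e y) (e y')))
    (hpq : ∀ y, q y → p (e y)) (hs : ∀ x, p x → ∃ y, q y ∧ f.SameCycle (e y) x)
    (F : X → M) (G : Y → M) (hF : ∀ x x', p x → f.SameCycle x x' → F x = F x')
    (hFG : ∀ y, q y → F (e y) = G y) :
    ∑ c : Orbit g with q c.out, G c.out = ∑ c : Orbit f with p c.out, F c.out := by
  have hof : ∀ x : X, f.SameCycle (Quotient.mk (Equiv.Perm.SameCycle.setoid f) x).out x :=
    fun x => Quotient.exact (Quotient.out_eq (Quotient.mk (Equiv.Perm.SameCycle.setoid f) x))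
  have hog : ∀ y : Y, g.SameCycle (Quotient.mk (Equiv.Perm.SameCycle.setoid g) y).out y :=
    fun y => Quotient.exact (Quotient.out_eq (Quotient.mk (Equiv.Perm.SameCycle.setoid g) y))
  refine Finset.sum_bij (fun c _ => Quotient.mk _ (e c.out)) ?_ ?_ ?_ ?_
  · intro c hc
    simp only [Finset.mem_filter, Finset.mem_univ, true_and] at hc ⊢
    exact hp _ _ (hof _).symm (hpq _ hc)
  · intro c hc d hd h
    simp only [Finset.mem_filter, Finset.mem_univ, true_and] at hc hd
    have := (he _ _ hc hd).mpr (Quotient.exact h)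
    rw [← Quotient.out_eq c, ← Quotient.out_eq d]
    exact Quotient.sound this
  · intro c hc
    simp only [Finset.mem_filter, Finset.mem_univ, true_and] at hc
    obtain ⟨y, hy, hyc⟩ := hs _ hc
    have hy' := hq _ _ (hog y).symm hy
    refine ⟨Quotient.mk _ y, by simpa using hy', ?_⟩
    conv_rhs => rw [← Quotient.out_eq c]
    exact Quotient.sound (((he _ _ hy' hy).mp (hog y)).trans hyc)
  · intro c hc
    simp only [Finset.mem_filter, Finset.mem_univ, true_and] at hc
    rw [← hFG _ hc]
    exact hF _ _ (hpq _ hc) (hof _).symm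

/-! ### Cutting -/

/-- The permutation `f` of the cutting and gluing procedure: `f x = x + 1` for an edge which is not
cut, and `f x = φ x + 1` for an edge which is cut. -/
abbrev glued (D : Diagram V X) (τ : Equiv.Perm X) : Equiv.Perm X := τ.trans D.next

/-- The abstract edge `x` lies on an orbit which consists of cut edges only. -/
def Lost (D : Diagram V X) (τ : Equiv.Perm X) (x : X) : Prop :=
  ∀ y, (D.glued τ).SameCycle x y → τ y ≠ y

theorem Lost.of_sameCycle {D : Diagram V X} {τ : Equiv.Perm X} (x x' : X)
    (h : (D.glued τ).SameCycle x x') (hx : D.Lost τ x) : D.Lost τ x' :=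
  fun y hy => hx y (h.trans hy)

/-- The glued successor of a cut edge starts at the same vertex (`glue_left`), so an orbit of cut
edges never leaves its vertex. The idempotent it produces does not depend on the representative. -/
theorem Lost.left_eq [Finite X] {D : Diagram V X} {τ : Equiv.Perm X} (hτ : D.IsGluing τ)
    (x x' : X) (hx : D.Lost τ x) (h : (D.glued τ).SameCycle x x') :
    (D.edge x).left = (D.edge x').left := by
  obtain ⟨n, rfl⟩ := exists_iterate_of_sameCycle h
  clear h
  induction n with
  | zero => rfl
  | succ n ih =>
    rw [ih, Function.iterate_succ_apply']
    exact (D.glue_left hτ _ (hx _ (sameCycle_iterate _ _ _))).symm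

open Classical in
theorem cut_verts [Fintype X] (D : Diagram V X) (τ : Equiv.Perm X) (hτ : D.IsGluing τ)
    [Fintype (Orbit (D.glued τ))] :
    (D.cut τ hτ).verts = D.verts +
      ∑ c : Orbit (D.glued τ) with D.Lost τ c.out, {(D.edge c.out).left} := by
  have hs : ∑ c : Orbit (D.glued τ) with D.Lost τ c.out, {(D.edge c.out).left} =
      ((Finset.univ.filter fun c : Orbit (D.glued τ) => D.Lost τ c.out).val.map
        fun c => (D.edge c.out).left) := by
    rw [← Multiset.sum_map_singleton (Multiset.map _ _), Multiset.map_map]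
    rfl
  rw [hs]
  refine congrArg (D.verts + ·) (congrArg (Multiset.map _) ?_)
  have : ∀ c : Orbit (D.glued τ),
      (∀ x, Quotient.mk _ x = c → τ x ≠ x) ↔ D.Lost τ c.out := fun c => by
    refine forall_congr' fun x => ?_
    have : Quotient.mk _ x = c ↔ (D.glued τ).SameCycle c.out x :=
      ⟨fun h => Quotient.exact ((Quotient.out_eq c).trans h.symm),
        fun h => (Quotient.sound h).symm.trans (Quotient.out_eq c)⟩
    rw [this]
  simp only [this]
  congr!

theorem Iso.cut [Fintype X] [Fintype Y] (D : Diagram V X) (e : X ≃ Y) (τ : Equiv.Perm X)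
    (σ : Equiv.Perm Y) (hτ : D.IsGluing τ) (hσ : (D.relabel e).IsGluing σ)
    (h : ∀ x, σ (e x) = e (τ x)) : (D.cut τ hτ).Iso ((D.relabel e).cut σ hσ) := by
  classical
  have hs : ∀ x, ((D.relabel e).glued σ) (e x) = e ((D.glued τ) x) := fun x => by
    simp only [glued, Equiv.trans_apply, h, relabel_next_apply]
  have hfix : ∀ x, τ x = x ↔ σ (e x) = e x := fun x => by rw [h, e.injective.eq_iff]
  refine Iso.of_equiv (e.subtypeEquiv hfix) (fun x => ?_) (fun x => ?_) ?_
  · apply Subtype.ext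
    exact returnPerm_semiconj (D.glued τ) ((D.relabel e).glued σ) e hs
      {x | τ x = x} {y | σ y = y} (fun x => (hfix x).symm) x _ rfl
  · exact D.relabel_edge_apply e x
  · rw [cut_verts, cut_verts]
    have hsc : ∀ x y, ((D.relabel e).glued σ).SameCycle (e x) (e y) ↔
        (D.glued τ).SameCycle x y := fun x y => sameCycle_iff_of_semiconj e.injective hs
    have hlost : ∀ x, D.Lost τ x ↔ (D.relabel e).Lost σ (e x) := fun x => by
      refine e.forall_congr fun y => ?_
      rw [hsc, Ne, Ne, hfix]
    refine congrArg₂ (· + ·) rfl (sum_orbits_eq e _ _ Lost.of_sameCycle Lost.of_sameCycle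
      (fun y y' _ _ => (hsc y y').symm) (fun y => (hlost y).mp) (fun x hx => ?_)
      (fun y => {((D.relabel e).edge y).left}) (fun x => {(D.edge x).left}) ?_ ?_)
    · obtain ⟨y, rfl⟩ := e.surjective x
      exact ⟨y, (hlost y).mpr hx, Equiv.Perm.SameCycle.refl _ _⟩
    · intro x x' hx hxx'
      exact congrArg _ (hx.left_eq hσ x x' hxx')
    · intro y _
      rw [relabel_edge_apply]

theorem isGluing_one (D : Diagram V X) : D.IsGluing 1 :=
  ⟨fun _ => rfl, fun _ h => absurd rfl h⟩

theorem cut_one_iso [Fintype X] (D : Diagram V X) : (D.cut 1 D.isGluing_one).Iso D := by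
  classical
  refine Iso.of_equiv (Equiv.subtypeUnivEquiv fun _ => rfl) (fun x => ?_) (fun x => rfl) ?_
  · exact (returnPerm_eq (D.glued 1) {x | (1 : Equiv.Perm X) x = x} x 0 rfl
      fun m hm => absurd hm (by omega)).symm
  · rw [cut_verts, Finset.filter_false_of_mem, Finset.sum_empty, add_zero]
    exact fun c _ h => h _ (Equiv.Perm.SameCycle.refl _ _) rfl

theorem iterate_eq_of_avoids {f g : Equiv.Perm X} {Z : Set X} (h : ∀ x, x ∉ Z → f x = g x)
    {x : X} (n : ℕ) (hx : ∀ m < n, f^[m] x ∉ Z) : f^[n] x = g^[n] x := by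
  induction n with
  | zero => rfl
  | succ n ih =>
    rw [Function.iterate_succ_apply', Function.iterate_succ_apply', ← ih fun m hm => hx m (by omega),
      h _ (hx n (by omega))]

theorem sameCycle_of_avoids [Finite X] {f g : Equiv.Perm X} {Z : Set X}
    (h : ∀ x, x ∉ Z → f x = g x) {x y : X} (hx : ∀ y, f.SameCycle x y → y ∉ Z)
    (hy : f.SameCycle x y) : g.SameCycle x y := by
  obtain ⟨n, rfl⟩ := exists_iterate_of_sameCycle hy
  rw [iterate_eq_of_avoids h n fun m _ => hx _ (sameCycle_iterate f x m)]
  exact sameCycle_iterate g x n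

theorem sameCycle_iff_of_avoids [Finite X] {f g : Equiv.Perm X} {Z : Set X}
    (h : ∀ x, x ∉ Z → f x = g x) {x : X} (hx : ∀ y, f.SameCycle x y → y ∉ Z) (y : X) :
    g.SameCycle x y ↔ f.SameCycle x y := by
  refine ⟨fun hy => ?_, sameCycle_of_avoids h hx⟩
  obtain ⟨n, rfl⟩ := exists_iterate_of_sameCycle hy
  rw [← iterate_eq_of_avoids h n fun m _ => hx _ (sameCycle_iterate f x m)]
  exact sameCycle_iterate f x n

/-- `σ` consists of the gluing `τ₁` and the gluing `τ₂` of the edges which are left by `τ₁`. -/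
structure IsComposite (τ₁ : Equiv.Perm X) (τ₂ : Equiv.Perm {x // τ₁ x = x})
    (σ : Equiv.Perm X) : Prop where
  fixed : ∀ z : {x // τ₁ x = x}, σ z = τ₂ z
  moved : ∀ x, τ₁ x ≠ x → σ x = τ₁ x

variable {D : Diagram V X} {τ₁ : Equiv.Perm X} {τ₂ : Equiv.Perm {x // τ₁ x = x}}
  {σ : Equiv.Perm X}

theorem IsComposite.fixed_of_fixed (h : IsComposite τ₁ τ₂ σ) {x : X} (hx : σ x = x) :
    τ₁ x = x := by
  by_contra hx'
  exact hx' ((h.moved x hx').symm.trans hx)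

/-- Away from the edges left by `τ₁`, the glued permutations of `σ` and `τ₁` agree; `τ₂` enters only
in the step that leaves such an edge. Gluing the cut collection thus amounts to a first return map
of the one-step gluing. -/
theorem IsComposite.glued_eq [Fintype X] (h : IsComposite τ₁ τ₂ σ) (h₁ : D.IsGluing τ₁) :
    (D.cut τ₁ h₁).glued τ₂ = returnPerm (D.glued σ) {x | τ₁ x = x} := by
  ext z
  obtain ⟨n, hn, hm⟩ := returnPerm_spec (D.glued τ₁) {x | τ₁ x = x} (τ₂ z)
  have hstep : ∀ x, x ∉ {x | τ₁ x = x} → D.glued τ₁ x = D.glued σ x := fun x hx =>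
    congrArg D.next (h.moved x hx).symm
  have h0 : D.glued σ z = D.glued τ₁ (τ₂ z) :=
    congrArg D.next ((h.fixed z).trans (τ₂ z).2.symm)
  have hit : ∀ m ≤ n, (D.glued σ)^[m + 1] z = (D.glued τ₁)^[m + 1] (τ₂ z) := fun m hmn => by
    rw [Function.iterate_succ_apply, h0, Function.iterate_succ_apply]
    refine (iterate_eq_of_avoids hstep m fun k hk => ?_).symm
    rw [← Function.iterate_succ_apply]
    exact hm k (by omega)
  refine Eq.trans hn (Eq.trans (hit n le_rfl).symm (returnPerm_eq _ _ z n ?_ fun m hmn => ?_).symm)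
  · rw [hit n le_rfl, ← hn]
    exact Subtype.property _
  · rw [hit m hmn.le]
    exact hm m hmn

/-- Cutting in two steps is the same as cutting at once. -/
theorem IsComposite.cut_cut_iso [Fintype X] [Fintype {x // τ₁ x = x}] (h : IsComposite τ₁ τ₂ σ)
    (h₁ : D.IsGluing τ₁) (h₂ : (D.cut τ₁ h₁).IsGluing τ₂) (hσ : D.IsGluing σ) :
    ((D.cut τ₁ h₁).cut τ₂ h₂).Iso (D.cut σ hσ) := by
  classical
  let Z : Set X := {x | τ₁ x = x}
  have hfix : ∀ z : {x // τ₁ x = x}, τ₂ z = z ↔ σ z = z := fun z => by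
    rw [h.fixed, Subtype.ext_iff]
  let e : {z : {x // τ₁ x = x} // τ₂ z = z} ≃ {x // σ x = x} :=
    { toFun := fun z => ⟨z.1.1, (hfix z.1).mp z.2⟩
      invFun := fun x => ⟨⟨x.1, h.fixed_of_fixed x.2⟩, (hfix ⟨x.1, _⟩).mpr x.2⟩
      left_inv := fun _ => rfl
      right_inv := fun _ => rfl }
  refine Iso.of_equiv e (fun z => ?_) (fun z => rfl) ?_
  · apply Subtype.ext
    have := returnPerm_returnPerm (D.glued σ) Z {x | σ x = x} {z | τ₂ z = z}
      (fun x hx => h.fixed_of_fixed hx) hfix z (e z) rfl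
    refine this.trans ?_
    rw [← h.glued_eq h₁]
    rfl
  · have hstep : ∀ x, x ∉ Z → D.glued τ₁ x = D.glued σ x := fun x hx =>
      congrArg D.next (h.moved x hx).symm
    have hsc : ∀ x, D.Lost τ₁ x → ∀ y, (D.glued σ).SameCycle x y ↔ (D.glued τ₁).SameCycle x y :=
      fun x hx => sameCycle_iff_of_avoids hstep fun y hy => hx y hy
    rw [cut_verts, cut_verts, cut_verts, add_assoc]
    refine congrArg (D.verts + ·) ?_
    -- A lost orbit of `σ` either avoids `Z`, and then it is lost in the first cut, or it meets `Z`,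
    -- and then its trace on `Z` is an orbit lost in the second cut.
    rw [← Finset.sum_filter_add_sum_filter_not (Finset.univ.filter
      fun c : Orbit (D.glued σ) => D.Lost σ c.out)
      (fun c : Orbit (D.glued σ) => ∀ y, (D.glued σ).SameCycle c.out y → y ∉ Z),
      Finset.filter_filter, Finset.filter_filter]
    refine congrArg₂ (· + ·) ?_ ?_
    · refine Eq.trans (sum_orbits_eq id
        (fun x => D.Lost σ x ∧ ∀ y, (D.glued σ).SameCycle x y → y ∉ Z) (D.Lost τ₁) ?_ Lost.of_sameCycle
        ?_ ?_ ?_ (fun x => ({(D.edge x).left} : Multiset (Quiver.Symmetrify V))) (fun x => ({(D.edge x).left} : Multiset (Quiver.Symmetrify V))) ?_ (fun _ _ => rfl)) (by congr!)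
      · exact fun x x' hxx' hx => ⟨hx.1.of_sameCycle _ _ hxx', fun y hy => hx.2 y (hxx'.trans hy)⟩
      · exact fun y y' hy _ => (hsc y hy y').symm
      · refine fun y hy => ⟨fun x hx => ?_, fun x hx => ?_⟩
        · have := hy x ((hsc y hy x).mp hx)
          rwa [h.moved x this]
        · exact hy x ((hsc y hy x).mp hx)
      · refine fun x hx => ⟨x, fun y hy => hx.2 y ?_, Equiv.Perm.SameCycle.refl _ _⟩
        exact (sameCycle_iff_of_avoids (fun x hx => (hstep x hx).symm) hx.2 y).mp hy
      · exact fun x x' hx hxx' => congrArg _ (hx.1.left_eq hσ x x' hxx')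
    · have hg : ∀ z z' : {x // τ₁ x = x}, ((D.cut τ₁ h₁).glued τ₂).SameCycle z z' ↔
          (D.glued σ).SameCycle (z : X) z' := fun z z' => by
        rw [h.glued_eq h₁]
        exact sameCycle_returnPerm_iff (D.glued σ) Z z z'
      refine Eq.trans (sum_orbits_eq (Subtype.val : {x // τ₁ x = x} → X)
        (fun x => D.Lost σ x ∧ ¬ ∀ y, (D.glued σ).SameCycle x y → y ∉ Z)
        ((D.cut τ₁ h₁).Lost τ₂) ?_ Lost.of_sameCycle
        ?_ ?_ ?_ (fun x => ({(D.edge x).left} : Multiset (Quiver.Symmetrify V))) (fun z => ({((D.cut τ₁ h₁).edge z).left} :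
          Multiset (Quiver.Symmetrify V))) ?_
        (fun _ _ => rfl)) (by congr!)
      · exact fun x x' hxx' hx => ⟨hx.1.of_sameCycle _ _ hxx',
          fun h' => hx.2 fun y hy => h' y (hxx'.symm.trans hy)⟩
      · exact fun z z' _ _ => hg z z'
      · refine fun z hz => ⟨fun x hx => ?_, fun h' => h' z (Equiv.Perm.SameCycle.refl _ _) z.2⟩
        by_cases hxz : τ₁ x = x
        · have := hz ⟨x, hxz⟩ ((hg z ⟨x, hxz⟩).mpr hx)
          rwa [Ne, hfix] at this
        · rwa [h.moved x hxz]
      · rintro x ⟨hx, hx'⟩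
        push Not at hx'
        obtain ⟨y, hy, hyZ⟩ := hx'
        refine ⟨⟨y, hyZ⟩, fun z hz => ?_, hy.symm⟩
        rw [Ne, hfix]
        exact hx z (hy.trans ((hg _ _).mp hz))
      · exact fun x x' hx hxx' => congrArg _ (hx.1.left_eq hσ x x' hxx')

end Diagram

end

section

namespace Diagram

variable {V : Type u} [Quiver.{v} V] (k : Type w) [Field k] {X : Type*} {Y : Type*}

/-! ### The Wick sum of a collection with heights -/

open Classical in
/-- The coefficient of a gluing `τ` in the Wick sum: each glued pair of edges contributes
`± h / 2`, the sign being that of the lower edge with respect to `r`. -/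
noncomputable def weight [Fintype X] (D : Diagram V X) (r : X → X → Prop) (τ : Equiv.Perm X) :
    Polynomial k :=
  ∏ x, if r x (τ x) then Polynomial.C (1 / 2 : k) * Polynomial.X * (D.edge x).sign (Polynomial k)
    else 1

/-- The gluings of a collection. -/
structure Gluing (D : Diagram V X) where
  perm : Equiv.Perm X
  isGluing : D.IsGluing perm

/-- Gluings as a subtype of the permutations. -/
def gluingEquiv (D : Diagram V X) : D.Gluing ≃ {τ : Equiv.Perm X // D.IsGluing τ} where
  toFun τ := ⟨τ.1, τ.2⟩
  invFun τ := ⟨τ.1, τ.2⟩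
  left_inv _ := rfl
  right_inv _ := rfl

theorem Gluing.ext {D : Diagram V X} {τ σ : D.Gluing} (h : τ.1 = σ.1) : τ = σ := by
  cases τ
  cases h
  rfl

noncomputable instance [Finite X] (D : Diagram V X) : Fintype D.Gluing :=
  have := Finite.of_equiv _ D.gluingEquiv.symm
  Fintype.ofFinite _

open Classical in
/-- The sum over all gluings of a collection whose set of abstract edges is ordered by `r`. -/
noncomputable def wick [Fintype X] (D : Diagram V X) (r : X → X → Prop) : SymL V (Polynomial k) :=
  ∑ τ : D.Gluing, D.weight k r τ.1 • (D.cut τ.1 τ.2).sym (Polynomial k)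

theorem isGluing_relabel_iff (D : Diagram V X) (e : X ≃ Y) (τ : Equiv.Perm X) :
    D.IsGluing τ ↔ (D.relabel e).IsGluing (e.permCongr τ) := by
  refine and_congr ?_ ?_
  · refine e.forall_congr fun x => ?_
    simp
  · refine e.forall_congr fun x => ?_
    simp [relabel]

theorem wick_relabel [Fintype X] [Fintype Y] (D : Diagram V X) (e : X ≃ Y) (r : Y → Y → Prop) :
    (D.relabel e).wick k r = D.wick k fun x y => r (e x) (e y) := by
  classical
  rw [wick, wick]
  refine (Fintype.sum_equiv (D.gluingEquiv.trans ((e.permCongr.subtypeEquiv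
    (D.isGluing_relabel_iff e)).trans (D.relabel e).gluingEquiv.symm)) _ _ fun τ => ?_).symm
  refine congrArg₂ (· • ·) ?_ ?_
  · refine Fintype.prod_equiv e _ _ fun x => ?_
    simp [relabel_edge_apply, gluingEquiv]
  · exact Iso.sym_eq _ (Iso.cut D e _ _ _ _ fun x => by simp [gluingEquiv])

/-- `r` compares any two distinct elements in exactly one way. -/
structure IsTournament (r : X → X → Prop) : Prop where
  irrefl : ∀ x, ¬ r x x
  total : ∀ x y, x ≠ y → (r x y ↔ ¬ r y x)

theorem IsTournament.comap {r : Y → Y → Prop} (hr : IsTournament r) {e : X → Y}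
    (he : Function.Injective e) : IsTournament fun x y => r (e x) (e y) :=
  ⟨fun _ => hr.irrefl _, fun _ _ h => hr.total _ _ (he.ne h)⟩

theorem isTournament_lt [LinearOrder X] : IsTournament ((· < ·) : X → X → Prop) :=
  ⟨lt_irrefl, fun x y h => by
    rw [not_lt]
    exact ⟨le_of_lt, fun h' => lt_of_le_of_ne h' h⟩⟩

theorem sign_rev (R : Type*) [Ring R] (a : DEdge V) : a.rev.sign R = - a.sign R := by
  obtain ⟨x, y, f | f⟩ := a <;>
  simp [DEdge.sign, DEdge.IsForward, DEdge.rev]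

theorem IsGluing.edge_eq {D : Diagram V X} {τ : Equiv.Perm X} (hτ : D.IsGluing τ) {x y : X}
    (h : τ x = y) (hxy : x ≠ y) : D.edge y = (D.edge x).rev := by
  subst h
  exact hτ.2 x hxy.symm

theorem weight_one [Fintype X] (D : Diagram V X) (r : X → X → Prop) (hr : IsTournament r) :
    D.weight k r 1 = 1 :=
  Finset.prod_eq_one fun x _ => if_neg (hr.irrefl x)

/-- Interchanging the heights of two edges which are glued to each other changes the sign. -/
theorem weight_swap [Fintype X] [DecidableEq X] (D : Diagram V X) (r : X → X → Prop) (hr : IsTournament r)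
    (τ : Equiv.Perm X) (hτ : D.IsGluing τ) (z : X) (hz : τ z ≠ z) :
    D.weight k (fun x y => r (Equiv.swap z (τ z) x) (Equiv.swap z (τ z) y)) τ =
      - D.weight k r τ := by
  classical
  set s := Equiv.swap z (τ z) with hs
  have hcomm : ∀ x, s (τ x) = τ (s x) := fun x => by
    by_cases h1 : x = z
    · subst h1; simp [hs, hτ.1]
    by_cases h2 : x = τ z
    · subst h2; simp [hs, hτ.1]
    rw [hs, Equiv.swap_apply_of_ne_of_ne h1 h2, Equiv.swap_apply_of_ne_of_ne
      (fun h => h2 (by rw [← h, hτ.1])) (fun h => h1 (τ.injective h))]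
  have hsign : ∀ x, (D.edge (s x)).sign (Polynomial k) =
      if x = z ∨ x = τ z then - (D.edge x).sign (Polynomial k)
      else (D.edge x).sign (Polynomial k) := fun x => by
    split_ifs with h
    · rcases h with rfl | rfl
      · rw [hs, Equiv.swap_apply_left, hτ.2 _ hz, sign_rev]
      · rw [hs, Equiv.swap_apply_right, hτ.2 z hz, sign_rev, neg_neg]
    · push Not at h
      rw [hs, Equiv.swap_apply_of_ne_of_ne h.1 h.2]
  -- As `s` commutes with `τ`, reindexing by `s` restores the order `r` and moves the exchange to
  -- the labels, where it flips the signs at `z` and `τ z`.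
  rw [weight, weight, ← Equiv.prod_comp s]
  have hss : ∀ x, s (s x) = x := fun x => Equiv.swap_apply_self _ _ x
  simp only [hcomm, hss, hsign]
  -- Exactly one of `z` and `τ z` is the lower edge of its pair, so exactly one factor changes sign.
  obtain ⟨x₀, hx₀⟩ : ∃ x₀, ∀ x, (r x (τ x) ∧ (x = z ∨ x = τ z)) ↔ x = x₀ := by
    have ht := hr.total z (τ z) hz.symm
    by_cases h : r z (τ z)
    · refine ⟨z, fun x => ⟨?_, ?_⟩⟩
      · rintro ⟨h1, rfl | rfl⟩
        · rfl
        · rw [hτ.1] at h1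
          exact absurd h1 (ht.mp h)
      · rintro rfl
        exact ⟨h, Or.inl rfl⟩
    · refine ⟨τ z, fun x => ⟨?_, ?_⟩⟩
      · rintro ⟨h1, rfl | rfl⟩
        · exact absurd h1 h
        · rfl
      · rintro rfl
        rw [hτ.1]
        exact ⟨by tauto, Or.inr rfl⟩
  have : ∀ x, (if r x (τ x) then Polynomial.C (1 / 2 : k) * Polynomial.X *
      (if x = z ∨ x = τ z then - (D.edge x).sign (Polynomial k)
      else (D.edge x).sign (Polynomial k)) else 1) =
      (if x = x₀ then -1 else 1) * (if r x (τ x) then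
        Polynomial.C (1 / 2 : k) * Polynomial.X * (D.edge x).sign (Polynomial k) else 1) := by
    intro x
    rw [← if_congr (hx₀ x) rfl rfl]
    by_cases h1 : r x (τ x) <;> by_cases h2 : x = z ∨ x = τ z <;> simp [h1, h2]
  rw [Finset.prod_congr rfl fun x _ => this x, Finset.prod_mul_distrib, Finset.prod_ite_eq']
  simp

/-- `i` and `j` compare in the same way with all other elements. -/
def IsAdjacent (r : X → X → Prop) (i j : X) : Prop :=
  ∀ x, x ≠ i → x ≠ j → (r x i ↔ r x j) ∧ (r i x ↔ r j x)

/-- Each of `i` and `j` is either not glued or glued to a third edge, and third edges do not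
distinguish between `i` and `j`. -/
theorem weight_swap_of_ne [Fintype X] [DecidableEq X] (D : Diagram V X) (r : X → X → Prop) (hr : IsTournament r)
    (τ : Equiv.Perm X) (hτ : D.IsGluing τ) (i j : X) (hij : i ≠ j) (ha : IsAdjacent r i j)
    (h : τ i ≠ j) :
    D.weight k (fun x y => r (Equiv.swap i j x) (Equiv.swap i j y)) τ = D.weight k r τ := by
  have h' : τ j ≠ i := fun h2 => h (by rw [← h2, hτ.1])
  have key : ∀ x, r (Equiv.swap i j x) (Equiv.swap i j (τ x)) ↔ r x (τ x) := by
    intro x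
    by_cases h1 : x = i
    · subst h1
      by_cases h2 : τ x = x
      · simp [h2, hr.irrefl]
      · rw [Equiv.swap_apply_left, Equiv.swap_apply_of_ne_of_ne h2 h]
        exact (ha _ h2 h).2.symm
    by_cases h2 : x = j
    · subst h2
      by_cases h3 : τ x = x
      · simp [h3, hr.irrefl]
      · rw [Equiv.swap_apply_right, Equiv.swap_apply_of_ne_of_ne h' h3]
        exact (ha _ h' h3).2
    rw [Equiv.swap_apply_of_ne_of_ne h1 h2]
    by_cases h3 : τ x = i
    · rw [h3, Equiv.swap_apply_left]
      exact (ha _ h1 h2).1.symm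
    by_cases h4 : τ x = j
    · rw [h4, Equiv.swap_apply_right]
      exact (ha _ h1 h2).1
    rw [Equiv.swap_apply_of_ne_of_ne h3 h4]
  classical
  exact Finset.prod_congr rfl fun x _ => if_congr (key x) rfl rfl

theorem wick_swap_of_ne [Fintype X] [DecidableEq X] (D : Diagram V X) (r : X → X → Prop) (hr : IsTournament r)
    (i j : X) (hij : i ≠ j) (ha : IsAdjacent r i j) (h : D.edge j ≠ (D.edge i).rev) :
    D.wick k (fun x y => r (Equiv.swap i j x) (Equiv.swap i j y)) = D.wick k r := by
  refine Finset.sum_congr rfl fun τ _ => congrArg (· • _) ?_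
  exact D.weight_swap_of_ne k r hr τ.1 τ.2 i j hij ha fun h' => h (τ.2.edge_eq h' hij)

section Composite

variable {D : Diagram V X} {τ₁ : Equiv.Perm X}

theorem isComposite_ofSubtype [DecidablePred fun x => τ₁ x = x] (h₁ : D.IsGluing τ₁)
    (τ₂ : Equiv.Perm {x // τ₁ x = x}) :
    IsComposite τ₁ τ₂ (Equiv.Perm.ofSubtype τ₂ * τ₁) := by
  constructor
  · intro z
    rw [Equiv.Perm.mul_apply, z.2, Equiv.Perm.ofSubtype_apply_coe]
  · intro x hx
    rw [Equiv.Perm.mul_apply, Equiv.Perm.ofSubtype_apply_of_not_mem]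
    rw [h₁.1]
    exact fun h => hx h.symm

theorem IsComposite.isGluing [Fintype X] {τ₂ : Equiv.Perm {x // τ₁ x = x}} {σ : Equiv.Perm X}
    (h : IsComposite τ₁ τ₂ σ) (h₁ : D.IsGluing τ₁) (h₂ : (D.cut τ₁ h₁).IsGluing τ₂) :
    D.IsGluing σ := by
  refine ⟨fun x => ?_, fun x hx => ?_⟩
  · by_cases hx : τ₁ x = x
    · rw [h.fixed ⟨x, hx⟩, h.fixed, h₂.1]
    · rw [h.moved x hx, h.moved, h₁.1]
      rw [h₁.1]
      exact fun h => hx h.symm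
  · by_cases hx' : τ₁ x = x
    · rw [h.fixed ⟨x, hx'⟩] at hx ⊢
      exact h₂.2 ⟨x, hx'⟩ fun h' => hx (congrArg Subtype.val h')
    · rw [h.moved x hx']
      exact h₁.2 x hx'

theorem IsComposite.unique {τ₂ : Equiv.Perm {x // τ₁ x = x}} {σ σ' : Equiv.Perm X}
    (h : IsComposite τ₁ τ₂ σ) (h' : IsComposite τ₁ τ₂ σ') : σ = σ' := by
  ext x
  by_cases hx : τ₁ x = x
  · exact (h.fixed ⟨x, hx⟩).trans (h'.fixed ⟨x, hx⟩).symm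
  · rw [h.moved x hx, h'.moved x hx]

theorem cut_edge [Fintype X] (h₁ : D.IsGluing τ₁) (z : {x // τ₁ x = x}) :
    (D.cut τ₁ h₁).edge z = D.edge z := rfl

/-- A gluing that matches `i` with `j` preserves the complement of `{i, j}`; its restriction there
is the second gluing. With `isComposite_ofSubtype` this makes gluings matching `i` with `j`
correspond to gluings of the collection cut at `i` and `j`. -/
theorem exists_composite_swap [Fintype X] [DecidableEq X] (i j : X) (hij : i ≠ j)
    (h : D.edge j = (D.edge i).rev) (σ : Equiv.Perm X) (hσ : D.IsGluing σ) (hi : σ i = j) :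
    ∃ τ₂, (D.cut _ (D.isGluing_swap i j h)).IsGluing τ₂ ∧
      IsComposite (Equiv.swap i j) τ₂ σ := by
  have hj : σ j = i := by rw [← hi, hσ.1]
  have hs : ∀ y, Equiv.swap i j y = y ↔ y ≠ i ∧ y ≠ j := fun y =>
    ⟨fun h => ⟨fun h' => hij (by simpa [h'] using h.symm), fun h' => hij (by simpa [h'] using h)⟩,
      fun h => Equiv.swap_apply_of_ne_of_ne h.1 h.2⟩
  have hfix : ∀ x, Equiv.swap i j (σ x) = σ x ↔ Equiv.swap i j x = x := by
    intro x
    rw [hs, hs, and_comm]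
    refine and_congr (not_congr ⟨fun h => ?_, fun h => ?_⟩)
      (not_congr ⟨fun h => ?_, fun h => ?_⟩)
    · exact σ.injective (h.trans hi.symm)
    · rw [h, hi]
    · exact σ.injective (h.trans hj.symm)
    · rw [h, hj]
  obtain ⟨τ₂, hτ₂⟩ : ∃ τ₂ : Equiv.Perm {x // Equiv.swap i j x = x}, ∀ z, (τ₂ z : X) = σ z :=
    ⟨σ.subtypePerm hfix, fun _ => rfl⟩
  refine ⟨τ₂, ⟨fun z => Subtype.ext ?_, fun z hz => ?_⟩, fun z => (hτ₂ z).symm, fun x hx => ?_⟩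
  · rw [hτ₂, hτ₂, hσ.1]
  · rw [cut_edge, cut_edge, hτ₂]
    exact hσ.2 z fun h => hz (Subtype.ext ((hτ₂ z).trans h))
  · rw [Ne, hs, not_and_or, not_not, not_not] at hx
    rcases hx with rfl | rfl
    · rw [Equiv.swap_apply_left, hi]
    · rw [Equiv.swap_apply_right, hj]

end Composite

theorem weight_composite [Fintype X] [DecidableEq X] (D : Diagram V X) (r : X → X → Prop) (hr : IsTournament r)
    (i j : X) (hij : i ≠ j) (h : D.edge j = (D.edge i).rev) (hr' : r i j)
    (τ₂ : Equiv.Perm {x // Equiv.swap i j x = x}) (σ : Equiv.Perm X)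
    (hσ : IsComposite (Equiv.swap i j) τ₂ σ) :
    D.weight k r σ = Polynomial.C (1 / 2 : k) * Polynomial.X * (D.edge i).sign (Polynomial k) *
      (D.cut _ (D.isGluing_swap i j h)).weight k (fun x y => r x y) τ₂ := by
  classical
  have hi : σ i = j := by rw [hσ.moved i (by simpa using hij.symm), Equiv.swap_apply_left]
  have hj : σ j = i := by rw [hσ.moved j (by simpa using hij), Equiv.swap_apply_right]
  rw [weight, ← Fintype.prod_subtype_mul_prod_subtype (fun x => Equiv.swap i j x = x), mul_comm]
  refine congrArg₂ (· * ·) ?_ ?_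
  · rw [← Finset.prod_subtype (f := fun x => if r x (σ x) then Polynomial.C (1 / 2 : k) *
      Polynomial.X * (D.edge x).sign (Polynomial k) else 1) {i, j}]
    · rw [Finset.prod_pair hij, hi, hj, if_pos hr', if_neg ((hr.total i j hij).mp hr'), mul_one]
    · intro x
      rw [Finset.mem_insert, Finset.mem_singleton]
      constructor
      · rintro (rfl | rfl)
        · simpa using hij.symm
        · simpa using hij
      · intro hx
        by_contra h'
        push Not at h'
        exact hx (Equiv.swap_apply_of_ne_of_ne h'.1 h'.2)
  · refine Finset.prod_congr rfl fun x _ => ?_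
    rw [hσ.fixed]
    rfl

/-- The relation of `A_h(Q)` for Wick sums. Only gluings that match `i` with `j` survive in the
difference, each with twice its weight. The factor of the pair itself becomes `2 · (h/2) · sign = h
· sign`, and the rest is the Wick sum of the cut collection. -/
theorem wick_swap [CharZero k] [Fintype X] [DecidableEq X] (D : Diagram V X)
    (r : X → X → Prop)
    (hr : IsTournament r) (i j : X) (hij : i ≠ j) (ha : IsAdjacent r i j) (hr' : r i j)
    (h : D.edge j = (D.edge i).rev) :
    D.wick k r = D.wick k (fun x y => r (Equiv.swap i j x) (Equiv.swap i j y)) +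
      (Polynomial.X * (D.edge i).sign (Polynomial k)) •
        (D.cut _ (D.isGluing_swap i j h)).wick k (fun x y => r x y) := by
  have key : D.wick k r - D.wick k (fun x y => r (Equiv.swap i j x) (Equiv.swap i j y)) =
      ∑ τ : D.Gluing with τ.1 i = j,
        (2 * D.weight k r τ.1) • (D.cut τ.1 τ.2).sym (Polynomial k) := by
    rw [wick, wick, ← Finset.sum_sub_distrib, Finset.sum_filter]
    refine Finset.sum_congr rfl fun τ _ => ?_
    split_ifs with hτ
    · have := D.weight_swap k r hr τ.1 τ.2 i (by rw [hτ]; exact hij.symm)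
      rw [hτ] at this
      rw [this, two_mul, add_smul, neg_smul, sub_neg_eq_add]
      congr!
    · rw [D.weight_swap_of_ne k r hr τ.1 τ.2 i j hij ha hτ, sub_self]
  rw [← sub_eq_iff_eq_add', key, wick, Finset.smul_sum]
  have hc := isComposite_ofSubtype (D.isGluing_swap i j h)
  symm
  refine Finset.sum_bij (fun τ₂ _ => ⟨Equiv.Perm.ofSubtype τ₂.1 * Equiv.swap i j,
    (hc τ₂.1).isGluing _ τ₂.2⟩) ?_ ?_ ?_ ?_
  · intro τ₂ _
    rw [Finset.mem_filter]
    refine ⟨Finset.mem_univ _, ?_⟩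
    change (Equiv.Perm.ofSubtype τ₂.1 * Equiv.swap i j) i = j
    rw [(hc τ₂.1).moved i (by simpa using hij.symm), Equiv.swap_apply_left]
  · intro τ₂ _ τ₂' _ he
    apply Gluing.ext
    apply Equiv.ext
    intro z
    apply Subtype.ext
    rw [← (hc τ₂.1).fixed, ← (hc τ₂'.1).fixed]
    exact congrArg (fun σ : D.Gluing => σ.1 z) he
  · intro σ hσ
    have hi : σ.1 i = j := (Finset.mem_filter.mp hσ).2
    obtain ⟨τ₂, hτ₂, hcomp⟩ := exists_composite_swap i j hij h σ.1 σ.2 hi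
    exact ⟨⟨τ₂, hτ₂⟩, Finset.mem_univ _, Gluing.ext ((hc τ₂).unique hcomp)⟩
  · intro τ₂ _
    rw [D.weight_composite k r hr i j hij h hr' τ₂.1 _ (hc τ₂.1), smul_smul]
    refine congrArg₂ (· • ·) ?_ ?_
    · rw [← mul_assoc, ← mul_assoc, ← mul_assoc]
      congr 2
      rw [show (2 : Polynomial k) = Polynomial.C 2 from rfl, ← Polynomial.C_mul]
      norm_num
    · exact Iso.sym_eq _ ((hc τ₂.1).cut_cut_iso _ _ _)

end Diagram

end

/-! ### Wick sums of stacked collections -/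

section

namespace Diagram

variable {V : Type u} [Quiver.{v} V] (k : Type w) [Field k] {X : Type*} {Y : Type*}

theorem wick_eq_of_relabel_eq {_ : Fintype X} {_ : Fintype Y} {D : Diagram V X} {D' : Diagram V Y}
    (e : X ≃ Y) (h : D.relabel e = D') {r : X → X → Prop} {r' : Y → Y → Prop}
    (hr : ∀ x y, r x y ↔ r' (e x) (e y)) : D.wick k r = D'.wick k r' := by
  subst h
  rw [wick_relabel]
  congr 1
  funext x y
  exact propext (hr x y)

/-- Gluing edges of one part of a disjoint union does not affect the other part. -/
theorem exists_cut_disjUnion_equiv {W : Type*} [Fintype X] [Fintype W] (D : Diagram V X)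
    (G : Diagram V W) (τ : Equiv.Perm X) (hτ : D.IsGluing τ) (σ : Equiv.Perm (X ⊕ W))
    (hσ : (D.disjUnion G).IsGluing σ) (hl : ∀ x, σ (Sum.inl x) = Sum.inl (τ x))
    (hr : ∀ y, σ (Sum.inr y) = Sum.inr y) :
    ∃ e : {z // σ z = z} ≃ {x // τ x = x} ⊕ W,
      ((D.disjUnion G).cut σ hσ).relabel e = (D.cut τ hτ).disjUnion G ∧
      (∀ x, (e.symm (Sum.inl x) : X ⊕ W) = Sum.inl x.1) ∧
      ∀ y, (e.symm (Sum.inr y) : X ⊕ W) = Sum.inr y := by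
  classical
  have hfix : ∀ x, σ (Sum.inl x) = Sum.inl x ↔ τ x = x := fun x => by rw [hl, Sum.inl.injEq]
  let e : {z // σ z = z} ≃ {x // τ x = x} ⊕ W :=
    { toFun := fun z => match z with
        | ⟨Sum.inl x, h⟩ => Sum.inl ⟨x, (hfix x).mp h⟩
        | ⟨Sum.inr y, _⟩ => Sum.inr y
      invFun := Sum.elim (fun x => ⟨Sum.inl x.1, (hfix x.1).mpr x.2⟩) fun y => ⟨Sum.inr y, hr y⟩
      left_inv := by rintro ⟨x | y, h⟩ <;> rfl
      right_inv := by rintro (x | y) <;> rfl }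
  have hgl : ∀ x, (D.disjUnion G).glued σ (Sum.inl x) = Sum.inl (D.glued τ x) := fun x => by
    simp only [glued, Equiv.trans_apply, hl]
    rfl
  have hsc : ∀ x y, ((D.disjUnion G).glued σ).SameCycle (Sum.inl x) (Sum.inl y) ↔
      (D.glued τ).SameCycle x y := fun x y => sameCycle_iff_of_semiconj Sum.inl_injective hgl
  have hin : ∀ x z, ((D.disjUnion G).glued σ).SameCycle (Sum.inl x) z →
      ∃ y, z = Sum.inl y := by
    rintro x z ⟨n, rfl⟩
    exact ⟨_, zpow_apply_of_semiconj hgl n x⟩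
  have hlost : ∀ x, D.Lost τ x ↔ (D.disjUnion G).Lost σ (Sum.inl x) := fun x => by
    constructor
    · intro h z hz
      obtain ⟨y, rfl⟩ := hin x z hz
      rw [Ne, hfix]
      exact h y ((hsc x y).mp hz)
    · intro h y hy
      rw [Ne, ← hfix]
      exact h _ ((hsc x y).mpr hy)
  refine ⟨e, relabel_eq e ?_ ?_ ?_, fun _ => rfl, fun _ => rfl⟩
  · rintro ⟨x | y, hz⟩
    · have := returnPerm_semiconj (D.glued τ) ((D.disjUnion G).glued σ) Sum.inl hgl
        {x | τ x = x} {z | σ z = z} hfix ⟨x, (hfix x).mp hz⟩ ⟨Sum.inl x, hz⟩ rfl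
      rw [← Equiv.symm_apply_eq]
      exact Subtype.ext this.symm
    -- No edge of the second part is cut, so its first return takes a single step.
    · have h1 : (D.disjUnion G).glued σ (Sum.inr y) = Sum.inr (G.next y) := by
        simp only [glued, Equiv.trans_apply, hr]
        rfl
      have := returnPerm_eq ((D.disjUnion G).glued σ) {z | σ z = z} ⟨Sum.inr y, hz⟩ 0
        (by rw [Function.iterate_one, h1]; exact hr _) fun m hm => absurd hm (by omega)
      rw [← Equiv.symm_apply_eq]
      exact Subtype.ext (h1.symm.trans this.symm)
  · rintro ⟨x | y, hz⟩ <;> rfl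
  · have h2 : ((D.cut τ hτ).disjUnion G).verts = (D.cut τ hτ).verts + G.verts := rfl
    have h3 : (D.disjUnion G).verts = D.verts + G.verts := rfl
    rw [h2, cut_verts, cut_verts, h3, add_right_comm]
    refine congrArg (_ + · + _) (Eq.symm ?_)
    refine sum_orbits_eq Sum.inl ((D.disjUnion G).Lost σ) (D.Lost τ) Lost.of_sameCycle
      Lost.of_sameCycle (fun x y _ _ => (hsc x y).symm) (fun x => (hlost x).mp) ?_
      (fun z => ({((D.disjUnion G).edge z).left} : Multiset (Quiver.Symmetrify V)))
      (fun x => {(D.edge x).left}) ?_ fun _ _ => rfl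
    · rintro (x | y) hz
      · exact ⟨x, (hlost x).mpr hz, Equiv.Perm.SameCycle.refl _ _⟩
      · exact absurd (hr y) (hz _ (Equiv.Perm.SameCycle.refl _ _))
    · exact fun x x' hx hxx' => congrArg _ (hx.left_eq hσ x x' hxx')

/-- The bijection of disjoint unions which moves the first part `X ≃ N` to the middle. -/
def stackRelabel {Z N A B : Type*} (e : X ≃ N) (f : Y ⊕ N ≃ A) (g : A ⊕ Z ≃ B) :
    X ⊕ (Y ⊕ Z) ≃ B :=
  (Equiv.sumAssoc X Y Z).symm.trans
    ((Equiv.sumCongr ((Equiv.sumComm X Y).trans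
      ((Equiv.sumCongr (Equiv.refl _) e).trans f)) (Equiv.refl _)).trans g)

theorem relabel_stackRelabel {Z N A B : Type*} (E : Diagram V Y) (D : Diagram V X)
    (F : Diagram V Z) (e : X ≃ N) (f : Y ⊕ N ≃ A) (g : A ⊕ Z ≃ B) :
    (D.disjUnion (E.disjUnion F)).relabel (stackRelabel e f g) =
      (((E.disjUnion (D.relabel e)).relabel f).disjUnion F).relabel g := by
  refine relabel_eq _ ?_ ?_ ?_
  · rintro (x | x | x) <;> simp [relabel, disjUnion, stackRelabel]
  · rintro (x | x | x) <;> simp [relabel, disjUnion, stackRelabel]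
  · simp only [relabel, disjUnion]
    abel

end Diagram

namespace HDiagram

variable {V : Type u} [Quiver.{v} V] (k : Type w) [Field k] {X : Type*}

theorem mul_diag (D D' : HDiagram V) :
    (D * D').diag = (D.diag.disjUnion D'.diag).relabel finSumFinEquiv := rfl

/-- The bijection which places `X` above `Fin m` and below `Fin p`. -/
def stackEquiv {m n p : ℕ} (e : X ≃ Fin n) : X ⊕ (Fin m ⊕ Fin p) ≃ Fin (m + n + p) :=
  Diagram.stackRelabel e finSumFinEquiv finSumFinEquiv

theorem stackEquiv_inl {m n p : ℕ} (e : X ≃ Fin n) (x : X) :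
    (stackEquiv (m := m) (p := p) e (Sum.inl x) : ℕ) = m + e x := rfl

theorem stackEquiv_inr_inl {m n p : ℕ} (e : X ≃ Fin n) (x : Fin m) :
    (stackEquiv (m := m) (p := p) e (Sum.inr (Sum.inl x)) : ℕ) = x := rfl

theorem stackEquiv_inr_inr {m n p : ℕ} (e : X ≃ Fin n) (x : Fin p) :
    (stackEquiv (m := m) (p := p) e (Sum.inr (Sum.inr x)) : ℕ) = m + n + x := rfl

theorem stack_diag (E F : HDiagram V) {n : ℕ} (D : Diagram V X) (e : X ≃ Fin n) :
    (E * ⟨n, D.relabel e⟩ * F).diag =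
      (D.disjUnion (E.diag.disjUnion F.diag)).relabel (stackEquiv e) :=
  (Diagram.relabel_stackRelabel E.diag D F.diag e finSumFinEquiv finSumFinEquiv).symm

open Classical in
/-- The Wick sum of a collection with heights. -/
noncomputable def wick (D : HDiagram V) : SymL V (Polynomial k) := D.diag.wick k (· < ·)

/-- The relations must hold inside every product `E * _ * F`. Here `D` is a summand of a fixed
disjoint union and the heights enter only through the comparison relation, so an exchange of heights
alters the relation and not the collection. -/
theorem wick_stack [Fintype X] (E F : HDiagram V) {n : ℕ} (D : Diagram V X) (e : X ≃ Fin n) :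
    (E * ⟨n, D.relabel e⟩ * F).wick k = (D.disjUnion (E.diag.disjUnion F.diag)).wick k
      fun x y => (stackEquiv e x : Fin (E.size + n + F.size)) < stackEquiv e y := by
  rw [wick, stack_diag]
  exact Diagram.wick_relabel k _ _ _

theorem stackEquiv_swap {m N p : ℕ} (i j : Fin N) (x : Fin N ⊕ (Fin m ⊕ Fin p)) :
    stackEquiv (Equiv.swap i j) x =
      stackEquiv (Equiv.refl _) (Equiv.swap (Sum.inl i) (Sum.inl j) x) := by
  rcases x with x | x
  · rw [Sum.inl_injective.swap_apply]
    rfl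
  · rw [Equiv.swap_apply_of_ne_of_ne Sum.inr_ne_inl Sum.inr_ne_inl]
    rcases x with x | x <;> rfl

/-- Stacking shifts the heights of `i` and `j` by the same amount `m`, so they stay consecutive and
no third height separates them. -/
theorem isAdjacent_stackEquiv {m N p : ℕ} (i j : Fin N) (hij : (i : ℕ) + 1 = j) :
    Diagram.IsAdjacent (fun x y : Fin N ⊕ (Fin m ⊕ Fin p) =>
      stackEquiv (Equiv.refl _) x < stackEquiv (Equiv.refl _) y) (Sum.inl i) (Sum.inl j) := by
  intro x hi hj
  have hi' : (stackEquiv (Equiv.refl (Fin N)) x : ℕ) ≠ m + i :=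
    fun h => hi ((stackEquiv (Equiv.refl (Fin N))).injective (Fin.ext h))
  have hj' : (stackEquiv (Equiv.refl (Fin N)) x : ℕ) ≠ m + j :=
    fun h => hj ((stackEquiv (Equiv.refl (Fin N))).injective (Fin.ext h))
  simp only [Fin.lt_def, stackEquiv_inl, Equiv.refl_apply]
  omega

theorem wick_stack_refl (E F : HDiagram V) {N : ℕ} (D : Diagram V (Fin N)) :
    (E * ⟨N, D⟩ * F).wick k = (D.disjUnion (E.diag.disjUnion F.diag)).wick k
      fun x y => (stackEquiv (Equiv.refl _) x : Fin (E.size + N + F.size)) <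
        stackEquiv (Equiv.refl _) y :=
  wick_stack k E F D (Equiv.refl _)

theorem wick_stack_swap_of_ne (E F : HDiagram V) {N : ℕ} (D : Diagram V (Fin N)) (i j : Fin N)
    (hij : (i : ℕ) + 1 = j) (h : D.edge j ≠ (D.edge i).rev) :
    (E * ⟨N, D⟩ * F).wick k = (E * ⟨N, D.relabel (Equiv.swap i j)⟩ * F).wick k := by
  have hne : i ≠ j := fun h => by rw [h] at hij; omega
  rw [wick_stack_refl, wick_stack]
  simp only [stackEquiv_swap]
  exact ((D.disjUnion (E.diag.disjUnion F.diag)).wick_swap_of_ne k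
    (fun x y => (stackEquiv (Equiv.refl _) x : Fin (E.size + N + F.size)) <
      stackEquiv (Equiv.refl _) y) (Diagram.isTournament_lt.comap (stackEquiv (Equiv.refl _)).injective) (Sum.inl i) (Sum.inl j)
    (fun h => hne (Sum.inl_injective h)) (isAdjacent_stackEquiv i j hij) h).symm

theorem wick_stack_swap [CharZero k] (E F : HDiagram V) {N : ℕ} (D : Diagram V (Fin N))
    (i j : Fin N) (hij : (i : ℕ) + 1 = j) (h : D.edge j = (D.edge i).rev) :
    (E * ⟨N, D⟩ * F).wick k = (E * ⟨N, D.relabel (Equiv.swap i j)⟩ * F).wick k +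
      (Polynomial.X * (D.edge i).sign (Polynomial k)) •
        (E * ofOrdered (D.cut _ (D.isGluing_swap i j h)) * F).wick k := by
  have hne : i ≠ j := fun h => by rw [h] at hij; omega
  let e := (monoEquivOfFin {x : Fin N // Equiv.swap i j x = x} rfl).symm
  have hc := wick_stack k E F (D.cut _ (D.isGluing_swap i j h)) e.toEquiv
  have hc' : (E * ofOrdered (D.cut _ (D.isGluing_swap i j h)) * F).wick k = _ := hc
  rw [wick_stack_refl, wick_stack, hc']
  simp only [stackEquiv_swap]
  refine ((D.disjUnion (E.diag.disjUnion F.diag)).wick_swap k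
    (fun x y => (stackEquiv (Equiv.refl _) x : Fin (E.size + N + F.size)) <
      stackEquiv (Equiv.refl _) y) (Diagram.isTournament_lt.comap (stackEquiv (Equiv.refl _)).injective) (Sum.inl i) (Sum.inl j)
    (fun h => hne (Sum.inl_injective h)) (isAdjacent_stackEquiv i j hij) ?_ h).trans ?_
  · rw [Fin.lt_def, stackEquiv_inl, stackEquiv_inl]
    simp only [Equiv.refl_apply]
    omega
  refine congrArg (fun z : SymL V (Polynomial k) => _ + (Polynomial.X * (D.edge i).sign (Polynomial k)) • z) ?_
  -- Cutting inside `D` commutes with placing `E` below and `F` above it.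
  obtain ⟨e', he', hl, hr⟩ := D.exists_cut_disjUnion_equiv (E.diag.disjUnion F.diag) _
    (D.isGluing_swap i j h) (Equiv.swap (Sum.inl i) (Sum.inl j))
    (Diagram.isGluing_swap _ _ _ h) (fun x => Sum.inl_injective.swap_apply i j x)
    (fun y => Equiv.swap_apply_of_ne_of_ne Sum.inr_ne_inl Sum.inr_ne_inl)
  refine Diagram.wick_eq_of_relabel_eq k e' he' fun a b => ?_
  obtain ⟨a, rfl⟩ := e'.symm.surjective a
  obtain ⟨b, rfl⟩ := e'.symm.surjective b
  rw [Equiv.apply_symm_apply, Equiv.apply_symm_apply]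
  -- `e` is an order isomorphism, so closing the gap left by the two deleted heights does not change
  -- any comparison.
  have he : ∀ x y : {x : Fin N // Equiv.swap i j x = x},
      ((e x : Fin _) : ℕ) < e y ↔ (x : ℕ) < (y : ℕ) := fun x y => e.lt_iff_lt
  have hec : ∀ x, e.toEquiv x = e x := fun _ => rfl
  rcases a with a | a | a <;> rcases b with b | b | b <;>
    simp only [hl, hr, Fin.lt_def, stackEquiv_inl, stackEquiv_inr_inl, stackEquiv_inr_inr,
      Equiv.refl_apply, hec]
  · have := he a b
    omega
  all_goals omega

end HDiagram

end

section

/-! ### The inverse of the symmetrization map -/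

/-- A linear map which takes the same values on all multiples of the two sides of each relation
descends to the quotient. -/
theorem exists_linearMap_ringQuot {S A M : Type*} [CommRing S] [Ring A] [Algebra S A]
    [AddCommGroup M] [Module S M] (r : A → A → Prop) (Ψ : A →ₗ[S] M)
    (h : ∀ x y, r x y → ∀ b c, Ψ (b * x * c) = Ψ (b * y * c)) :
    ∃ Ψ' : RingQuot r →ₗ[S] M, ∀ a, Ψ' (RingQuot.mkAlgHom S r a) = Ψ a := by
  -- Pairs that `Ψ` cannot distinguish inside any product `b * _ * c` form a ring congruence. It
  -- contains `r`, so everything that dies in the quotient is killed by `Ψ`.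
  let J : RingCon A :=
    { r := fun x y => ∀ b c, Ψ (b * x * c) = Ψ (b * y * c)
      iseqv := ⟨fun _ _ _ => rfl, fun h b c => (h b c).symm, fun h h' b c =>
        (h b c).trans (h' b c)⟩
      add' := fun h h' b c => by
        simp only [mul_add, add_mul, map_add, h b c, h' b c]
      mul' := fun {x y z t} h h' b c => by
        have h1 := h b (z * c)
        have h2 := h' (b * y) c
        simp only [mul_assoc] at h1 h2 ⊢
        rw [h1, h2] }
  have hJ : ∀ a, RingQuot.mkAlgHom S r a = 0 → Ψ a = 0 := by
    intro a ha
    have hr : ∀ ⦃x y⦄, r x y → J.mk' x = J.mk' y := fun x y hxy =>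
      (RingCon.eq J).mpr (h x y hxy)
    have h1 : RingQuot.lift ⟨J.mk', hr⟩ (RingQuot.mkRingHom r a) = J.mk' a :=
      RingQuot.lift_mkRingHom_apply _ _ _
    have h2 : RingQuot.mkRingHom r a = 0 := by
      rw [← RingQuot.mkAlgHom_coe S]
      exact ha
    rw [h2, map_zero] at h1
    have h3 : J 0 a := (RingCon.eq J).mp h1
    have h4 := h3 1 1
    simpa using h4.symm
  let p : A →ₗ[S] RingQuot r := (RingQuot.mkAlgHom S r).toLinearMap
  have hp : Function.Surjective p := RingQuot.mkAlgHom_surjective S r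
  have hk : LinearMap.ker p ≤ LinearMap.ker Ψ := fun a ha => hJ a ha
  refine ⟨(LinearMap.ker p).liftQ Ψ hk ∘ₗ
    (p.quotKerEquivOfSurjective hp).symm.toLinearMap, fun a => ?_⟩
  have : (p.quotKerEquivOfSurjective hp).symm (p a) = (LinearMap.ker p).mkQ a := by
    rw [LinearEquiv.symm_apply_eq]
    rfl
  change (LinearMap.ker p).liftQ Ψ hk ((p.quotKerEquivOfSurjective hp).symm (p a)) = _
  rw [this]
  rfl

variable {V : Type u} [Quiver.{v} V] (k : Type w) [Field k]

/-- The linear extension of a function on the collections with heights. -/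
noncomputable def heightLift {M : Type*} [AddCommGroup M] [Module (Polynomial k) M]
    (f : HDiagram V → M) : HeightAlgebra k V →ₗ[Polynomial k] M where
  toFun a := (Finsupp.linearCombination (Polynomial k) f) a.coeff
  map_add' a b := by rw [MonoidAlgebra.coeff_add, map_add]
  map_smul' c a := by rw [MonoidAlgebra.coeff_smul, map_smul, RingHom.id_apply]

theorem heightLift_toAlg {M : Type*} [AddCommGroup M] [Module (Polynomial k) M]
    (f : HDiagram V → M) (D : HDiagram V) : heightLift k f (D.toAlg k) = f D := by
  simp [heightLift, HDiagram.toAlg]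

theorem toAlg_mul (D E : HDiagram V) : (D * E).toAlg k = D.toAlg k * E.toAlg k :=
  map_mul (MonoidAlgebra.of _ _) _ _

theorem toAh_mul (D E : HDiagram V) : (D * E).toAh k = D.toAh k * E.toAh k := by
  rw [HDiagram.toAh, toAlg_mul, map_mul]
  rfl

theorem heightAlgebra_induction {p : HeightAlgebra k V → Prop} (a : HeightAlgebra k V)
    (h : ∀ D : HDiagram V, p (D.toAlg k)) (hadd : ∀ a b, p a → p b → p (a + b))
    (hsmul : ∀ (c : Polynomial k) a, p a → p (c • a)) : p a :=
  MonoidAlgebra.induction_on a h hadd hsmul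

theorem wick_rel [CharZero k] (x y : HeightAlgebra k V) (h : HRel k x y)
    (b c : HeightAlgebra k V) :
    heightLift k (HDiagram.wick k) (b * x * c) = heightLift k (HDiagram.wick k) (b * y * c) := by
  induction b using heightAlgebra_induction k with
  | hadd b b' hb hb' => simp only [add_mul, map_add, hb, hb']
  | hsmul s b hb => simp only [smul_mul_assoc, map_smul, hb]
  | h E =>
  induction c using heightAlgebra_induction k with
  | hadd b b' hb hb' => simp only [mul_add, map_add, hb, hb']
  | hsmul s b hb => simp only [mul_smul_comm, map_smul, hb]
  | h F =>
  cases h with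
  | commute D i j hij h =>
    rw [← toAlg_mul, ← toAlg_mul, ← toAlg_mul, ← toAlg_mul, heightLift_toAlg, heightLift_toAlg]
    exact HDiagram.wick_stack_swap_of_ne k E F D i j hij h
  | glue D i j hij h =>
    rw [mul_add, add_mul, mul_smul_comm, smul_mul_assoc, map_add, map_smul, ← toAlg_mul,
      ← toAlg_mul, ← toAlg_mul, ← toAlg_mul, ← toAlg_mul, ← toAlg_mul, heightLift_toAlg,
      heightLift_toAlg, heightLift_toAlg]
    exact HDiagram.wick_stack_swap k E F D i j hij h

/-- The Wick sums define a linear map on `A_h(Q)`. -/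
theorem exists_wickMap [CharZero k] : ∃ Ψ : Ah k V →ₗ[Polynomial k] SymL V (Polynomial k),
    ∀ D : HDiagram V, Ψ (D.toAh k) = D.wick k := by
  obtain ⟨Ψ, h⟩ := exists_linearMap_ringQuot (HRel (V := V) k)
    (heightLift k (HDiagram.wick k)) (wick_rel k)
  exact ⟨Ψ, fun D => (h _).trans (heightLift_toAlg k _ D)⟩

/-- The linear map on `A_h(Q)` given by the Wick sums. -/
noncomputable def wickMap [CharZero k] : Ah k V →ₗ[Polynomial k] SymL V (Polynomial k) :=
  (exists_wickMap k).choose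

theorem wickMap_toAh [CharZero k] (D : HDiagram V) : wickMap k (D.toAh k) = D.wick k :=
  (exists_wickMap k).choose_spec D

namespace Diagram

variable {X : Type*} {Y : Type*} [Fintype X] [Fintype Y]

/-- Frees the number of edges from the form `Fintype.card X`, which avoids casts between types `Fin
n`. -/
theorem average_eq (D : Diagram V X) (n : ℕ) (hn : Fintype.card X = n)
    [Fintype (X ≃ Fin n)] :
    D.average k = Polynomial.C ((n ! : k)⁻¹) •
      ∑ H : X ≃ Fin n, HDiagram.toAh k ⟨n, D.relabel H⟩ := by
  classical
  subst hn
  rw [average]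
  congr!

theorem average_relabel (D : Diagram V X) (e : X ≃ Y) : (D.relabel e).average k = D.average k := by
  classical
  rw [D.average_eq k (Fintype.card Y) (Fintype.card_congr e),
    (D.relabel e).average_eq k (Fintype.card Y) rfl]
  congr 1
  exact Fintype.sum_equiv (e.symm.equivCongr (Equiv.refl (Fin (Fintype.card Y)))) _ _ fun H => rfl

theorem Iso.average_eq {D : Diagram V X} {D' : Diagram V Y} (h : D.Iso D') :
    D.average k = D'.average k := by
  obtain ⟨e, rfl⟩ := h
  rw [average_relabel]

/-- The average is invariant under renaming of abstract edges, so it may be computed on any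
representative of the monomial. -/
theorem PhiW_sym (D : Diagram V X) : PhiW k (D.sym (Polynomial k)) = D.average k := by
  have h : D.sym (Polynomial k) =
      MvPolynomial.basisMonomials (Necklace V) (Polynomial k) D.exponent := by
    rw [sym_eq_monomial, MvPolynomial.coe_basisMonomials]
  rw [h, PhiW, Module.Basis.constr_basis]
  exact (D.iso_ofMonomial.average_eq k).symm

theorem map_average (D : Diagram V X) {M : Type*} [AddCommGroup M]
    [Module (Polynomial k) M] (f : Ah k V →ₗ[Polynomial k] M) [Fintype (X ≃ Fin (Fintype.card X))] :
    f (D.average k) = Polynomial.C (((Fintype.card X)! : k)⁻¹) •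
      ∑ H : X ≃ Fin (Fintype.card X), f (HDiagram.toAh k ⟨_, D.relabel H⟩) := by
  rw [D.average_eq k _ rfl, map_smul, map_sum]

end Diagram

end

/-! ### Wick sums of averages; the Moyal formula -/

section

variable {V : Type u} [Quiver.{v} V] (k : Type w) [Field k]

namespace Diagram

variable {X : Type*} {Y : Type*} [Fintype X] [Fintype Y]

/-- The weights of a nontrivial gluing cancel over a family of height assignments which is stable
under exchanging the heights of two glued edges. -/
theorem sum_weight_eq_zero [CharZero k] [DecidableEq X] {ι : Type*} [Fintype ι] (D : Diagram V X)
    (r : ι → X → X → Prop) (hr : ∀ H, IsTournament (r H)) (τ : Equiv.Perm X)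
    (hτ : D.IsGluing τ) (z : X) (hz : τ z ≠ z) (a : ι ≃ ι)
    (ha : ∀ H x y, r (a H) x y ↔ r H (Equiv.swap z (τ z) x) (Equiv.swap z (τ z) y)) :
    ∑ H, D.weight k (r H) τ = 0 := by
  have h : ∑ H, D.weight k (r H) τ = - ∑ H, D.weight k (r H) τ := by
    rw [← Finset.sum_neg_distrib]
    refine (Equiv.sum_comp a _).symm.trans (Finset.sum_congr rfl fun H _ => ?_)
    rw [← D.weight_swap k (r H) (hr H) τ hτ z hz]
    congr 1
    funext x y
    exact propext (ha H x y)
  exact self_eq_neg.mp h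

theorem wick_of_relabel (D : Diagram V X) {n : ℕ} (H : X ≃ Fin n) :
    HDiagram.wick k ⟨n, D.relabel H⟩ = D.wick k fun x y => H x < H y :=
  D.wick_relabel k H _

theorem sum_wick {ι : Type*} [Fintype ι] (D : Diagram V X) (r : ι → X → X → Prop)
    [DecidableEq X] :
    ∑ H, D.wick k (r H) =
      ∑ τ : D.Gluing, (∑ H, D.weight k (r H) τ.1) • (D.cut τ.1 τ.2).sym (Polynomial k) := by
  simp only [wick, Finset.sum_smul]
  rw [Finset.sum_comm]
  congr!

theorem C_inv_factorial_smul [CharZero k] {M : Type*} [AddCommMonoid M] [Module (Polynomial k) M]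
    (n : ℕ) (x : M) : Polynomial.C ((n ! : k)⁻¹) • (n ! : Polynomial k) • x = x := by
  have h : (n ! : k) ≠ 0 := by exact_mod_cast n.factorial_ne_zero
  rw [smul_smul, ← Polynomial.C_eq_natCast, ← Polynomial.C_mul, inv_mul_cancel₀ h,
    Polynomial.C_1, one_smul]

theorem C_inv_factorial_smul₂ [CharZero k] {M : Type*} [AddCommMonoid M] [Module (Polynomial k) M]
    (n m : ℕ) (c : Polynomial k) (x : M) :
    Polynomial.C ((n ! : k)⁻¹) • Polynomial.C ((m ! : k)⁻¹) •
      ((n ! : Polynomial k) * (m ! : Polynomial k) * c) • x = c • x := by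
  rw [mul_assoc, mul_smul, smul_comm (Polynomial.C ((m ! : k)⁻¹)), C_inv_factorial_smul, mul_smul,
    C_inv_factorial_smul]

/-- The weights of a nontrivial gluing cancel over all heights, by exchanging the heights of one of
its pairs. The trivial gluing has weight `1` for each of the `N!` height assignments. -/
theorem wickMap_average [CharZero k] (D : Diagram V X) :
    wickMap k (D.average k) = D.sym (Polynomial k) := by
  classical
  rw [map_average]
  simp only [wickMap_toAh, wick_of_relabel]
  rw [sum_wick, Finset.sum_eq_single ⟨1, D.isGluing_one⟩]
  · have : ∀ H : X ≃ Fin (Fintype.card X), D.weight k (fun x y => H x < H y) 1 = 1 :=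
      fun H => D.weight_one k _ (isTournament_lt.comap H.injective)
    simp only [this, Finset.sum_const, nsmul_eq_mul, mul_one]
    rw [Finset.card_univ, Fintype.card_equiv (Fintype.equivFin X), C_inv_factorial_smul]
    exact D.cut_one_iso.sym_eq _
  · intro τ _ hτ
    obtain ⟨z, hz⟩ : ∃ z, τ.1 z ≠ z := by
      by_contra h
      push Not at h
      exact hτ (Gluing.ext (Equiv.ext h))
    rw [D.sum_weight_eq_zero k (fun (H : X ≃ Fin (Fintype.card X)) x y => H x < H y)
      (fun H => isTournament_lt.comap H.injective) τ.1 τ.2 z hz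
      ((Equiv.swap z (τ.1 z)).equivCongr (Equiv.refl _)) (fun H x y => by simp), zero_smul]
  · intro h
    exact absurd (Finset.mem_univ _) h

/-- The order on a disjoint union in which the second part lies above the first part. -/
def stackOrder {n m : ℕ} (H : (X ≃ Fin n) × (Y ≃ Fin m)) (x y : X ⊕ Y) : Prop :=
  finSumFinEquiv (Sum.map H.1 H.2 x) < finSumFinEquiv (Sum.map H.1 H.2 y)

theorem stackOrder_inl_inr {A B : Type*} {n m : ℕ} (H : (A ≃ Fin n) × (B ≃ Fin m)) (x : A) (y : B) :
    stackOrder H (Sum.inl x) (Sum.inr y) := by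
  simp only [stackOrder, Sum.map_inl, Sum.map_inr, finSumFinEquiv_apply_left,
    finSumFinEquiv_apply_right, Fin.lt_def, Fin.val_castAdd, Fin.val_natAdd]
  omega

theorem isTournament_stackOrder {A B : Type*} {n m : ℕ} (H : (A ≃ Fin n) × (B ≃ Fin m)) :
    IsTournament (stackOrder H) :=
  isTournament_lt.comap
    (finSumFinEquiv.injective.comp (Sum.map_injective.mpr ⟨H.1.injective, H.2.injective⟩))

theorem wick_mul_relabel (D : Diagram V X) (D' : Diagram V Y) {n m : ℕ}
    (H : (X ≃ Fin n) × (Y ≃ Fin m)) :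
    HDiagram.wick k ((⟨n, D.relabel H.1⟩ : HDiagram V) * ⟨m, D'.relabel H.2⟩) =
      (D.disjUnion D').wick k (stackOrder H) := by
  have h : ((⟨n, D.relabel H.1⟩ : HDiagram V) * ⟨m, D'.relabel H.2⟩).diag =
      (D.disjUnion D').relabel ((Equiv.sumCongr H.1 H.2).trans finSumFinEquiv) := by
    symm
    refine relabel_eq _ ?_ ?_ rfl
    · rintro (x | x) <;> simp [HDiagram.mul_diag, relabel, disjUnion]
    · rintro (x | x) <;> simp [HDiagram.mul_diag, relabel, disjUnion]
  rw [HDiagram.wick, h]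
  exact wick_relabel k _ _ _

open Classical in
-- The lower edge of a cross pair always lies in the first collection, so the heights inside the two
-- parts are irrelevant. Its sign is opposite to that of its partner `y`, hence `-1` exactly when
-- `y` belongs to `Q`.
theorem weight_cross (D : Diagram V X) (D' : Diagram V Y) {n m : ℕ}
    (H : (X ≃ Fin n) × (Y ≃ Fin m)) (τ : Equiv.Perm (X ⊕ Y)) (hτ : (D.disjUnion D').IsGluing τ)
    (hc : ∀ z, τ z ≠ z → (τ z).isLeft = !z.isLeft) :
    (D.disjUnion D').weight k (stackOrder H) τ =
      (Polynomial.C (1 / 2 : k) * Polynomial.X) ^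
        (Finset.univ.filter fun x : X => τ (Sum.inl x) ≠ Sum.inl x).card *
      (-1) ^ (Finset.univ.filter fun y : Y =>
        τ (Sum.inr y) ≠ Sum.inr y ∧ (D'.edge y).IsForward).card := by
  have hl : ∀ x, τ (Sum.inl x) ≠ Sum.inl x → ∃ y, τ (Sum.inl x) = Sum.inr y := fun x hx => by
    have := hc _ hx
    rcases h : τ (Sum.inl x) with y | y
    · rw [h] at this
      simp at this
    · exact ⟨y, rfl⟩
  have hr : ∀ y, τ (Sum.inr y) ≠ Sum.inr y → ∃ x, τ (Sum.inr y) = Sum.inl x := fun y hy => by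
    have := hc _ hy
    rcases h : τ (Sum.inr y) with x | x
    · exact ⟨x, rfl⟩
    · rw [h] at this
      simp at this
  have ht := isTournament_stackOrder H
  have h1 : ∀ x, stackOrder H (Sum.inl x) (τ (Sum.inl x)) ↔ τ (Sum.inl x) ≠ Sum.inl x := fun x => by
    constructor
    · intro h h'
      rw [h'] at h
      exact ht.irrefl _ h
    · intro h
      obtain ⟨y, hy⟩ := hl x h
      rw [hy]
      exact stackOrder_inl_inr H x y
  have h2 : ∀ y, ¬ stackOrder H (Sum.inr y) (τ (Sum.inr y)) := fun y h => by
    by_cases h' : τ (Sum.inr y) = Sum.inr y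
    · rw [h'] at h
      exact ht.irrefl _ h
    · obtain ⟨x, hx⟩ := hr y h'
      rw [hx] at h
      exact (ht.total _ _ Sum.inr_ne_inl).mp h (stackOrder_inl_inr H x y)
  rw [weight, Fintype.prod_sum_type]
  simp only [h1, h2, if_false, Finset.prod_const_one, mul_one]
  rw [← Finset.prod_filter, Finset.prod_mul_distrib, Finset.prod_const]
  congr 1
  -- The signs on `X`, extended by `1` to `Y`. Reindexing the product of `u` by `τ` turns a product
  -- over the cut edges of `X` into one over the cut edges of `Y`.
  let u : X ⊕ Y → Polynomial k := Sum.elim (fun x => if τ (Sum.inl x) ≠ Sum.inl x then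
    (D.edge x).sign (Polynomial k) else 1) fun _ => 1
  have hu : ∏ x, u (Sum.inl x) = ∏ y, u (τ (Sum.inr y)) := by
    have h3 : ∏ z, u z = ∏ x, u (Sum.inl x) := by
      rw [Fintype.prod_sum_type]
      simp [u]
    have h4 : ∏ z, u (τ z) = ∏ y, u (τ (Sum.inr y)) := by
      rw [Fintype.prod_sum_type, Finset.prod_eq_one (fun x _ => ?_), one_mul]
      by_cases hx : τ (Sum.inl x) = Sum.inl x
      · rw [hx]
        simp [u, hx]
      · obtain ⟨y, hy⟩ := hl x hx
        rw [hy]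
        rfl
    rw [← h3, ← h4, Equiv.prod_comp τ u]
  have h5 : ∀ y, u (τ (Sum.inr y)) =
      if τ (Sum.inr y) ≠ Sum.inr y ∧ (D'.edge y).IsForward then -1 else 1 := fun y => by
    by_cases hy : τ (Sum.inr y) = Sum.inr y
    · rw [hy]
      simp [u]
    · obtain ⟨x, hx⟩ := hr y hy
      have hx' : τ (Sum.inl x) ≠ Sum.inl x := by
        rw [← hx, hτ.1]
        exact fun h => hy h.symm
      have he : D.edge x = (D'.edge y).rev := hτ.edge_eq hx Sum.inr_ne_inl
      have : u (τ (Sum.inr y)) = (D.edge x).sign (Polynomial k) := by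
        rw [hx]
        exact if_pos hx'
      rw [this, he, sign_rev, DEdge.sign]
      by_cases hf : (D'.edge y).IsForward <;> simp [hy, hf]
  rw [Finset.prod_filter]
  refine Eq.trans hu ?_
  rw [Finset.prod_congr rfl fun y _ => h5 y, ← Finset.prod_filter, Finset.prod_const]

/-- A pair glued inside one of the two parts can exchange its heights without leaving the stacked
height assignments, which is impossible for a cross pair. So precisely the gluings with an inner
pair cancel. -/
theorem sum_cross [CharZero k] (D : Diagram V X) (D' : Diagram V Y) {n m : ℕ}
    (τ : Equiv.Perm (X ⊕ Y)) (hτ : (D.disjUnion D').IsGluing τ)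
    [Fintype ((X ≃ Fin n) × (Y ≃ Fin m))]
    (hc : ¬ ∀ z, τ z ≠ z → (τ z).isLeft = !z.isLeft) :
    ∑ H : (X ≃ Fin n) × (Y ≃ Fin m), (D.disjUnion D').weight k (stackOrder H) τ = 0 := by
  classical
  push Not at hc
  obtain ⟨z, hz, hz'⟩ := hc
  rcases z with x | x
  · obtain ⟨y, hy⟩ : ∃ y, τ (Sum.inl x) = Sum.inl y := by
      rcases h : τ (Sum.inl x) with y | y
      · exact ⟨y, rfl⟩
      · simp [h] at hz'
    refine sum_weight_eq_zero k _ _ isTournament_stackOrder τ hτ (Sum.inl x) hz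
      (Equiv.prodCongr ((Equiv.swap x y).equivCongr (Equiv.refl _)) (Equiv.refl _)) ?_
    have hs : ∀ (H : (X ≃ Fin n) × (Y ≃ Fin m)) t, Sum.map
        (Equiv.prodCongr ((Equiv.swap x y).equivCongr (Equiv.refl _)) (Equiv.refl _) H).1 H.2 t =
        Sum.map H.1 H.2 (Equiv.swap (Sum.inl x) (Sum.inl y) t) := by
      rintro H (t | t)
      · rw [Sum.inl_injective.swap_apply]
        simp
      · rw [Equiv.swap_apply_of_ne_of_ne Sum.inr_ne_inl Sum.inr_ne_inl]
        simp
    intro H s t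
    rw [hy, stackOrder, stackOrder, ← hs, ← hs]
    rfl
  · obtain ⟨y, hy⟩ : ∃ y, τ (Sum.inr x) = Sum.inr y := by
      rcases h : τ (Sum.inr x) with y | y
      · simp [h] at hz'
      · exact ⟨y, rfl⟩
    refine sum_weight_eq_zero k _ _ isTournament_stackOrder τ hτ (Sum.inr x) hz
      (Equiv.prodCongr (Equiv.refl _) ((Equiv.swap x y).equivCongr (Equiv.refl _))) ?_
    have hs : ∀ (H : (X ≃ Fin n) × (Y ≃ Fin m)) t, Sum.map H.1
        (Equiv.prodCongr (Equiv.refl _) ((Equiv.swap x y).equivCongr (Equiv.refl _)) H).2 t =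
        Sum.map H.1 H.2 (Equiv.swap (Sum.inr x) (Sum.inr y) t) := by
      rintro H (t | t)
      · rw [Equiv.swap_apply_of_ne_of_ne Sum.inl_ne_inr Sum.inl_ne_inr]
        simp
      · rw [Sum.inr_injective.swap_apply]
        simp
    intro H s t
    rw [hy, stackOrder, stackOrder, ← hs, ← hs]
    rfl

/-- Origin of the Moyal formula: by `sum_cross` only cross gluings survive, and their weight is
constant by `weight_cross`. The number of pairs of heights cancels the two normalizing factorials.
-/
theorem wickMap_average_mul [CharZero k] (D : Diagram V X) (D' : Diagram V Y) :
    wickMap k (D.average k * D'.average k) = D.moyal k D' := by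
  classical
  have h1 : wickMap k (D.average k * D'.average k) =
      Polynomial.C (((Fintype.card X)! : k)⁻¹) • Polynomial.C (((Fintype.card Y)! : k)⁻¹) •
      ∑ H : (X ≃ Fin (Fintype.card X)) × (Y ≃ Fin (Fintype.card Y)),
        (D.disjUnion D').wick k (stackOrder H) := by
    rw [D.average_eq k _ rfl, D'.average_eq k _ rfl, smul_mul_assoc, mul_smul_comm, map_smul,
      map_smul, Finset.sum_mul_sum, map_sum, Fintype.sum_prod_type]
    simp only [map_sum, ← toAh_mul, wickMap_toAh]
    congr 2
    refine Finset.sum_congr rfl fun H _ => Finset.sum_congr rfl fun H' _ => ?_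
    exact wick_mul_relabel k D D' (H, H')
  rw [h1, sum_wick, moyal, Finset.smul_sum, Finset.smul_sum]
  rw [← Finset.sum_filter_of_ne (p := fun τ : (D.disjUnion D').Gluing =>
    ∀ z, τ.1 z ≠ z → (τ.1 z).isLeft = !z.isLeft)]
  · symm
    refine Finset.sum_bij (fun τ _ => ⟨τ.1, τ.2.1⟩) ?_ ?_ ?_ ?_
    · exact fun τ _ => Finset.mem_filter.mpr ⟨Finset.mem_univ _, τ.2.2⟩
    · exact fun τ _ σ _ h => Subtype.ext (congrArg Gluing.perm h)
    · exact fun τ h => ⟨⟨τ.1, τ.2, (Finset.mem_filter.mp h).2⟩, Finset.mem_univ _, rfl⟩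
    · intro τ _
      simp only [weight_cross k D D' _ τ.1 τ.2.1 τ.2.2]
      rw [Finset.sum_const, Finset.card_univ, Fintype.card_prod,
        Fintype.card_equiv (Fintype.equivFin X), Fintype.card_equiv (Fintype.equivFin Y),
        nsmul_eq_mul, Nat.cast_mul]
      exact Eq.trans (by congr!) (C_inv_factorial_smul₂ k _ _ _ _).symm
  · intro τ _ h
    by_contra hc
    exact h (by rw [sum_cross k D D' τ.1 τ.2 hc, zero_smul, smul_zero, smul_zero])

end Diagram

end

section

variable {V : Type u} [Quiver.{v} V] (k : Type w) [Field k]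

/-! ### The symmetrization map is an isomorphism -/

theorem toAh_commute {N : ℕ} (D : Diagram V (Fin N)) (i j : Fin N) (hij : (i : ℕ) + 1 = j)
    (h : D.edge j ≠ (D.edge i).rev) :
    HDiagram.toAh k ⟨N, D⟩ = HDiagram.toAh k ⟨N, D.relabel (Equiv.swap i j)⟩ :=
  RingQuot.mkAlgHom_rel _ (HRel.commute D i j hij h)

theorem toAh_glue {N : ℕ} (D : Diagram V (Fin N)) (i j : Fin N) (hij : (i : ℕ) + 1 = j)
    (h : D.edge j = (D.edge i).rev) :
    HDiagram.toAh k ⟨N, D⟩ = HDiagram.toAh k ⟨N, D.relabel (Equiv.swap i j)⟩ +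
      (Polynomial.X * (D.edge i).sign (Polynomial k)) •
        HDiagram.toAh k (HDiagram.ofOrdered (D.cut _ (D.isGluing_swap i j h))) := by
  have := RingQuot.mkAlgHom_rel (Polynomial k) (HRel.glue (k := k) D i j hij h)
  rwa [map_add, map_smul] at this

theorem toAh_one : HDiagram.toAh k (1 : HDiagram V) = 1 := by
  rw [HDiagram.toAh, HDiagram.toAlg, map_one, map_one]

theorem Ah_induction {p : Ah k V → Prop} (a : Ah k V)
    (h : ∀ D : HDiagram V, p (D.toAh k)) (hadd : ∀ a b, p a → p b → p (a + b))
    (hsmul : ∀ (c : Polynomial k) a, p a → p (c • a)) : p a := by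
  obtain ⟨a, rfl⟩ := RingQuot.mkAlgHom_surjective (Polynomial k) (HRel (V := V) k) a
  induction a using heightAlgebra_induction k with
  | h D => exact h D
  | hadd a b ha hb =>
    rw [map_add]
    exact hadd _ _ ha hb
  | hsmul c a ha =>
    rw [map_smul]
    exact hsmul _ _ ha

/-- Transpositions of neighbours generate the symmetric group, and `R` absorbs the correction terms.
-/
theorem exists_eq_relabel_add (R : Submodule (Polynomial k) (Ah k V)) {N : ℕ}
    (h : ∀ (D : Diagram V (Fin N)) (i j : Fin N), (i : ℕ) + 1 = j →
      ∃ r ∈ R, HDiagram.toAh k ⟨N, D⟩ = HDiagram.toAh k ⟨N, D.relabel (Equiv.swap i j)⟩ + r)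
    (D : Diagram V (Fin N)) (σ : Equiv.Perm (Fin N)) :
    ∃ r ∈ R, HDiagram.toAh k ⟨N, D⟩ = HDiagram.toAh k ⟨N, D.relabel σ⟩ + r := by
  rcases N with _ | n
  · rw [Subsingleton.elim σ (Equiv.refl _)]
    exact ⟨0, R.zero_mem, (add_zero _).symm⟩
  · have hσ : σ ∈ Submonoid.closure
        (Set.range fun i : Fin n => Equiv.swap i.castSucc i.succ) := by
      rw [Equiv.Perm.mclosure_swap_castSucc_succ]
      trivial
    induction hσ using Submonoid.closure_induction generalizing D with
    | mem σ hσ =>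
      obtain ⟨i, rfl⟩ := hσ
      exact h D i.castSucc i.succ rfl
    | one => exact ⟨0, R.zero_mem, (add_zero _).symm⟩
    | mul σ τ _ _ hσ hτ =>
      obtain ⟨r, hr, h1⟩ := hτ D
      obtain ⟨s, hs, h2⟩ := hσ (D.relabel τ)
      refine ⟨s + r, R.add_mem hs hr, h1.trans ?_⟩
      rw [h2, add_assoc]
      rfl

/-- Induction on the number of edges. The correction term of the gluing relation has fewer edges and
lies in the range by induction, so modulo the range all heights of a given collection are
equivalent. -/
theorem PhiW_surjective [CharZero k] : Function.Surjective (PhiW (V := V) k) := by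
  classical
  have key : ∀ N (D : Diagram V (Fin N)),
      HDiagram.toAh k ⟨N, D⟩ ∈ LinearMap.range (PhiW (V := V) k) := by
    intro N
    induction N using Nat.strong_induction_on with
    | _ N ih =>
      intro D
      have h1 : ∀ σ : Equiv.Perm (Fin N), ∃ r ∈ LinearMap.range (PhiW (V := V) k),
          HDiagram.toAh k ⟨N, D⟩ = HDiagram.toAh k ⟨N, D.relabel σ⟩ + r := by
        refine exists_eq_relabel_add k _ (fun D i j hij => ?_) D
        by_cases h : D.edge j = (D.edge i).rev
        · refine ⟨_, Submodule.smul_mem _ _ (ih _ ?_ _), toAh_glue k D i j hij h⟩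
          have hne : i ≠ j := fun h => by rw [h] at hij; omega
          have := Fintype.card_subtype_lt (p := fun x => Equiv.swap i j x = x) (x := i)
            (by simpa using hne.symm)
          simpa using this
        · exact ⟨0, Submodule.zero_mem _, (toAh_commute k D i j hij h).trans (add_zero _).symm⟩
      choose r hr h2 using h1
      -- The class is written as the mean of `N!` copies of itself, and the copy with index `σ` is
      -- then replaced by the collection with heights permuted by `σ`.
      have h3 : HDiagram.toAh k ⟨N, D⟩ = Polynomial.C ((N ! : k)⁻¹) •
          ∑ _ : Fin N ≃ Fin N, HDiagram.toAh k ⟨N, D⟩ := by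
        rw [Finset.sum_const, Finset.card_univ, Fintype.card_perm, Fintype.card_fin,
          ← Nat.cast_smul_eq_nsmul (Polynomial k), Diagram.C_inv_factorial_smul]
      rw [h3, Finset.sum_congr rfl fun σ _ => h2 σ, Finset.sum_add_distrib, smul_add,
        ← D.average_eq k N (Fintype.card_fin N), ← Diagram.PhiW_sym k D]
      exact Submodule.add_mem _ (LinearMap.mem_range_self _ _)
        (Submodule.smul_mem _ _ (Submodule.sum_mem _ fun σ _ => hr σ))
  intro a
  change a ∈ LinearMap.range (PhiW (V := V) k)
  induction a using Ah_induction k with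
  | h D => exact key D.size D.diag
  | hadd a b ha hb => exact Submodule.add_mem _ ha hb
  | hsmul c a ha => exact Submodule.smul_mem _ _ ha

theorem basisMonomials_eq_sym (m : Necklace V →₀ ℕ) :
    MvPolynomial.basisMonomials (Necklace V) (Polynomial k) m =
      (HDiagram.ofMonomial m).diag.sym (Polynomial k) := by
  rw [HDiagram.sym_ofMonomial, MvPolynomial.coe_basisMonomials]

theorem wickMap_PhiW [CharZero k] (P : SymL V (Polynomial k)) : wickMap k (PhiW k P) = P := by
  have : wickMap k ∘ₗ PhiW (V := V) k = LinearMap.id := by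
    refine (MvPolynomial.basisMonomials (Necklace V) (Polynomial k)).ext fun m => ?_
    rw [basisMonomials_eq_sym, LinearMap.comp_apply, Diagram.PhiW_sym, Diagram.wickMap_average]
    rfl
  exact LinearMap.congr_fun this P

theorem PhiW_bijective [CharZero k] : Function.Bijective (PhiW (V := V) k) :=
  ⟨Function.LeftInverse.injective (wickMap_PhiW k), PhiW_surjective k⟩

theorem PhiW_wickMap [CharZero k] (a : Ah k V) : PhiW k (wickMap k a) = a := by
  obtain ⟨P, rfl⟩ := PhiW_surjective k a
  rw [wickMap_PhiW]

/-- Both sides are bilinear and agree on monomials. The algebraic properties of `star` are thereby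
inherited from `A_h(Q)`. -/
theorem star_eq [CharZero k] (P R : SymL V (Polynomial k)) :
    star k P R = wickMap k (PhiW k P * PhiW k R) := by
  have : star (V := V) k = ((LinearMap.mul (Polynomial k) (Ah k V)).compl₁₂ (PhiW k)
      (PhiW k)).compr₂ (wickMap k) := by
    refine (MvPolynomial.basisMonomials (Necklace V) (Polynomial k)).ext fun m => ?_
    refine (MvPolynomial.basisMonomials (Necklace V) (Polynomial k)).ext fun m' => ?_
    rw [star, Module.Basis.constr_basis, Module.Basis.constr_basis, basisMonomials_eq_sym,
      basisMonomials_eq_sym]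
    simp only [LinearMap.compr₂_apply, LinearMap.compl₁₂_apply, LinearMap.mul_apply',
      Diagram.PhiW_sym, Diagram.wickMap_average_mul]
  rw [this]
  rfl

theorem PhiW_star [CharZero k] (P R : SymL V (Polynomial k)) :
    PhiW k (star k P R) = PhiW k P * PhiW k R := by
  rw [star_eq, PhiW_wickMap]

theorem star_sym [CharZero k] {X Y : Type*} [Fintype X] [Fintype Y] (D : Diagram V X)
    (D' : Diagram V Y) :
    star k (D.sym (Polynomial k)) (D'.sym (Polynomial k)) = D.moyal k D' := by
  rw [star_eq, Diagram.PhiW_sym, Diagram.PhiW_sym, Diagram.wickMap_average_mul]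

theorem star_assoc [CharZero k] (P R S : SymL V (Polynomial k)) :
    star k (star k P R) S = star k P (star k R S) := by
  apply (PhiW_bijective k).1
  simp only [PhiW_star, mul_assoc]

theorem sym_one (R : Type*) [CommSemiring R] : (1 : HDiagram V).diag.sym R = 1 := by
  rw [Diagram.sym, HDiagram.necklaces_one, Multiset.map_zero, Multiset.prod_zero]

theorem PhiW_one : PhiW (V := V) k 1 = 1 := by
  classical
  have h : ∀ H : Fin 0 ≃ Fin 0, HDiagram.toAh k ⟨0, (1 : HDiagram V).diag.relabel H⟩ = 1 := by
    intro H
    rw [Subsingleton.elim H (Equiv.refl _)]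
    exact toAh_one k
  have h2 := (1 : HDiagram V).diag.average_eq k 0 (Fintype.card_fin 0)
  rw [← sym_one, Diagram.PhiW_sym]
  refine h2.trans (Eq.trans (congrArg _ (Finset.sum_congr rfl fun H _ => h H)) ?_)
  simp only [Finset.sum_const, Finset.card_univ, Nat.factorial_zero, Nat.cast_one, inv_one,
    map_one, one_smul]
  exact (congrArg (· • (1 : Ah k V)) (Fintype.card_eq_one_iff.2
    ⟨Equiv.refl (Fin 0), fun _ => Equiv.ext finZeroElim⟩)).trans (one_smul ℕ _)

theorem one_star [CharZero k] (P : SymL V (Polynomial k)) : star k 1 P = P ∧ star k P 1 = P := by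
  constructor <;> apply (PhiW_bijective k).1
  · rw [PhiW_star, PhiW_one, one_mul]
  · rw [PhiW_star, PhiW_one, mul_one]

/-! ### Forgetting the heights -/

theorem sym_mul (R : Type*) [CommSemiring R] (D E : HDiagram V) :
    (D * E).diag.sym R = D.diag.sym R * E.diag.sym R := by
  rw [Diagram.sym, HDiagram.necklaces_mul, Multiset.map_add, Multiset.prod_add]
  rfl

/-- The multiplicative map from collections with heights to monomials. -/
noncomputable def symHom (R : Type*) [CommSemiring R] : HDiagram V →* SymL V R where
  toFun D := D.diag.sym R
  map_one' := sym_one R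
  map_mul' := sym_mul R

/-- Forgetting heights, on linear combinations of collections with heights. -/
noncomputable def forgetHom : HeightAlgebra k V →+* SymL V k :=
  MonoidAlgebra.liftNCRingHom (MvPolynomial.C.comp (Polynomial.evalRingHom 0)) (symHom k)
    fun _ _ => Commute.all _ _

theorem forgetHom_toAlg (D : HDiagram V) : forgetHom k (D.toAlg k) = D.diag.sym k := by
  rw [forgetHom, HDiagram.toAlg, MonoidAlgebra.of_apply, MonoidAlgebra.liftNCRingHom_single,
    map_one, one_mul]
  rfl

theorem forgetHom_smul (c : Polynomial k) (a : HeightAlgebra k V) :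
    forgetHom k (c • a) = MvPolynomial.C (c.eval 0) * forgetHom k a := by
  rw [Algebra.smul_def, map_mul]
  congr 1
  rw [MonoidAlgebra.coe_algebraMap, forgetHom, Function.comp_apply,
    MonoidAlgebra.liftNCRingHom_single, map_one, mul_one]
  rfl

/-- The homomorphism `A_h(Q) → Sym L` which forgets heights and sends `h` to `0`. -/
noncomputable def pr : Ah k V →+* SymL V k :=
  RingQuot.lift ⟨forgetHom k, fun x y h => by
    cases h with
    | commute D i j hij h =>
      rw [forgetHom_toAlg, forgetHom_toAlg]
      exact (Diagram.sym_relabel k D _).symm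
    | glue D i j hij h =>
      rw [map_add, forgetHom_smul, forgetHom_toAlg, forgetHom_toAlg]
      -- The term with the deleted pair carries a factor `h`, which is sent to `0`.
      simp only [Polynomial.eval_mul, Polynomial.eval_X, zero_mul, map_zero, add_zero]
      exact (Diagram.sym_relabel k D _).symm⟩

theorem pr_mkAlgHom (a : HeightAlgebra k V) :
    pr k (RingQuot.mkAlgHom (Polynomial k) (HRel k) a) = forgetHom k a := by
  have : RingQuot.mkAlgHom (Polynomial k) (HRel k) a = RingQuot.mkRingHom (HRel (V := V) k) a := by
    rw [← RingQuot.mkAlgHom_coe (Polynomial k)]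
    rfl
  rw [this]
  exact RingQuot.lift_mkRingHom_apply _ _ _

theorem pr_toAh (D : HDiagram V) : pr k (D.toAh k) = D.diag.sym k :=
  (pr_mkAlgHom k _).trans (forgetHom_toAlg k D)

theorem pr_algebraMap (c : Polynomial k) :
    pr k (algebraMap (Polynomial k) (Ah k V) c) = MvPolynomial.C (c.eval 0) := by
  rw [← (RingQuot.mkAlgHom (Polynomial k) (HRel (V := V) k)).commutes, pr_mkAlgHom,
    Algebra.algebraMap_eq_smul_one, forgetHom_smul, map_one, mul_one]

theorem pr_smul (c : Polynomial k) (a : Ah k V) :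
    pr k (c • a) = MvPolynomial.C (c.eval 0) * pr k a := by
  rw [Algebra.smul_def, map_mul, pr_algebraMap]

theorem atZero_smul {σ : Type*} (c : Polynomial k) (P : MvPolynomial σ (Polynomial k)) :
    atZero k σ (c • P) = MvPolynomial.C (c.eval 0) * atZero k σ P := by
  rw [atZero, MvPolynomial.smul_eq_C_mul, map_mul, MvPolynomial.map_C]
  rfl

theorem atZero_sym {X : Type*} [Fintype X] (D : Diagram V X) :
    atZero k _ (D.sym (Polynomial k)) = D.sym k := by
  rw [Diagram.sym_eq_monomial, Diagram.sym_eq_monomial, atZero, MvPolynomial.map_monomial, map_one]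

theorem pr_average [CharZero k] {X : Type*} [Fintype X] (D : Diagram V X) :
    pr k (D.average k) = D.sym k := by
  classical
  rw [D.average_eq k _ rfl, pr_smul, map_sum]
  have : ∀ H : X ≃ Fin (Fintype.card X), pr k (HDiagram.toAh k ⟨_, D.relabel H⟩) = D.sym k :=
    fun H => (pr_toAh k _).trans (D.sym_relabel k H)
  rw [Finset.sum_congr rfl fun H _ => this H, Finset.sum_const, Finset.card_univ,
    Fintype.card_equiv (Fintype.equivFin X), Polynomial.eval_C, nsmul_eq_mul, ← mul_assoc,
    ← map_natCast (MvPolynomial.C (R := k) (σ := Necklace V)), ← MvPolynomial.C_mul,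
    inv_mul_cancel₀ (by exact_mod_cast (Nat.factorial_ne_zero _)), MvPolynomial.C_1, one_mul]

theorem SymL_induction {p : SymL V (Polynomial k) → Prop} (P : SymL V (Polynomial k))
    (h : ∀ D : HDiagram V, p (D.diag.sym (Polynomial k)))
    (hadd : ∀ a b, p a → p b → p (a + b))
    (hsmul : ∀ (c : Polynomial k) a, p a → p (c • a)) : p P := by
  induction P using MvPolynomial.induction_on' with
  | add a b ha hb => exact hadd a b ha hb
  | monomial m c =>
    have := hsmul c _ (h (HDiagram.ofMonomial m))
    rwa [HDiagram.sym_ofMonomial, MvPolynomial.smul_monomial, smul_eq_mul, mul_one] at this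

theorem pr_PhiW [CharZero k] (P : SymL V (Polynomial k)) : pr k (PhiW k P) = atZero k _ P := by
  induction P using SymL_induction k with
  | h D => rw [Diagram.PhiW_sym, pr_average, atZero_sym]
  | hadd a b ha hb => rw [map_add, map_add, map_add, ha, hb]
  | hsmul c a ha => rw [map_smul, pr_smul, atZero_smul, ha]

end

section

/-! ### Sums over index functions -/

namespace Diagram

section VertexProd

variable {V : Type u} (l : V → ℕ)

/-- The product of the numbers `l v` over the vertex idempotents `v`. -/
def vertexProd (s : Multiset (Quiver.Symmetrify V)) : ℕ := (Multiset.map (α := V) l s).prod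

theorem vertexProd_zero : vertexProd l (0 : Multiset (Quiver.Symmetrify V)) = 1 := rfl

theorem vertexProd_add (s t : Multiset (Quiver.Symmetrify V)) :
    vertexProd l (s + t) = vertexProd l s * vertexProd l t := by
  unfold vertexProd
  exact (congrArg Multiset.prod (Multiset.map_add (α := V) l s t)).trans (Multiset.prod_add _ _)

theorem vertexProd_singleton (v : Quiver.Symmetrify V) : vertexProd l {v} = l v :=
  Multiset.prod_singleton _

theorem vertexProd_sum_singleton {ι : Type*} (s : Finset ι) (f : ι → Quiver.Symmetrify V) :
    vertexProd l (∑ i ∈ s, {f i}) = ∏ i ∈ s, l (f i) := by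
  classical
  induction s using Finset.induction_on with
  | empty => rfl
  | insert i s hi ih =>
    rw [Finset.sum_insert hi, Finset.prod_insert hi, vertexProd_add, ih, vertexProd_singleton]

end VertexProd

variable {V : Type u} [Quiver.{v} V] {X : Type*} {Y : Type*}
variable {A : Type*} [Semiring A] (l : V → ℕ) (c : DEdge V → ℕ → ℕ → A)

open Classical in
/-- The index functions of a collection: one index for each abstract edge, at its tail. -/
noncomputable def indices [Fintype X] (D : Diagram V X) : Finset (X → ℕ) :=
  Fintype.piFinset fun x => Finset.range (l (D.edge x).left)

theorem mem_indices [Fintype X] {D : Diagram V X} {idx : X → ℕ} :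
    idx ∈ D.indices l ↔ ∀ x, idx x < l (D.edge x).left := by
  simp [indices]

/-- The summand of an index function: the product of the matrix entries along the list `L`. -/
def entryProd (D : Diagram V X) (idx : X → ℕ) (L : List X) : A :=
  (L.map fun x => c (D.edge x) (idx x) (idx (D.next x))).prod

/-- The sum over all index functions of the products of matrix entries, multiplied in the order
of the list `L` of abstract edges. -/
noncomputable def indexSum [Fintype X] (D : Diagram V X) (L : List X) : A :=
  vertexProd l D.verts • ∑ idx ∈ D.indices l, D.entryProd c idx L

theorem indexSum_relabel [Fintype X] [Fintype Y] (D : Diagram V X) (e : X ≃ Y) (L : List X) :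
    (D.relabel e).indexSum l c (L.map e) = D.indexSum l c L := by
  unfold indexSum
  congr 1
  refine Finset.sum_nbij' (fun idx => idx ∘ e) (fun idx => idx ∘ e.symm) ?_ ?_ ?_ ?_ ?_
  · intro idx h
    rw [mem_indices] at h ⊢
    intro x
    simpa [relabel] using h (e x)
  · intro idx h
    rw [mem_indices] at h ⊢
    exact fun y => h (e.symm y)
  · intro idx _
    ext; simp
  · intro idx _
    ext; simp
  · intro idx _
    simp [entryProd, relabel, Function.comp_def]

theorem indexSum_disjUnion [Fintype X] [Fintype Y] (D : Diagram V X) (D' : Diagram V Y) (L : List X) (L' : List Y) :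
    (D.disjUnion D').indexSum l c (L.map Sum.inl ++ L'.map Sum.inr) =
      D.indexSum l c L * D'.indexSum l c L' := by
  unfold indexSum
  rw [smul_mul_smul_comm, Finset.sum_mul_sum, ← Finset.sum_product']
  congr 1
  · exact vertexProd_add l _ _
  · refine Finset.sum_nbij' (fun idx => (idx ∘ Sum.inl, idx ∘ Sum.inr))
      (fun p => Sum.elim p.1 p.2) ?_ ?_ ?_ ?_ ?_
    · intro idx h
      rw [mem_indices] at h
      rw [Finset.mem_product, mem_indices, mem_indices]
      exact ⟨fun x => h (Sum.inl x), fun y => h (Sum.inr y)⟩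
    · rintro ⟨i, j⟩ h
      rw [Finset.mem_product, mem_indices, mem_indices] at h
      rw [mem_indices]
      rintro (x | y)
      · exact h.1 x
      · exact h.2 y
    · intro idx _
      exact Sum.elim_comp_inl_inr idx
    · intro p _
      rfl
    · intro idx _
      simp [entryProd, disjUnion, Function.comp_def]

/-- A function which agrees at moved points and their images is constant along the glued path up
to the first fixed point. -/
theorem eq_iterate_glued {D : Diagram V X} {τ : Equiv.Perm X} {β : Type*} (f : X → β)
    (hf : ∀ x, τ x ≠ x → f x = f (D.glued τ x)) (x : X) (n : ℕ)
    (hn : ∀ m < n, τ ((D.glued τ)^[m] x) ≠ (D.glued τ)^[m] x) :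
    f x = f ((D.glued τ)^[n] x) := by
  induction n with
  | zero => rfl
  | succ n ih =>
    rw [ih fun m hm => hn m (by omega), Function.iterate_succ_apply']
    exact hf _ (hn n (by omega))

theorem not_lost_iff [Finite X] {D : Diagram V X} {τ : Equiv.Perm X} {x : X} :
    ¬ D.Lost τ x ↔ ∃ n : ℕ, τ ((D.glued τ)^[n] x) = (D.glued τ)^[n] x := by
  unfold Lost
  push Not
  constructor
  · rintro ⟨y, hy, h⟩
    obtain ⟨n, rfl⟩ := exists_iterate_of_sameCycle hy
    exact ⟨n, h⟩
  · rintro ⟨n, h⟩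
    exact ⟨_, sameCycle_iterate _ _ n, h⟩

theorem sameCycle_out {f : Equiv.Perm X} (x : X) :
    f.SameCycle (Quotient.mk (Equiv.Perm.SameCycle.setoid f) x).out x :=
  Quotient.mk_out (s := Equiv.Perm.SameCycle.setoid f) x

open Classical in
/-- The index function of a collection obtained from an index function after cutting and gluing,
and from a choice of an index for each lost cycle. -/
noncomputable def extendIndex (D : Diagram V X) (τ : Equiv.Perm X) (i : {x // τ x = x} → ℕ)
    (g : Orbit (D.glued τ) → ℕ) (x : X) : ℕ :=
  if h : ∃ n : ℕ, τ ((D.glued τ)^[n] x) = (D.glued τ)^[n] x then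
    i ⟨(D.glued τ)^[Nat.find h] x, Nat.find_spec h⟩ else g (Quotient.mk _ x)

theorem extendIndex_of_fixed (D : Diagram V X) (τ : Equiv.Perm X) (i : {x // τ x = x} → ℕ)
    (g : Orbit (D.glued τ) → ℕ) (x : X) (hx : τ x = x) : D.extendIndex τ i g x = i ⟨x, hx⟩ := by
  classical
  have h : ∃ n : ℕ, τ ((D.glued τ)^[n] x) = (D.glued τ)^[n] x := ⟨0, hx⟩
  rw [extendIndex, dif_pos h]
  have h0 : Nat.find h = 0 := (Nat.find_eq_zero h).2 hx
  exact congrArg i (Subtype.ext (by dsimp only; rw [h0]; rfl))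

theorem extendIndex_of_lost [Finite X] (D : Diagram V X) (τ : Equiv.Perm X) (i : {x // τ x = x} → ℕ)
    (g : Orbit (D.glued τ) → ℕ) (x : X) (hx : D.Lost τ x) :
    D.extendIndex τ i g x = g (Quotient.mk _ x) := by
  rw [extendIndex, dif_neg]
  exact fun h => not_lost_iff.2 h hx

/-- If a surviving edge is reached from the cut edge `x`, one step shortens the way to it by exactly
one. Otherwise `x` and its glued successor lie on the same lost orbit. -/
theorem extendIndex_glued [Finite X] (D : Diagram V X) (τ : Equiv.Perm X) (i : {x // τ x = x} → ℕ)
    (g : Orbit (D.glued τ) → ℕ) (x : X) (hx : τ x ≠ x) :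
    D.extendIndex τ i g x = D.extendIndex τ i g (D.glued τ x) := by
  classical
  by_cases h : ∃ n : ℕ, τ ((D.glued τ)^[n] x) = (D.glued τ)^[n] x
  · have h' : ∃ n : ℕ, τ ((D.glued τ)^[n] (D.glued τ x)) = (D.glued τ)^[n] (D.glued τ x) := by
      obtain ⟨n, hn⟩ := h
      rcases n with _ | n
      · exact absurd hn hx
      · exact ⟨n, hn⟩
    have h0 : Nat.find h = Nat.find h' + 1 := Nat.find_comp_succ h h' hx
    rw [extendIndex, dif_pos h, extendIndex, dif_pos h']
    exact congrArg i (Subtype.ext (by dsimp only; rw [h0]; rfl))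
  · have hl : D.Lost τ x := not_not.1 fun hl => h (not_lost_iff.1 hl)
    have hs : (D.glued τ).SameCycle x (D.glued τ x) := sameCycle_iterate _ _ 1
    rw [extendIndex_of_lost _ _ _ _ _ hl, extendIndex_of_lost _ _ _ _ _ (hl.of_sameCycle _ _ hs)]
    exact congrArg g (Quotient.sound hs)

open Classical in
-- The constraints make an index function constant along every stretch of cut edges. It is therefore
-- determined by its values at the surviving edges and by one free value for each lost orbit; the
-- free values account for the product.
theorem sum_indices_cut [Fintype X] {M : Type*} [AddCommMonoid M] (D : Diagram V X)
    (τ : Equiv.Perm X) [Fintype {x // τ x = x}]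
    (hτ : D.IsGluing τ) (F : ({x // τ x = x} → ℕ) → M) :
    ∑ idx ∈ D.indices l with ∀ x, τ x ≠ x → idx x = idx (D.glued τ x), F (fun x => idx x) =
      (∏ o : Orbit (D.glued τ) with D.Lost τ o.out, l (D.edge o.out).left) •
        ∑ idx ∈ (D.cut τ hτ).indices l, F idx := by
  -- Orbits that are not lost receive the dummy value `0`, so that the free values form a function
  -- on all orbits.
  let G : Orbit (D.glued τ) → Finset ℕ := fun o =>
    if D.Lost τ o.out then Finset.range (l (D.edge o.out).left) else {0}
  have hG : (∏ o : Orbit (D.glued τ) with D.Lost τ o.out, l (D.edge o.out).left) =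
      (Fintype.piFinset G).card := by
    rw [Fintype.card_piFinset, Finset.prod_filter]
    refine Finset.prod_congr rfl fun o _ => ?_
    by_cases h : D.Lost τ o.out <;> simp [G, h]
  have h2 : ∀ idx : X → ℕ, (∀ x, τ x ≠ x → idx x = idx (D.glued τ x)) → ∀ x n,
      (∀ m < n, τ ((D.glued τ)^[m] x) ≠ (D.glued τ)^[m] x) → idx x = idx ((D.glued τ)^[n] x) :=
    fun idx h x n hn => eq_iterate_glued idx h x n hn
  rw [hG, ← Finset.sum_const, Finset.sum_comm]
  rw [Finset.sum_congr rfl fun _ _ => rfl, ← Finset.sum_product']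
  refine Finset.sum_nbij' (fun idx => ((fun x : {x // τ x = x} => idx x),
      fun o => if D.Lost τ o.out then idx o.out else 0))
    (fun p => D.extendIndex τ p.1 p.2) ?_ ?_ ?_ ?_ ?_
  · intro idx h
    rw [Finset.mem_filter, mem_indices] at h
    rw [Finset.mem_product, mem_indices, Fintype.mem_piFinset]
    refine ⟨fun x => h.1 x, fun o => ?_⟩
    by_cases ho : D.Lost τ o.out
    · simpa [G, ho] using h.1 o.out
    · simp [G, ho]
  · rintro ⟨i, g⟩ h
    rw [Finset.mem_product, mem_indices, Fintype.mem_piFinset] at h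
    rw [Finset.mem_filter, mem_indices]
    refine ⟨fun x => ?_, fun x hx => D.extendIndex_glued τ i g x hx⟩
    by_cases hl : D.Lost τ x
    · rw [extendIndex_of_lost _ _ _ _ _ hl]
      have ho := hl.of_sameCycle _ _ (sameCycle_out x).symm
      have := h.2 (Quotient.mk _ x)
      simp only [G, if_pos ho, Finset.mem_range] at this
      rwa [← hl.left_eq hτ _ _ (sameCycle_out x).symm] at this
    · have he := not_lost_iff.1 hl
      rw [extendIndex, dif_pos he, eq_iterate_glued (fun x => (D.edge x).left)
        (fun x hx => (D.glue_left hτ x hx).symm) x (Nat.find he) fun m hm => Nat.find_min he hm]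
      exact h.1 _
  · intro idx h
    rw [Finset.mem_filter, mem_indices] at h
    funext x
    by_cases hl : D.Lost τ x
    · have ho := hl.of_sameCycle _ _ (sameCycle_out x).symm
      rw [extendIndex_of_lost _ _ _ _ _ hl]
      simp only [if_pos ho]
      obtain ⟨n, hn⟩ := exists_iterate_of_sameCycle (sameCycle_out (f := D.glued τ) x)
      conv_rhs => rw [← hn]
      exact h2 idx h.2 _ n fun m _ => ho _ (sameCycle_iterate _ _ m)
    · have he := not_lost_iff.1 hl
      rw [extendIndex, dif_pos he]
      exact (h2 idx h.2 x _ fun m hm => Nat.find_min he hm).symm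
  · rintro ⟨i, g⟩ h
    rw [Finset.mem_product, Fintype.mem_piFinset] at h
    refine Prod.ext (funext fun x => D.extendIndex_of_fixed τ i g x x.2) (funext fun o => ?_)
    by_cases ho : D.Lost τ o.out
    · simp only [if_pos ho]
      rw [extendIndex_of_lost _ _ _ _ _ ho, Quotient.out_eq]
    · have := h.2 o
      simp only [G, if_neg ho, Finset.mem_singleton] at this
      simp only [if_neg ho, this]
  · intro idx _
    rfl

open Classical in
-- The factor counting the free indices of lost orbits is the one contributed by the new vertex
-- idempotents. What remains is the constrained sum over the index functions of the uncut
-- collection.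
theorem indexSum_cut [Fintype X] (D : Diagram V X) (τ : Equiv.Perm X)
    [Fintype {x // τ x = x}] (hτ : D.IsGluing τ) (L : List {x // τ x = x}) :
    (D.cut τ hτ).indexSum l c L = vertexProd l D.verts •
      ∑ idx ∈ D.indices l with ∀ x, τ x ≠ x → idx x = idx (D.glued τ x),
        D.entryProd c idx (L.map Subtype.val) := by
  have hv : vertexProd l (D.cut τ hτ).verts = vertexProd l D.verts *
      ∏ o : Orbit (D.glued τ) with D.Lost τ o.out, l (D.edge o.out).left := by
    rw [cut_verts, vertexProd_add, vertexProd_sum_singleton]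
  rw [indexSum, hv, mul_smul, ← sum_indices_cut l D τ hτ fun idx =>
    (D.cut τ hτ).entryProd c idx L]
  congr 1
  refine Finset.sum_congr rfl fun idx h => ?_
  rw [Finset.mem_filter] at h
  rw [entryProd, entryProd, List.map_map]
  congr 1
  refine List.map_congr_left fun x _ => ?_
  have hx : D.glued τ x = D.next x := congrArg D.next x.2
  -- The next surviving edge has the same index as the immediate successor of `x`, since only cut
  -- edges are passed on the way.
  have key := eq_iterate_glued idx h.2 (D.glued τ x)
    (Nat.find (exists_return (D.glued τ) {x : X | τ x = x} x))
    fun m hm => Nat.find_min (exists_return (D.glued τ) {x : X | τ x = x} x) hm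
  rw [hx] at key
  rw [Function.comp_apply, key, ← hx]
  rfl

end Diagram

theorem finRange_add (m n : ℕ) : List.finRange (m + n) =
    (List.finRange m).map (Fin.castAdd n) ++ (List.finRange n).map (Fin.natAdd m) := by
  rw [← List.ofFn_id, ← List.ofFn_eq_map, ← List.ofFn_eq_map, ← List.ofFn_fin_append]
  congr 1
  funext i
  refine Fin.addCases (fun i => ?_) (fun i => ?_) i <;> simp

/-- The sums over index functions, with the factors in the order of increasing heights, are
multiplicative. -/
noncomputable def HDiagram.indexSumHom {V : Type u} [Quiver.{v} V] {A : Type*} [Semiring A]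
    (l : V → ℕ) (c : DEdge V → ℕ → ℕ → A) : HDiagram V →* A where
  toFun D := D.diag.indexSum l c (List.finRange D.size)
  map_one' := by
    have h1 : ∀ idx ∈ (1 : HDiagram V).diag.indices l,
        (1 : HDiagram V).diag.entryProd c idx (List.finRange (1 : HDiagram V).size) = 1 :=
      fun _ _ => rfl
    have h2 : ((1 : HDiagram V).diag.indices l).card = 1 := by
      refine Finset.card_eq_one.2 ⟨fun _ => 0, Finset.eq_singleton_iff_unique_mem.2
        ⟨(Diagram.mem_indices l).2 fun x => Fin.elim0 x, fun _ _ => funext fun x => Fin.elim0 x⟩⟩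
    rw [Diagram.indexSum, Finset.sum_congr rfl h1, Finset.sum_const, h2, one_smul]
    exact one_smul ℕ _
  map_mul' D E := by
    rw [← Diagram.indexSum_disjUnion, ← Diagram.indexSum_relabel l _ _ finSumFinEquiv,
      List.map_append, List.map_map, List.map_map]
    exact congrArg _ (finRange_add D.size E.size)

end

section

/-! ### The commutation relations of the generators of `D_Q` -/

section Generators

variable {V : Type u} [Quiver.{v} V] (l : V → ℕ) (k : Type w) [Field k]

/-- The generator of `D_Q` attached to a matrix coordinate. -/
noncomputable def gen (u : DCoord l) : DQ l k := coord l k u.1 u.2.1 u.2.2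

/-- The coordinate `(M_{a*})_{ji}` corresponding to `(M_a)_{ij}`. -/
def revCoord {l : V → ℕ} (u : DCoord l) : DCoord l := ⟨u.1.rev, u.2.2, u.2.1⟩

theorem revCoord_revCoord {l : V → ℕ} (u : DCoord l) : revCoord (revCoord u) = u := by
  obtain ⟨⟨a, b, e | e⟩, i, j⟩ := u <;> rfl

open Classical in
-- Canonical commutation relations. By the Leibniz rule the commutator of `M` with `-h ∂` is `h` for
-- the order `e, e*` and `-h` for the order `e*, e`; coordinates of the same kind commute.
theorem coordOp_mul_coordOp (u u' : DCoord l) :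
    coordOp l k u * coordOp l k u' = coordOp l k u' * coordOp l k u +
      (if u' = revCoord u then Polynomial.X * u.1.sign (Polynomial k) else 0) • 1 := by
  have hlin : ∀ (w w' : Coord l) (f : MvPolynomial (Coord l) (Polynomial k)),
      MvPolynomial.pderiv w (MvPolynomial.X w' * f) =
        MvPolynomial.X w' * MvPolynomial.pderiv w f + if w' = w then f else 0 := by
    intro w w' f
    rw [MvPolynomial.pderiv_mul, MvPolynomial.pderiv_X, Pi.single_apply, add_comm, ite_mul,
      one_mul, zero_mul]
  obtain ⟨⟨a, b, e | e⟩, i, j⟩ := u <;> obtain ⟨⟨a', b', e' | e'⟩, i', j'⟩ := u'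
  · rw [if_neg (fun h => by cases h), zero_smul, add_zero]
    refine LinearMap.ext fun f => ?_
    exact mul_left_comm _ _ _
  · have hw : ((⟨⟨a', b', Sum.inr e'⟩, i', j'⟩ : DCoord l) =
        revCoord ⟨⟨a, b, Sum.inl e⟩, i, j⟩) ↔
        (⟨⟨a, b, e⟩, i, j⟩ : Coord l) = ⟨⟨b', a', e'⟩, j', i'⟩ := by
      constructor
      · intro h; cases h; rfl
      · intro h; cases h; rfl
    have hs : DEdge.sign (Polynomial k) (⟨a, b, Sum.inl e⟩ : DEdge V) = 1 := if_pos rfl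
    refine LinearMap.ext fun f => ?_
    simp only [hw, hs, coordOp, Module.End.mul_apply, LinearMap.add_apply, LinearMap.smul_apply,
      LinearMap.mulLeft_apply, Derivation.coeFn_coe, hlin,
      MvPolynomial.smul_eq_C_mul, Module.End.one_apply]
    split_ifs with h
    · simp only [map_neg, mul_one]
      ring
    · simp only [map_neg, map_zero]
      ring
  · have hw : ((⟨⟨a', b', Sum.inl e'⟩, i', j'⟩ : DCoord l) =
        revCoord ⟨⟨a, b, Sum.inr e⟩, i, j⟩) ↔
        (⟨⟨a', b', e'⟩, i', j'⟩ : Coord l) = ⟨⟨b, a, e⟩, j, i⟩ := by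
      constructor
      · intro h; cases h; rfl
      · intro h; cases h; rfl
    have hs : DEdge.sign (Polynomial k) (⟨a, b, Sum.inr e⟩ : DEdge V) = -1 := if_neg (by
      simp [DEdge.IsForward])
    refine LinearMap.ext fun f => ?_
    simp only [hw, hs, coordOp, Module.End.mul_apply, LinearMap.add_apply, LinearMap.smul_apply,
      LinearMap.mulLeft_apply, Derivation.coeFn_coe, hlin,
      MvPolynomial.smul_eq_C_mul, Module.End.one_apply]
    split_ifs with h
    · simp only [map_neg, map_mul, map_one]
      ring
    · simp only [map_neg, map_zero]
      ring
  · rw [if_neg (fun h => by cases h), zero_smul, add_zero]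
    have hc : ∀ (w w' : Coord l) (f : MvPolynomial (Coord l) (Polynomial k)),
        MvPolynomial.pderiv w (MvPolynomial.pderiv w' f) =
          MvPolynomial.pderiv w' (MvPolynomial.pderiv w f) := by
      intro w w' f
      have : ⁅MvPolynomial.pderiv (R := Polynomial k) w,
          MvPolynomial.pderiv (R := Polynomial k) w'⁆ = 0 := by
        refine MvPolynomial.derivation_ext fun x => ?_
        rw [Derivation.commutator_apply, MvPolynomial.pderiv_X, MvPolynomial.pderiv_X,
          Pi.single_apply, Pi.single_apply]
        split_ifs <;> simp
      refine sub_eq_zero.1 ?_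
      rw [← Derivation.commutator_apply, this, Derivation.zero_apply]
    refine LinearMap.ext fun f => ?_
    simp only [coordOp, Module.End.mul_apply, LinearMap.smul_apply,
      Derivation.coeFn_coe, Derivation.map_smul]
    rw [hc]

open Classical in
theorem gen_mul_gen (u u' : DCoord l) :
    gen l k u * gen l k u' = gen l k u' * gen l k u +
      (if u' = revCoord u then Polynomial.X * u.1.sign (Polynomial k) else 0) • 1 :=
  Subtype.ext (coordOp_mul_coordOp l k u u')

/-- The matrix entry `ι(a)_{pq}`, for natural numbers `p` and `q`. -/
noncomputable def entryOp (a : DEdge V) (p q : ℕ) : DQ l k :=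
  if h : p < l a.left ∧ q < l a.right then coord l k a ⟨p, h.1⟩ ⟨q, h.2⟩ else 0

open Classical in
-- The bounds matter: entries outside the range are `0`, while the scalar term on the right need not
-- vanish there.
theorem entryOp_mul_entryOp (a b : DEdge V) (p q r s : ℕ) (hp : p < l a.left) (hq : q < l a.right)
    (hr : r < l b.left) (hs : s < l b.right) :
    entryOp l k a p q * entryOp l k b r s = entryOp l k b r s * entryOp l k a p q +
      (if b = a.rev ∧ r = q ∧ p = s then Polynomial.X * a.sign (Polynomial k) else 0) • 1 := by
  have := gen_mul_gen l k ⟨a, ⟨p, hp⟩, ⟨q, hq⟩⟩ ⟨b, ⟨r, hr⟩, ⟨s, hs⟩⟩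
  have hw : ((⟨b, ⟨r, hr⟩, ⟨s, hs⟩⟩ : DCoord l) = revCoord ⟨a, ⟨p, hp⟩, ⟨q, hq⟩⟩) ↔
      b = a.rev ∧ r = q ∧ p = s := by
    constructor
    · intro h
      cases h
      exact ⟨rfl, rfl, rfl⟩
    · rintro ⟨rfl, rfl, rfl⟩
      rfl
  rw [entryOp, dif_pos ⟨hp, hq⟩, entryOp, dif_pos ⟨hr, hs⟩]
  simp only [hw] at this
  exact this

end Generators

/-! ### Operators of collections with heights -/

section Rho

variable {V : Type u} [Quiver.{v} V] (l : V → ℕ) (k : Type w) [Field k]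

theorem Diagram.next_lt {X : Type*} [Fintype X] {D : Diagram V X} {idx : X → ℕ}
    (h : idx ∈ D.indices l) (x : X) : idx (D.next x) < l (D.edge x).right := by
  rw [D.comp]
  exact (Diagram.mem_indices l).1 h _

/-- Replaces indices in types `Fin (l v)`, which depend on the labels, by bounded natural numbers.
Index functions can then be compared after cutting or renaming without casts. -/
theorem rhoDiagram_eq (D : HDiagram V) :
    rhoDiagram l k D = D.diag.indexSum l (entryOp l k) (List.finRange D.size) := by
  unfold rhoDiagram Diagram.indexSum
  congr 1
  refine Finset.sum_bij' (fun i _ x => (i x : ℕ))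
    (fun idx h x => ⟨idx x, (Diagram.mem_indices l).1 h x⟩) ?_ ?_ ?_ ?_ ?_
  · intro i _
    rw [Diagram.mem_indices]
    exact fun x => (i x).2
  · intro idx _
    exact Finset.mem_univ _
  · intro i _
    rfl
  · intro idx _
    rfl
  · intro i hi
    rw [Diagram.entryProd, List.ofFn_eq_map]
    congr 1
    refine List.map_congr_left fun x _ => ?_
    rw [entryOp, dif_pos ⟨(i x).2, by rw [D.diag.comp]; exact (i _).2⟩]
    rfl

theorem finRange_split {N : ℕ} (i j : Fin N) (hij : (i : ℕ) + 1 = j) :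
    ∃ L₁ L₂ : List (Fin N), List.finRange N = L₁ ++ i :: j :: L₂ := by
  refine ⟨(List.finRange N).take i, (List.finRange N).drop (i + 1 + 1), ?_⟩
  have h1 : (i : ℕ) < (List.finRange N).length := by simp
  have h2 : (i : ℕ) + 1 < (List.finRange N).length := by simp [hij]
  have h3 := List.drop_eq_getElem_cons h1
  have h4 := List.drop_eq_getElem_cons h2
  conv_lhs => rw [← List.take_append_drop i (List.finRange N), h3, h4]
  simp [hij]

theorem rhoDiagram_relabel {N : ℕ} (D : Diagram V (Fin N)) (σ : Equiv.Perm (Fin N)) :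
    rhoDiagram l k ⟨N, D.relabel σ⟩ =
      D.indexSum l (entryOp l k) ((List.finRange N).map σ.symm) := by
  rw [rhoDiagram_eq, ← Diagram.indexSum_relabel l _ D σ, List.map_map]
  simp

theorem rhoDiagram_ofOrdered {X : Type*} [Fintype X] [LinearOrder X] (D : Diagram V X) :
    rhoDiagram l k (HDiagram.ofOrdered D) = D.indexSum l (entryOp l k)
      ((List.finRange (Fintype.card X)).map (monoEquivOfFin X rfl)) := by
  rw [rhoDiagram_eq, ← Diagram.indexSum_relabel l _ D (monoEquivOfFin X rfl).symm.toEquiv,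
    List.map_map]
  have : (⇑(monoEquivOfFin X rfl).symm.toEquiv ∘ ⇑(monoEquivOfFin X rfl)) = id := by
    funext x; simp
  rw [this, List.map_id]
  rfl

theorem map_swap_finRange {N : ℕ} (i j : Fin N) (L₁ L₂ : List (Fin N))
    (h : List.finRange N = L₁ ++ i :: j :: L₂) :
    (List.finRange N).map (Equiv.swap i j) = L₁ ++ j :: i :: L₂ ∧
      ∀ x, x ∈ L₁ ++ L₂ ↔ Equiv.swap i j x = x := by
  have hn := List.nodup_finRange N
  have hm : ∀ x, x ∈ L₁ ++ i :: j :: L₂ := fun x => h ▸ List.mem_finRange x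
  rw [h] at hn
  have hn' : (i :: j :: (L₁ ++ L₂)).Nodup := by
    refine (List.Perm.nodup_iff ?_).1 hn
    exact (List.perm_middle.trans (List.Perm.cons _ List.perm_middle))
  rw [List.nodup_cons, List.nodup_cons] at hn'
  have hi : i ∉ L₁ ++ L₂ := fun hi => hn'.1 (List.mem_cons_of_mem _ hi)
  have hj : j ∉ L₁ ++ L₂ := hn'.2.1
  have hij : i ≠ j := fun hij => hn'.1 (hij ▸ List.mem_cons_self)
  have hs : ∀ x ∈ L₁ ++ L₂, Equiv.swap i j x = x := fun x hx =>
    Equiv.swap_apply_of_ne_of_ne (fun h => hi (h ▸ hx)) (fun h => hj (h ▸ hx))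
  constructor
  · rw [h, List.map_append, List.map_cons, List.map_cons, Equiv.swap_apply_left,
      Equiv.swap_apply_right]
    congr 1
    · exact List.map_congr_left (fun x hx => hs x (List.mem_append_left _ hx)) |>.trans
        (List.map_id _)
    · congr 2
      exact List.map_congr_left (fun x hx => hs x (List.mem_append_right _ hx)) |>.trans
        (List.map_id _)
  · refine fun x => ⟨hs x, fun hx => ?_⟩
    have hxi : x ≠ i := fun h => by subst h; simp [hij.symm] at hx
    have hxj : x ≠ j := fun h => by subst h; simp [hij] at hx
    simpa [hxi, hxj] using hm x

/-- Both lists are strictly increasing and have the same members, so they coincide: deleting the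
pair keeps the order of the other factors. -/
theorem map_val_monoEquivOfFin {N : ℕ} (i j : Fin N) (L₁ L₂ : List (Fin N))
    (h : List.finRange N = L₁ ++ i :: j :: L₂) :
    ((List.finRange (Fintype.card {x // Equiv.swap i j x = x})).map
      (monoEquivOfFin {x // Equiv.swap i j x = x} rfl)).map Subtype.val = L₁ ++ L₂ := by
  have hp := List.pairwise_lt_finRange N
  have hsub : (L₁ ++ L₂).Sublist (List.finRange N) := by
    rw [h]
    exact (List.Sublist.refl _).append
      (((List.Sublist.refl L₂).cons j).cons i)
  have h1 : (((List.finRange (Fintype.card {x // Equiv.swap i j x = x})).map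
      (monoEquivOfFin {x // Equiv.swap i j x = x} rfl)).map Subtype.val).Pairwise (· < ·) := by
    rw [List.map_map, List.pairwise_map]
    refine (List.pairwise_lt_finRange _).imp fun {a b} hab => ?_
    exact (monoEquivOfFin {x // Equiv.swap i j x = x} rfl).lt_iff_lt.2 hab
  have h2 : (L₁ ++ L₂).Pairwise (· < ·) := hp.sublist hsub
  have hperm : (((List.finRange (Fintype.card {x // Equiv.swap i j x = x})).map
      (monoEquivOfFin {x // Equiv.swap i j x = x} rfl)).map Subtype.val).Perm (L₁ ++ L₂) := by
    rw [List.perm_ext_iff_of_nodup (h1.imp fun h => h.ne) (h2.imp fun h => h.ne)]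
    intro x
    rw [(map_swap_finRange i j L₁ L₂ h).2 x]
    simp only [List.mem_map, List.mem_finRange, true_and, exists_exists_eq_and]
    constructor
    · rintro ⟨a, rfl⟩
      exact ((monoEquivOfFin {x // Equiv.swap i j x = x} rfl) a).2
    · intro hx
      exact ⟨(monoEquivOfFin {x // Equiv.swap i j x = x} rfl).symm ⟨x, hx⟩, by simp⟩
  exact hperm.eq_of_pairwise' (r := (· < ·)) h1 h2

open Classical in
theorem entryProd_swap {X : Type*} [Fintype X] (D : Diagram V X) {idx : X → ℕ}
    (hidx : idx ∈ D.indices l) (i j : X) (L₁ L₂ : List X) :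
    D.entryProd (entryOp l k) idx (L₁ ++ i :: j :: L₂) =
      D.entryProd (entryOp l k) idx (L₁ ++ j :: i :: L₂) +
      (if D.edge j = (D.edge i).rev ∧ idx j = idx (D.next i) ∧ idx i = idx (D.next j) then
        Polynomial.X * (D.edge i).sign (Polynomial k) else 0) •
        D.entryProd (entryOp l k) idx (L₁ ++ L₂) := by
  have h := (Diagram.mem_indices l).1 hidx
  have hc := entryOp_mul_entryOp l k (D.edge i) (D.edge j) (idx i) (idx (D.next i)) (idx j)
    (idx (D.next j)) (h i) (Diagram.next_lt l hidx i) (h j) (Diagram.next_lt l hidx j)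
  simp only [Diagram.entryProd, List.map_append, List.map_cons, List.prod_append, List.prod_cons]
  rw [← mul_assoc (entryOp l k _ _ _), hc, add_mul, mul_add, mul_assoc (entryOp l k _ _ _),
    smul_mul_assoc, one_mul, mul_smul_comm]

theorem rhoDiagram_commute {N : ℕ} (D : Diagram V (Fin N)) (i j : Fin N) (hij : (i : ℕ) + 1 = j)
    (h : D.edge j ≠ (D.edge i).rev) :
    rhoDiagram l k ⟨N, D⟩ = rhoDiagram l k ⟨N, D.relabel (Equiv.swap i j)⟩ := by
  classical
  obtain ⟨L₁, L₂, hL⟩ := finRange_split i j hij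
  rw [rhoDiagram_relabel, rhoDiagram_eq, Equiv.symm_swap, (map_swap_finRange i j L₁ L₂ hL).1]
  dsimp only
  rw [hL, Diagram.indexSum, Diagram.indexSum]
  congr 1
  refine Finset.sum_congr rfl fun idx hidx => ?_
  rw [entryProd_swap l k D hidx, if_neg fun h' => h h'.1, zero_smul, add_zero]

/-- For each index function the commutator of the two neighbouring factors is `h` times the sign
times Kronecker deltas. The deltas select the index functions over which `indexSum_cut` sums. -/
theorem rhoDiagram_glue {N : ℕ} (D : Diagram V (Fin N)) (i j : Fin N) (hij : (i : ℕ) + 1 = j)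
    (h : D.edge j = (D.edge i).rev) :
    rhoDiagram l k ⟨N, D⟩ = rhoDiagram l k ⟨N, D.relabel (Equiv.swap i j)⟩ +
      (Polynomial.X * (D.edge i).sign (Polynomial k)) •
        rhoDiagram l k (HDiagram.ofOrdered (D.cut _ (D.isGluing_swap i j h))) := by
  classical
  obtain ⟨L₁, L₂, hL⟩ := finRange_split i j hij
  have hne : i ≠ j := fun h => by rw [h] at hij; omega
  rw [rhoDiagram_relabel, rhoDiagram_eq, rhoDiagram_ofOrdered, Diagram.indexSum_cut,
    map_val_monoEquivOfFin i j L₁ L₂ hL, Equiv.symm_swap, (map_swap_finRange i j L₁ L₂ hL).1]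
  dsimp only
  rw [hL, Diagram.indexSum, Diagram.indexSum, smul_comm (Polynomial.X * _), ← smul_add,
    Finset.sum_filter, Finset.smul_sum (r := Polynomial.X * (D.edge i).sign (Polynomial k)),
    ← Finset.sum_add_distrib]
  congr 1
  refine Finset.sum_congr rfl fun idx hidx => ?_
  rw [entryProd_swap l k D hidx]
  congr 1
  -- The glued successor of `i` is the successor of `j` and conversely, so the constraints of the
  -- gluing are the two deltas.
  have hiff : (D.edge j = (D.edge i).rev ∧ idx j = idx (D.next i) ∧ idx i = idx (D.next j)) ↔
      ∀ x, Equiv.swap i j x ≠ x → idx x = idx (D.glued (Equiv.swap i j) x) := by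
    constructor
    · rintro ⟨-, h1, h2⟩ x hx
      by_cases hxi : x = i
      · subst hxi
        simpa using h2
      · by_cases hxj : x = j
        · subst hxj
          simpa using h1
        · exact absurd (Equiv.swap_apply_of_ne_of_ne hxi hxj) hx
    · intro hx
      refine ⟨h, ?_, ?_⟩
      · simpa using hx j (by simpa using hne)
      · simpa using hx i (by simpa using hne.symm)
  simp only [hiff]
  split_ifs <;> simp

/-- The representation `ρ_l^h` of `A_h(Q)` by differential operators. -/
noncomputable def rho : Ah k V →ₐ[Polynomial k] DQ l k :=
  RingQuot.liftAlgHom (Polynomial k) ⟨MonoidAlgebra.lift (Polynomial k) (DQ l k) (HDiagram V)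
    (HDiagram.indexSumHom l (entryOp l k)),
    fun x y h => by
      cases h with
      | commute D i j hij h =>
        simp only [HDiagram.toAlg, MonoidAlgebra.lift_of]
        exact (rhoDiagram_eq l k _).symm.trans ((rhoDiagram_commute l k D i j hij h).trans
          (rhoDiagram_eq l k _))
      | glue D i j hij h =>
        simp only [HDiagram.toAlg, MonoidAlgebra.lift_of, map_add, map_smul]
        have := rhoDiagram_glue l k D i j hij h
        rwa [rhoDiagram_eq, rhoDiagram_eq, rhoDiagram_eq] at this⟩

theorem rho_toAh (D : HDiagram V) : rho l k (D.toAh k) = rhoDiagram l k D := by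
  rw [rho, HDiagram.toAh, RingQuot.liftAlgHom_mkAlgHom_apply, HDiagram.toAlg,
    MonoidAlgebra.lift_of, rhoDiagram_eq]
  rfl

end Rho

end

section

/-! ### Traces as sums over index functions -/

section Chain

variable {A : Type*} [CommSemiring A] (b : ℕ → ℕ) (m : ℕ → ℕ → ℕ → A)

/-- The entries of the product of the first `n` of a sequence of matrices `m 0, m 1, …`, where the
rows of `m r` are indexed by the natural numbers below `b r`. -/
def chain : ℕ → ℕ → ℕ → A
  | 0, i, j => if i = j then 1 else 0
  | n + 1, i, j => ∑ q ∈ Finset.range (b n), chain n i q * m n q j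

/-- A matrix product expanded over all intermediate indices. The arbitrary function `g` of the two
end indices serves the induction: the last matrix is absorbed into it. -/
theorem sum_chain (n : ℕ) (g : ℕ → ℕ → A) :
    ∑ idx ∈ Fintype.piFinset (fun r : Fin (n + 1) => Finset.range (b r)),
      (∏ r : Fin n, m r (idx r.castSucc) (idx r.succ)) * g (idx 0) (idx (Fin.last n)) =
    ∑ i ∈ Finset.range (b 0), ∑ q ∈ Finset.range (b n), chain b m n i q * g i q := by
  induction n generalizing g with
  | zero =>
    have h : ∀ i ∈ Finset.range (b 0), ∑ q ∈ Finset.range (b 0), chain b m 0 i q * g i q = g i i := by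
      intro i hi
      rw [Finset.sum_eq_single_of_mem i hi]
      · simp [chain]
      · intro q _ hq
        simp [chain, hq.symm]
    rw [Finset.sum_congr rfl h]
    refine Finset.sum_nbij' (fun idx => idx 0) (fun i _ => i) ?_ ?_ ?_ ?_ ?_
    · intro idx h
      exact Fintype.mem_piFinset.1 h 0
    · intro i hi
      refine Fintype.mem_piFinset.2 fun r => ?_
      rw [Fin.fin_one_eq_zero r]
      exact hi
    · intro idx _
      funext r
      rw [Fin.fin_one_eq_zero r]
    · intro i _
      rfl
    · intro idx _
      simp
  | succ n ih =>
    have h : ∀ i, ∑ q ∈ Finset.range (b (n + 1)), chain b m (n + 1) i q * g i q =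
        ∑ p ∈ Finset.range (b n), chain b m n i p *
          ∑ q ∈ Finset.range (b (n + 1)), m n p q * g i q := by
      intro i
      simp only [chain, Finset.sum_mul, Finset.mul_sum]
      rw [Finset.sum_comm]
      simp only [mul_assoc]
    rw [Finset.sum_congr rfl fun i _ => h i,
      ← ih fun i p => ∑ q ∈ Finset.range (b (n + 1)), m n p q * g i q]
    simp only [Finset.mul_sum]
    rw [← Finset.sum_product']
    refine Finset.sum_nbij' (fun idx => (Fin.init idx, idx (Fin.last (n + 1))))
      (fun p => (Fin.snoc p.1 p.2 : Fin (n + 2) → ℕ)) ?_ ?_ ?_ ?_ ?_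
    · intro idx h
      rw [Fintype.mem_piFinset] at h
      rw [Finset.mem_product, Fintype.mem_piFinset]
      exact ⟨fun r => h r.castSucc, h (Fin.last (n + 1))⟩
    · rintro ⟨p, q⟩ h
      rw [Finset.mem_product, Fintype.mem_piFinset] at h
      rw [Fintype.mem_piFinset]
      intro r
      refine Fin.lastCases ?_ (fun r => ?_) r
      · simpa using h.2
      · simpa using h.1 r
    · intro idx _
      exact Fin.snoc_init_self idx
    · rintro ⟨p, q⟩ _
      simp
    · intro idx _
      rw [Fin.prod_univ_castSucc, mul_assoc]
      rfl

end Chain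

section Trace

variable {V : Type u} [Quiver.{v} V] (l : V → ℕ)

/-- The matrix entry `(M_a)_{pq}`, for natural numbers `p` and `q`. -/
noncomputable def entryVar (R : Type w) [CommSemiring R] (a : DEdge V) (p q : ℕ) :
    MvPolynomial (DCoord l) R :=
  if h : p < l a.left ∧ q < l a.right then MvPolynomial.X ⟨a, ⟨p, h.1⟩, ⟨q, h.2⟩⟩ else 0

/-- Indexing by natural numbers keeps the matrix sizes, which vary along the path, out of the types;
this lemma returns to honest matrices. -/
theorem chain_eq_pathMatrix (R : Type w) [CommSemiring R] (b : ℕ → ℕ)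
    (m : ℕ → ℕ → ℕ → MvPolynomial (DCoord l) R) {x y : Quiver.Symmetrify V} (p : Quiver.Path x y)
    (hb : ∀ (r : ℕ) (h : r < (HDiagram.arrows p).length), b r = l ((HDiagram.arrows p)[r]).left)
    (hm : ∀ (r : ℕ) (h : r < (HDiagram.arrows p).length),
      m r = entryVar l R ((HDiagram.arrows p)[r])) (i : Fin (l x)) (j : Fin (l y)) :
    chain b m (HDiagram.arrows p).length i j = pathMatrix l R p i j := by
  induction p with
  | nil =>
    simp only [HDiagram.arrows, List.length_nil, chain, pathMatrix, Matrix.one_apply, Fin.ext_iff]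
  | @cons y z p e ih =>
    have hlen : (HDiagram.arrows (p.cons e)).length = (HDiagram.arrows p).length + 1 := by
      simp [HDiagram.arrows]
    have hlast : (HDiagram.arrows (p.cons e))[(HDiagram.arrows p).length]'(by omega) =
        ⟨y, z, e⟩ := by
      simp [HDiagram.arrows]
    have hpre : ∀ (r : ℕ) (h : r < (HDiagram.arrows p).length),
        (HDiagram.arrows (p.cons e))[r]'(by omega) = (HDiagram.arrows p)[r] := by
      intro r h
      simp only [HDiagram.arrows]
      rw [List.getElem_append_left h]
    have ih' := ih (fun r h => by rw [hb r (by omega), hpre r h])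
      (fun r h => by rw [hm r (by omega), hpre r h])
    rw [hlen, chain, hb _ (by omega), hm _ (by omega), hlast, Finset.sum_range, pathMatrix,
      Matrix.mul_apply]
    refine Finset.sum_congr rfl fun q _ => ?_
    rw [ih' q, entryVar, dif_pos ⟨q.2, j.2⟩]
    rfl

theorem HDiagram.indexSum_cycle {A : Type*} [CommSemiring A] (c : DEdge V → ℕ → ℕ → A)
    (E : HDiagram V) (n : ℕ) (hn : E.size = n + 1) (hnext : E.diag.next = finRotate _)
    (b : ℕ → ℕ) (m : ℕ → ℕ → ℕ → A) (hb : ∀ x : Fin E.size, b x = l (E.diag.edge x).left)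
    (hm : ∀ x : Fin E.size, m x = c (E.diag.edge x)) :
    HDiagram.indexSumHom l c E =
      Diagram.vertexProd l E.diag.verts • ∑ i ∈ Finset.range (b 0), chain b m E.size i i := by
  obtain ⟨N, D⟩ := E
  dsimp only at hn hnext hb hm ⊢
  subst hn
  change Diagram.vertexProd l D.verts • ∑ idx ∈ D.indices l, D.entryProd c idx _ = _
  congr 1
  simp only [chain]
  -- The last matrix plays the role of `g`: it leads from the last index back to the first one and
  -- closes the trace.
  rw [← sum_chain b m n fun i q => m n q i]
  have hi : D.indices l = Fintype.piFinset (fun r : Fin (n + 1) => Finset.range (b r)) := by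
    simp only [hb]
    unfold Diagram.indices
    congr!
  rw [hi]
  refine Finset.sum_congr rfl fun idx _ => ?_
  rw [Diagram.entryProd, ← List.ofFn_eq_map, List.prod_ofFn, Fin.prod_univ_castSucc, hnext,
    finRotate_last, ← hm (Fin.last n)]
  congr 1
  refine Finset.prod_congr rfl fun r _ => ?_
  rw [finRotate_apply, Fin.coeSucc_eq_succ, ← hm]
  rfl

theorem indexSumHom_ofClosedPath (R : Type w) [CommSemiring R] (x : ClosedPath V) :
    HDiagram.indexSumHom l (entryVar l R) (HDiagram.ofClosedPath x) =
      (pathMatrix l R x.2).trace := by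
  classical
  obtain ⟨x, p⟩ := x
  by_cases hp : HDiagram.arrows p = []
  -- A trivial path has no edges and a single empty index function; the factor `l x` of its vertex
  -- is the trace of the identity matrix.
  · have hxp : (⟨x, p⟩ : ClosedPath V) = ⟨x, Quiver.Path.nil⟩ := by
      cases p with
      | nil => rfl
      | cons p e => simp [HDiagram.arrows] at hp
    rw [hxp]
    have hv : (HDiagram.ofClosedPath (⟨x, Quiver.Path.nil⟩ : ClosedPath V)).diag.verts = {x} :=
      (if_pos rfl : (if HDiagram.arrows (Quiver.Path.nil : Quiver.Path x x) = [] then {x} else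
        (0 : Multiset (Quiver.Symmetrify V))) = {x})
    have h1 : (HDiagram.ofClosedPath (⟨x, Quiver.Path.nil⟩ : ClosedPath V)).diag.indices l =
        {fun _ => 0} := Finset.eq_singleton_iff_unique_mem.2
      ⟨(Diagram.mem_indices l).2 fun x => Fin.elim0 x, fun _ _ => funext fun x => Fin.elim0 x⟩
    change Diagram.indexSum l _ _ _ = _
    rw [Diagram.indexSum, hv, h1, Finset.sum_singleton, Diagram.vertexProd_singleton, pathMatrix,
      Matrix.trace_one, Fintype.card_fin]
    exact nsmul_one _
  · obtain ⟨n, hn⟩ := Nat.exists_eq_succ_of_ne_zero (fun h => hp (List.length_eq_zero_iff.1 h))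
    let b : ℕ → ℕ := fun r => if h : r < (HDiagram.arrows p).length then
      l ((HDiagram.arrows p)[r]).left else 0
    let m : ℕ → ℕ → ℕ → MvPolynomial (DCoord l) R :=
      fun r => if h : r < (HDiagram.arrows p).length then entryVar l R ((HDiagram.arrows p)[r])
        else 0
    have hb : ∀ (r : ℕ) (h : r < (HDiagram.arrows p).length),
        b r = l ((HDiagram.arrows p)[r]).left := fun r h => dif_pos h
    have hm : ∀ (r : ℕ) (h : r < (HDiagram.arrows p).length),
        m r = entryVar l R ((HDiagram.arrows p)[r]) := fun r h => dif_pos h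
    rw [HDiagram.indexSum_cycle l (entryVar l R) (HDiagram.ofClosedPath ⟨x, p⟩) n hn rfl b m
      (fun r => hb r r.2) (fun r => hm r r.2)]
    have hv : (HDiagram.ofClosedPath (⟨x, p⟩ : ClosedPath V)).diag.verts = 0 := if_neg hp
    have h0 : b 0 = l x := by
      rw [hb 0 (by omega)]
      exact congrArg l ((HDiagram.arrows_spec p).2.1 (by omega))
    rw [hv, Diagram.vertexProd_zero, one_smul, h0, Finset.sum_range, Matrix.trace]
    exact Finset.sum_congr rfl fun i _ => chain_eq_pathMatrix l R b m p hb hm i i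

theorem Diagram.indexSum_perm {A : Type*} [CommSemiring A] (c : DEdge V → ℕ → ℕ → A)
    {X : Type*} [Fintype X] (D : Diagram V X) {L L' : List X} (h : L.Perm L') :
    D.indexSum l c L = D.indexSum l c L' := by
  unfold Diagram.indexSum Diagram.entryProd
  congr 1
  exact Finset.sum_congr rfl fun idx _ => (h.map _).prod_eq

theorem map_list_prod_eq {ι M N : Type*} [Monoid M] [Monoid N] (F G : M →* N) (f : ι → M)
    (h : ∀ i, F (f i) = G (f i)) (L : List ι) : F (L.map f).prod = G (L.map f).prod := by
  rw [map_list_prod, map_list_prod, List.map_map, List.map_map]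
  congr 1
  exact List.map_congr_left fun i _ => h i

theorem traceMap_ofMonomial (R : Type w) [CommSemiring R] (e : Necklace V →₀ ℕ) :
    traceMap l R ((HDiagram.ofMonomial e).diag.sym R) =
      HDiagram.indexSumHom l (entryVar l R) (HDiagram.ofMonomial e) := by
  refine map_list_prod_eq ((traceMap l R).toRingHom.toMonoidHom.comp (symHom R)) _
    (fun n => HDiagram.ofClosedPath (Quot.out n)) (fun n => ?_) _
  rw [indexSumHom_ofClosedPath]
  change traceMap l R (Diagram.sym R _) = _
  rw [Diagram.sym, necklaces_ofClosedPath, Multiset.map_singleton, Multiset.prod_singleton,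
    traceMap, MvPolynomial.aeval_X]
  rfl

/-- In a commutative ring the order of the factors is irrelevant, so the index sum depends only on
the isomorphism class and may be computed on the representative, a product of closed paths. -/
theorem traceMap_sym (R : Type w) [CommSemiring R] (D : HDiagram V) :
    traceMap l R (D.diag.sym R) = HDiagram.indexSumHom l (entryVar l R) D := by
  have hiso := D.diag.iso_ofMonomial
  rw [Diagram.sym_eq_monomial, ← HDiagram.sym_ofMonomial, traceMap_ofMonomial]
  obtain ⟨e, he⟩ := hiso
  change Diagram.indexSum l _ _ _ = Diagram.indexSum l _ _ _
  rw [← he, Diagram.indexSum_perm l _ _ (L' := (List.finRange D.size).map e),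
    Diagram.indexSum_relabel]
  rw [List.perm_ext_iff_of_nodup (List.nodup_finRange _)
    ((List.nodup_finRange _).map e.injective)]
  intro x
  simp only [List.mem_finRange, List.mem_map, true_and, true_iff]
  exact ⟨e.symm x, e.apply_symm_apply x⟩

end Trace

end

section

/-! ### The Weyl symmetrization map -/

section Weyl

variable {V : Type u} [Quiver.{v} V] (l : V → ℕ) (k : Type w) [Field k]

/-- The image under `φ_W` of a monomial. -/
noncomputable def weyl (m : DCoord l →₀ ℕ) : DQ l k := phiW l k (MvPolynomial.monomial m 1)

theorem phiW_monomial (m : DCoord l →₀ ℕ) (a : Polynomial k) :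
    phiW l k (MvPolynomial.monomial m a) = a • weyl l k m := by
  rw [weyl, ← map_smul, MvPolynomial.smul_monomial, smul_eq_mul, mul_one]

/-- The sum over all orderings of the factors of a product of generators. -/
noncomputable def sumOrders {n : ℕ} (c : Fin n → DCoord l) : DQ l k :=
  ∑ σ : Equiv.Perm (Fin n), (List.ofFn fun r => gen l k (c (σ r))).prod

theorem sumOrders_comp {n : ℕ} (c : Fin n → DCoord l) (e : Equiv.Perm (Fin n)) :
    sumOrders l k (fun i => c (e i)) = sumOrders l k c :=
  Fintype.sum_equiv (Equiv.mulLeft e) _ _ fun _ => rfl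

/-- Removes the arbitrary enumeration in the definition of `phiW`: a sum over all orderings does not
depend on the initial one. -/
theorem weyl_sum_single {n : ℕ} (c : Fin n → DCoord l) :
    weyl l k (∑ i, Finsupp.single (c i) 1) = Polynomial.C ((n ! : k)⁻¹) • sumOrders l k c := by
  classical
  have key : ∀ (L : List (DCoord l)), (L : Multiset (DCoord l)) = Finset.univ.val.map c →
      Polynomial.C ((L.length ! : k)⁻¹) • sumOrders l k L.get =
        Polynomial.C ((n ! : k)⁻¹) • sumOrders l k c := by
    intro L hL
    have hn : L.length = n := by
      have := congrArg Multiset.card hL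
      simpa using this
    subst hn
    have h2 : Finset.univ.val.map L.get = Finset.univ.val.map c := by
      rw [← hL, ← List.ofFn_get L]
      simp
    obtain ⟨e, he⟩ := Diagram.exists_equiv_of_map_univ_eq L.get c h2
    rw [← sumOrders_comp l k c e, ← funext he]
  have hb : MvPolynomial.monomial (∑ i, Finsupp.single (c i) 1) (1 : Polynomial k) =
      MvPolynomial.basisMonomials (DCoord l) (Polynomial k) (∑ i, Finsupp.single (c i) 1) := by
    rw [MvPolynomial.coe_basisMonomials]
  rw [weyl, hb, phiW, Module.Basis.constr_basis]
  refine key _ ?_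
  rw [Multiset.coe_toList, map_sum]
  simp only [Finsupp.toMultiset_single, one_smul]
  rw [← Multiset.sum_map_singleton (Finset.univ.val.map c), Multiset.map_map]
  rfl

theorem weyl_zero : weyl l k 0 = 1 := by
  have := weyl_sum_single l k (n := 0) finZeroElim
  rw [Finset.univ_eq_empty, Finset.sum_empty] at this
  rw [this, sumOrders]
  simp

theorem sumOrders_succ {n : ℕ} (c : Fin (n + 1) → DCoord l) :
    sumOrders l k c =
      ∑ p, gen l k (c p) * sumOrders l k (fun i : Fin n => c (Equiv.swap 0 p i.succ)) := by
  rw [sumOrders, ← Equiv.sum_comp Equiv.Perm.decomposeFin.symm, Fintype.sum_prod_type]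
  refine Finset.sum_congr rfl fun p _ => ?_
  rw [sumOrders, Finset.mul_sum]
  refine Finset.sum_congr rfl fun e _ => ?_
  rw [List.ofFn_succ, List.prod_cons]
  simp only [Equiv.Perm.decomposeFin_symm_apply_zero, Equiv.Perm.decomposeFin_symm_apply_succ]

theorem exists_sum_single {ι : Type*} (m : ι →₀ ℕ) :
    ∃ c : Fin m.degree → ι, m = ∑ i, Finsupp.single (c i) 1 := by
  classical
  have h : ∀ (n : ℕ) (m : ι →₀ ℕ), m.degree = n → ∃ c : Fin n → ι,
      m = ∑ i, Finsupp.single (c i) 1 := by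
    intro n
    induction n with
    | zero =>
      intro m hm
      exact ⟨finZeroElim, by simpa using (Finsupp.degree_eq_zero_iff m).1 hm⟩
    | succ n ih =>
      intro m hm
      have hne : m ≠ 0 := fun h => by simp [h] at hm
      obtain ⟨v, hv⟩ := Finsupp.ne_iff.1 hne
      have hle : Finsupp.single v 1 ≤ m := by
        rw [Finsupp.single_le_iff]
        exact Nat.one_le_iff_ne_zero.2 hv
      have hsub := tsub_add_cancel_of_le hle
      have hdeg : (m - Finsupp.single v 1).degree = n := by
        have := congrArg Finsupp.degree hsub
        rw [map_add, Finsupp.degree_single, hm] at this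
        omega
      obtain ⟨c, hc⟩ := ih _ hdeg
      refine ⟨Fin.cons v c, ?_⟩
      rw [Fin.sum_univ_succ, ← hsub, hc]
      simp [add_comm]
  exact h _ m rfl

/-- Orderings are sorted by their first factor, and equal coordinates are collected with
multiplicity `m u`. It is a noncommutative form of Euler's identity for homogeneous polynomials. The
set `S` may exceed the support, so that one set serves several monomials. -/
theorem weyl_euler [CharZero k] (S : Finset (DCoord l)) (m : DCoord l →₀ ℕ) (hS : m.support ⊆ S) :
    (m.degree : Polynomial k) • weyl l k m =
      ∑ u ∈ S, (m u : Polynomial k) • (gen l k u * weyl l k (m - Finsupp.single u 1)) := by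
  classical
  obtain ⟨c, hc⟩ := exists_sum_single m
  generalize m.degree = n at c hc ⊢
  subst hc
  rcases n with _ | n
  · simp
  · have hp : ∀ p : Fin (n + 1), ∑ i, Finsupp.single (c i) 1 - Finsupp.single (c p) 1 =
        ∑ i : Fin n, Finsupp.single (c (Equiv.swap 0 p i.succ)) 1 := by
      intro p
      rw [← Equiv.sum_comp (Equiv.swap 0 p), Fin.sum_univ_succ, Equiv.swap_apply_left,
        add_tsub_cancel_left]
    have h1 : ((n + 1 : ℕ) : Polynomial k) • weyl l k (∑ i, Finsupp.single (c i) 1) =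
        ∑ p, gen l k (c p) * weyl l k (∑ i, Finsupp.single (c i) 1 - Finsupp.single (c p) 1) := by
      have hf : ((n + 1 : ℕ) : k) * (((n + 1) ! : ℕ) : k)⁻¹ = ((n ! : ℕ) : k)⁻¹ := by
        have h1 : ((n + 1 : ℕ) : k) ≠ 0 := by exact_mod_cast n.succ_ne_zero
        have h2 : ((n ! : ℕ) : k) ≠ 0 := by exact_mod_cast n.factorial_ne_zero
        rw [Nat.factorial_succ, Nat.cast_mul]
        field_simp
      rw [weyl_sum_single, sumOrders_succ, smul_smul, ← Polynomial.C_eq_natCast,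
        ← Polynomial.C_mul, hf, Finset.smul_sum]
      refine Finset.sum_congr rfl fun p _ => ?_
      rw [hp, weyl_sum_single, mul_smul_comm]
    rw [h1]
    have h2 : ∀ u, (∑ i, Finsupp.single (c i) 1 : DCoord l →₀ ℕ) u =
        (Finset.univ.filter fun i => c i = u).card := by
      intro u
      rw [Finsupp.finsetSum_apply, Finset.card_filter]
      simp [Finsupp.single_apply]
    have h3 : ∀ i ∈ Finset.univ, c i ∈ S := by
      intro i _
      refine hS (Finsupp.mem_support_iff.2 ?_)
      rw [h2]
      exact Finset.card_ne_zero_of_mem (Finset.mem_filter.2 ⟨Finset.mem_univ i, rfl⟩)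
    rw [← Finset.sum_fiberwise_of_maps_to h3]
    refine Finset.sum_congr rfl fun u _ => ?_
    rw [h2 u, Nat.cast_smul_eq_nsmul, ← Finset.sum_const]
    refine Finset.sum_congr rfl fun i hi => ?_
    rw [(Finset.mem_filter.1 hi).2]

end Weyl

end

section

/-! ### Symmetrized products of elements whose commutators are scalars -/

section Symmetrized

/-- Linear algebra for the end of `IsSymmetrized.add_single`. There `x` is the generator times the
symmetrized product, `w` the symmetrized product with the new factor, and `y` the commutator term.
Everything is additive, as no subtraction is available. -/
theorem smul_add_half_smul {R M : Type*} [CommSemiring R] [AddCommMonoid M] [Module R M] (n : ℕ)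
    (c : R) (hc : c * 2 = 1) (s w x y : M) (hw : ((n + 1 + 1 : ℕ) : R) • w = s + x)
    (hx : ((n + 1 : ℕ) : R) • x = s + c • (n : R) • y + y) :
    ((n + 1 + 1 : ℕ) : R) • (w + c • y) = ((n + 1 + 1 : ℕ) : R) • x := by
  have h2 : ((n + 1 + 1 : ℕ) : R) • x = ((n + 1 : ℕ) : R) • x + x := by
    rw [Nat.cast_succ (n + 1), add_smul, one_smul]
  have h3 : ((n + 1 + 1 : ℕ) : R) • c • y = c • (n : R) • y + y := by
    have h4 : ((n + 1 + 1 : ℕ) : R) * c = c * n + c * 2 := by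
      push_cast
      ring
    rw [smul_smul, h4, add_smul, hc, one_smul, mul_smul]
  rw [h2, hx, smul_add, hw, h3, add_right_comm, add_assoc s, add_assoc s, add_assoc s]

variable {R A ι : Type*} [CommSemiring R] [Semiring A] [Algebra R A]

/-- Elements `g i` of an algebra, whose commutators are scalars, and elements `P m` indexed by
monomials which satisfy the recursion that characterizes the symmetrized products of the `g i`. -/
structure IsSymmetrized (g : ι → A) (rv : ι → ι) (hs : ι → R) (P : (ι →₀ ℕ) → A) : Prop where
  comm : ∀ u, g u * g (rv u) = g (rv u) * g u + hs u • 1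
  comm_of_ne : ∀ u u', u' ≠ rv u → g u * g u' = g u' * g u
  zero : P 0 = 1
  euler : ∀ (S : Finset ι) (m : ι →₀ ℕ), m.support ⊆ S →
    (m.degree : R) • P m = ∑ u ∈ S, (m u : R) • (g u * P (m - Finsupp.single u 1))
  cancel : ∀ n : ℕ, n ≠ 0 → ∀ x y : A, (n : R) • x = (n : R) • y → x = y

variable {g : ι → A} {rv : ι → ι} {hs : ι → R} {P : (ι →₀ ℕ) → A}

theorem degree_sub_single {ι : Type*} (m : ι →₀ ℕ) (u : ι) (hu : m u ≠ 0) :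
    (m - Finsupp.single u 1).degree + 1 = m.degree := by
  have hle : Finsupp.single u 1 ≤ m := by
    rw [Finsupp.single_le_iff]
    exact Nat.one_le_iff_ne_zero.2 hu
  have := congrArg Finsupp.degree (tsub_add_cancel_of_le hle)
  rwa [map_add, Finsupp.degree_single] at this

/-- Symmetry of the second partial derivatives of a monomial, for the coefficients. -/
theorem sub_single_mul_comm {ι : Type*} (m : ι →₀ ℕ) (u u' : ι) :
    m u * (m - Finsupp.single u 1 : ι →₀ ℕ) u' = m u' * (m - Finsupp.single u' 1 : ι →₀ ℕ) u := by
  classical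
  by_cases h : u = u'
  · rw [h]
  · simp [h, Ne.symm h, mul_comm]

/-- Interchanging the two derivatives turns the sum into the Euler recursion of `m - Finsupp.single
u' 1`, whose degree is one less. -/
theorem IsSymmetrized.double_sum (hP : IsSymmetrized g rv hs P) (S : Finset (ι)) (m : ι →₀ ℕ)
    (hS : m.support ⊆ S) (u' : ι) :
    ∑ u ∈ S, (m u : R) • (g u * (((m - Finsupp.single u 1 : ι →₀ ℕ) u' : ℕ) :
      R) • P (m - Finsupp.single u 1 - Finsupp.single u' 1)) =
    ((m.degree - 1 : ℕ) : R) • (m u' : R) •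
      P (m - Finsupp.single u' 1) := by
  have h1 : ∀ u ∈ S, (m u : R) • (g u * (((m - Finsupp.single u 1 : ι →₀ ℕ) u' : ℕ) :
      R) • P (m - Finsupp.single u 1 - Finsupp.single u' 1)) =
      (m u' : R) • (((m - Finsupp.single u' 1 : ι →₀ ℕ) u : ℕ) : R) •
        (g u * P (m - Finsupp.single u' 1 - Finsupp.single u 1)) := by
    intro u _
    rw [mul_smul_comm, smul_smul, smul_smul, ← Nat.cast_mul, ← Nat.cast_mul,
      sub_single_mul_comm m u u', tsub_right_comm]
  rw [Finset.sum_congr rfl h1, ← Finset.smul_sum, ← hP.euler, smul_comm]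
  · by_cases hu : m u' = 0
    · simp [hu]
    · rw [← degree_sub_single m u' hu, Nat.add_sub_cancel]
  · exact (Finsupp.support_mono tsub_le_self).trans hS

open Classical in
theorem IsSymmetrized.sum_commutator (hP : IsSymmetrized g rv hs P) (S : Finset (ι)) (m : ι →₀ ℕ) (u : ι)
    (hu : rv u ∈ S) (T : ι → A) :
    ∑ u' ∈ S, (m u' : R) • (g u * (g u' * T u')) =
      ∑ u' ∈ S, (m u' : R) • (g u' * (g u * T u')) +
        hs u • (m (rv u) : R) • T (rv u) := by
  have h : ∀ u' ∈ S, (m u' : R) • (g u * (g u' * T u')) =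
      (m u' : R) • (g u' * (g u * T u')) +
        if u' = rv u then hs u • (m (rv u) : R) • T (rv u)
          else 0 := by
    intro u' _
    split_ifs with h
    · rw [h, ← mul_assoc, hP.comm, add_mul, smul_add, mul_assoc, smul_one_mul, smul_comm (hs u)]
    · rw [← mul_assoc, hP.comm_of_ne u u' h, add_zero, mul_assoc]
  rw [Finset.sum_congr rfl h, Finset.sum_add_distrib, Finset.sum_ite_eq' S, if_pos hu]

/-- Induction on the degree through the Euler recursion. The commutator term arises once from
passing the first factor and `n` times from the induction hypothesis, via `double_sum`; the total `n
+ 1` is cancelled. -/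
theorem IsSymmetrized.commutator (hP : IsSymmetrized g rv hs P) (u : ι) (m : ι →₀ ℕ) :
    g u * P m = P m * g u +
      hs u • (m (rv u) : R) •
        P (m - Finsupp.single (rv u) 1) := by
  classical
  generalize hn : m.degree = n
  induction n generalizing m with
  | zero =>
    obtain rfl := (Finsupp.degree_eq_zero_iff m).1 hn
    simp [hP.zero]
  | succ n ih =>
    let S := insert (rv u) m.support
    have hS : m.support ⊆ S := Finset.subset_insert _ _
    have hR := hP.euler S m hS
    have hD := hP.double_sum S m hS (rv u)
    rw [hn, Nat.add_sub_cancel] at hD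
    rw [hn] at hR
    refine hP.cancel _ n.succ_ne_zero _ _ ?_
    have h1 : ∀ u' ∈ S, (m u' : R) • (g u' * (g u *
        P (m - Finsupp.single u' 1))) =
        (m u' : R) • (g u' * P (m - Finsupp.single u' 1)) * g u +
        hs u • (m u' : R) • (g u' *
          (((m - Finsupp.single u' 1 : ι →₀ ℕ) (rv u) : ℕ) : R) •
            P (m - Finsupp.single u' 1 - Finsupp.single (rv u) 1)) := by
      intro u' _
      by_cases h0 : m u' = 0
      · simp [h0]
      · have hd := degree_sub_single m u' h0
        rw [ih (m - Finsupp.single u' 1) (by omega), mul_add, smul_add, mul_smul_comm,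
          smul_comm (hs u), ← mul_assoc, smul_mul_assoc]
    rw [← mul_smul_comm, hR, Finset.mul_sum]
    simp only [mul_smul_comm (m _ : R)]
    rw [hP.sum_commutator S m u (Finset.mem_insert_self _ _), Finset.sum_congr rfl h1,
      Finset.sum_add_distrib, ← Finset.smul_sum, hD, ← Finset.sum_mul, ← hR, smul_add,
      smul_mul_assoc, add_assoc]
    congr 1
    rw [smul_comm _ (hs u), ← smul_add]
    congr 1
    rw [Nat.succ_eq_add_one, Nat.cast_add, Nat.cast_one, add_smul, one_smul]

/-- Moving `g u` from the front to a uniformly distributed place passes, on average, half of the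
other factors; hence half of the full commutator, `c` being `1/2`. The proof compares the Euler
recursions of `m` and of `m + Finsupp.single u 1`; in the latter the new factor in first position
gives back `g u * P m`. -/
theorem IsSymmetrized.add_single (hP : IsSymmetrized g rv hs P) (c : R) (hc : c * 2 = 1) (u : ι) (m : ι →₀ ℕ) :
    P (m + Finsupp.single u 1) + c • hs u •
      (m (rv u) : R) • P (m - Finsupp.single (rv u) 1) =
    g u * P m := by
  classical
  generalize hn : m.degree = n
  induction n generalizing m with
  | zero =>
    obtain rfl := (Finsupp.degree_eq_zero_iff m).1 hn
    have h := hP.euler {u} (Finsupp.single u 1) Finsupp.support_single_subset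
    simpa [hP.zero] using h
  | succ n ih =>
    let S := insert u (insert (rv u) m.support)
    have hS : m.support ⊆ S :=
      (Finset.subset_insert _ _).trans (Finset.subset_insert _ _)
    have hS' : (m + Finsupp.single u 1).support ⊆ S := by
      refine Finsupp.support_add.trans (Finset.union_subset hS ?_)
      exact Finsupp.support_single_subset.trans (by simp [S])
    have hu : u ∈ S := Finset.mem_insert_self _ _
    have hu' : rv u ∈ S := Finset.mem_insert_of_mem (Finset.mem_insert_self _ _)
    have hR := hP.euler S m hS
    have hR' := hP.euler S _ hS'
    have hD := hP.double_sum S m hS (rv u)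
    rw [hn, Nat.add_sub_cancel] at hD
    rw [hn] at hR
    rw [map_add, Finsupp.degree_single, hn] at hR'
    have h0 : ∀ u' ∈ S, (((m + Finsupp.single u 1 : ι →₀ ℕ) u' : ℕ) : R) •
        (g u' * P (m + Finsupp.single u 1 - Finsupp.single u' 1)) =
        (m u' : R) •
          (g u' * P (m - Finsupp.single u' 1 + Finsupp.single u 1)) +
        if u' = u then g u * P m else 0 := by
      intro u' _
      have h2 : (m u' : R) •
          (g u' * P (m + Finsupp.single u 1 - Finsupp.single u' 1)) =
          (m u' : R) •
          (g u' * P (m - Finsupp.single u' 1 + Finsupp.single u 1)) := by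
        by_cases h0 : m u' = 0
        · simp [h0]
        · have hle : Finsupp.single u' 1 ≤ m := by
            rw [Finsupp.single_le_iff]
            exact Nat.one_le_iff_ne_zero.2 h0
          rw [tsub_add_eq_add_tsub hle]
      rw [Finsupp.add_apply, Nat.cast_add, add_smul, h2]
      congr 1
      split_ifs with h
      · subst h
        simp
      · rw [Finsupp.single_eq_of_ne h, Nat.cast_zero, zero_smul]
    have h1 : ∀ u' ∈ S, (m u' : R) • (g u' * (g u *
        P (m - Finsupp.single u' 1))) =
        (m u' : R) •
          (g u' * P (m - Finsupp.single u' 1 + Finsupp.single u 1)) +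
        c • hs u • (m u' : R) • (g u' *
          (((m - Finsupp.single u' 1 : ι →₀ ℕ) (rv u) : ℕ) : R) •
            P (m - Finsupp.single u' 1 - Finsupp.single (rv u) 1)) := by
      intro u' _
      by_cases h0 : m u' = 0
      · simp [h0]
      · have hd := degree_sub_single m u' h0
        rw [← ih (m - Finsupp.single u' 1) (by omega), mul_add, smul_add]
        congr 1
        rw [mul_smul_comm, mul_smul_comm, smul_comm (m u' : R),
          smul_comm (m u' : R)]
    rw [Finset.sum_congr rfl h0, Finset.sum_add_distrib, Finset.sum_ite_eq' S, if_pos hu] at hR'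
    have hA : g u * ((n + 1 : ℕ) : R) • P m =
        ∑ u' ∈ S, (m u' : R) •
          (g u' * P (m - Finsupp.single u' 1 + Finsupp.single u 1)) +
        c • hs u • (n : R) •
          (m (rv u) : R) • P (m - Finsupp.single (rv u) 1) +
        hs u • (m (rv u) : R) •
          P (m - Finsupp.single (rv u) 1) := by
      rw [hR, Finset.mul_sum]
      simp only [mul_smul_comm (m _ : R)]
      rw [hP.sum_commutator S m u hu', Finset.sum_congr rfl h1,
        Finset.sum_add_distrib, ← Finset.smul_sum, ← Finset.smul_sum, hD]
    refine hP.cancel _ (n + 1).succ_ne_zero _ _ ?_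
    refine smul_add_half_smul n _ hc _ _ _ _ hR' ?_
    rw [← mul_smul_comm, hA, smul_comm (n : R) (hs u)]

end Symmetrized

end

/-! ### Bijectivity of the Weyl symmetrization map -/

section

section PhiW

variable {V : Type u} [Quiver.{v} V] (l : V → ℕ) (k : Type w) [Field k]

theorem natCast_smul_cancel [CharZero k] {n : ℕ} (hn : n ≠ 0) {x y : DQ l k}
    (h : (n : Polynomial k) • x = (n : Polynomial k) • y) : x = y := by
  have h0 : (n : k) ≠ 0 := by exact_mod_cast hn
  have h1 : Polynomial.C (n : k)⁻¹ * (n : Polynomial k) = 1 := by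
    rw [← Polynomial.C_eq_natCast, ← Polynomial.C_mul, inv_mul_cancel₀ h0, Polynomial.C_1]
  have h2 := congrArg (Polynomial.C (n : k)⁻¹ • ·) h
  simpa only [smul_smul, h1, one_smul] using h2

/-- `h [u, u*]` for the coordinate `u = (M_a)_{ij}`. -/
noncomputable def hsign (u : DCoord l) : Polynomial k := Polynomial.X * u.1.sign (Polynomial k)

theorem isSymmetrized_weyl [CharZero k] :
    IsSymmetrized (gen l k) revCoord (hsign l k) (weyl l k) where
  comm u := by
    have := gen_mul_gen l k u (revCoord u)
    rwa [if_pos rfl] at this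
  comm_of_ne u u' h := by
    have := gen_mul_gen l k u u'
    rwa [if_neg h, zero_smul, add_zero] at this
  zero := weyl_zero l k
  euler := weyl_euler l k
  cancel _ hn _ _ h := natCast_smul_cancel l k hn h

theorem phiW_pderiv_monomial (u : DCoord l) (m : DCoord l →₀ ℕ) (a : Polynomial k) :
    phiW l k (MvPolynomial.pderiv u (MvPolynomial.monomial m a)) =
      a • (m u : Polynomial k) • weyl l k (m - Finsupp.single u 1) := by
  rw [MvPolynomial.pderiv_monomial, phiW_monomial, mul_smul]

/-- Linear extension of `IsSymmetrized.add_single`. Surjectivity of `phiW` and multiplicativity of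
the symbol rest on it. -/
theorem gen_mul_phiW [CharZero k] (u : DCoord l) (f : MvPolynomial (DCoord l) (Polynomial k)) :
    gen l k u * phiW l k f = phiW l k (MvPolynomial.X u * f) +
      Polynomial.C (1 / 2 : k) • hsign l k u •
        phiW l k (MvPolynomial.pderiv (revCoord u) f) := by
  have hc : Polynomial.C (1 / 2 : k) * 2 = 1 := by
    rw [← Polynomial.C_ofNat, ← Polynomial.C_mul]
    simp
  induction f using MvPolynomial.induction_on' with
  | add f g hf hg =>
    simp only [mul_add, map_add, smul_add, hf, hg]
    exact add_add_add_comm _ _ _ _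
  | monomial m a =>
    have h := (isSymmetrized_weyl l k).add_single _ hc u m
    have hX : MvPolynomial.X u * MvPolynomial.monomial m a =
        MvPolynomial.monomial (m + Finsupp.single u 1) a := by
      rw [MvPolynomial.X, MvPolynomial.monomial_mul, one_mul, add_comm]
    rw [hX, phiW_pderiv_monomial, phiW_monomial, phiW_monomial, mul_smul_comm, ← h, smul_add]
    congr 1
    rw [smul_comm a, smul_comm a]

theorem phiW_commutator [CharZero k] (u : DCoord l)
    (f : MvPolynomial (DCoord l) (Polynomial k)) :
    gen l k u * phiW l k f = phiW l k f * gen l k u +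
      hsign l k u • phiW l k (MvPolynomial.pderiv (revCoord u) f) := by
  induction f using MvPolynomial.induction_on' with
  | add f g hf hg =>
    simp only [mul_add, add_mul, map_add, smul_add, hf, hg]
    exact add_add_add_comm _ _ _ _
  | monomial m a =>
    have h := (isSymmetrized_weyl l k).commutator u m
    rw [phiW_pderiv_monomial, phiW_monomial, mul_smul_comm, h, smul_add, smul_mul_assoc]
    congr 1
    rw [smul_comm a]

theorem hsign_ne_zero (u : DCoord l) : hsign l k u ≠ 0 := by
  unfold hsign DEdge.sign
  split_ifs <;> simp [Polynomial.X_ne_zero]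

theorem smul_DQ_eq_zero {c : Polynomial k} (hc : c ≠ 0) {T : DQ l k} (h : c • T = 0) : T = 0 := by
  refine Subtype.ext (LinearMap.ext fun f => ?_)
  have h1 : c • (T : Operators l k) f = 0 :=
    LinearMap.congr_fun (congrArg (Subtype.val : DQ l k → Operators l k) h) f
  exact (smul_eq_zero.1 h1).resolve_left hc

/-- The commutator of a generator with `0` vanishes, and the factor `± h` can be cancelled because
polynomials over `k[h]` have no torsion. So the kernel is stable under all partial derivatives. -/
theorem phiW_pderiv_eq_zero [CharZero k] (u : DCoord l)
    {f : MvPolynomial (DCoord l) (Polynomial k)} (hf : phiW l k f = 0) :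
    phiW l k (MvPolynomial.pderiv u f) = 0 := by
  have h := phiW_commutator l k (revCoord u) f
  rw [hf, mul_zero, zero_mul, zero_add, revCoord_revCoord] at h
  exact smul_DQ_eq_zero l k (hsign_ne_zero l k _) h.symm

theorem phiW_C (a : Polynomial k) :
    phiW l k (MvPolynomial.C a) = algebraMap (Polynomial k) (DQ l k) a := by
  rw [← MvPolynomial.monomial_zero', phiW_monomial, weyl_zero, Algebra.algebraMap_eq_smul_one]

theorem phiW_one : phiW l k 1 = 1 := by
  rw [← MvPolynomial.C_1, phiW_C, map_one]

/-- The partial derivatives lie in the kernel and have smaller degree, so they vanish by induction.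
In characteristic `0` this makes `f` constant, and scalars act faithfully. -/
theorem eq_zero_of_phiW_eq_zero [CharZero k] (n : ℕ)
    (f : MvPolynomial (DCoord l) (Polynomial k)) (hf : phiW l k f = 0)
    (hn : ∀ m, f.coeff m ≠ 0 → m.degree ≤ n) : f = 0 := by
  classical
  have hconst : ∀ f : MvPolynomial (DCoord l) (Polynomial k), phiW l k f = 0 →
      (∀ m, m ≠ 0 → f.coeff m = 0) → f = 0 := by
    intro f hf h
    have hC : f = MvPolynomial.C (f.coeff 0) := by
      ext1 m
      rw [MvPolynomial.coeff_C]
      split_ifs with h0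
      · rw [h0]
      · exact h m (Ne.symm h0)
    rw [hC, phiW_C, Algebra.algebraMap_eq_smul_one] at hf
    have h0 : f.coeff 0 = 0 := by
      by_contra hc
      have h1 := smul_DQ_eq_zero l k hc hf
      have h2 : (1 : MvPolynomial (Coord l) (Polynomial k)) = 0 :=
        LinearMap.congr_fun (congrArg (Subtype.val : DQ l k → Operators l k) h1) 1
      exact one_ne_zero h2
    rw [hC, h0, map_zero]
  induction n generalizing f with
  | zero =>
    refine hconst f hf fun m hm => ?_
    by_contra h
    exact hm ((Finsupp.degree_eq_zero_iff m).1 (Nat.le_zero.1 (hn m h)))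
  | succ n ih =>
    refine hconst f hf fun m hm => ?_
    obtain ⟨u, hu⟩ := Finsupp.ne_iff.1 hm
    have hle : Finsupp.single u 1 ≤ m := by
      rw [Finsupp.single_le_iff]
      exact Nat.one_le_iff_ne_zero.2 hu
    have h0 : MvPolynomial.pderiv u f = 0 := by
      refine ih _ (phiW_pderiv_eq_zero l k u hf) fun m' hm' => ?_
      rw [MvPolynomial.coeff_pderiv] at hm'
      have := hn _ (left_ne_zero_of_mul hm')
      rw [map_add, Finsupp.degree_single] at this
      omega
    have h1 := congrArg (MvPolynomial.coeff (m - Finsupp.single u 1)) h0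
    rw [MvPolynomial.coeff_pderiv, tsub_add_cancel_of_le hle, MvPolynomial.coeff_zero] at h1
    exact (mul_eq_zero.1 h1).resolve_right (Nat.cast_add_one_ne_zero _)

theorem phiW_injective [CharZero k] : Function.Injective (phiW l k) := by
  refine (injective_iff_map_eq_zero (phiW l k)).2 fun f hf => ?_
  refine eq_zero_of_phiW_eq_zero l k f.totalDegree f hf fun m hm => ?_
  exact MvPolynomial.le_totalDegree (MvPolynomial.mem_support_iff.2 hm)

theorem adjoin_subtype_induction {R A : Type*} [CommSemiring R] [Semiring A] [Algebra R A]
    {s : Set A} {p : Algebra.adjoin R s → Prop} (T : Algebra.adjoin R s)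
    (hs : ∀ T (h : T ∈ s), p ⟨T, Algebra.subset_adjoin h⟩)
    (hr : ∀ a, p (algebraMap R (Algebra.adjoin R s) a))
    (hadd : ∀ T U, p T → p U → p (T + U)) (hmul : ∀ T U, p T → p U → p (T * U)) : p T := by
  obtain ⟨T, hT⟩ := T
  exact Algebra.adjoin_induction (p := fun T hT => p ⟨T, hT⟩) hs hr
    (fun T U hT hU h h' => hadd _ _ h h') (fun T U hT hU h h' => hmul _ _ h h') hT

theorem DQ_induction {p : DQ l k → Prop} (T : DQ l k) (hgen : ∀ u, p (gen l k u))
    (hr : ∀ a, p (algebraMap (Polynomial k) (DQ l k) a))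
    (hadd : ∀ T U, p T → p U → p (T + U)) (hmul : ∀ T U, p T → p U → p (T * U)) : p T := by
  unfold DQ at T p hr hadd hmul
  refine adjoin_subtype_induction T ?_ hr hadd hmul
  rintro _ ⟨u, rfl⟩
  exact hgen u

theorem phiW_surjective [CharZero k] : Function.Surjective (phiW l k) := by
  intro T
  -- The range is stable under left multiplication by generators, hence by all of `D_Q`; it also
  -- contains `1`.
  have key : ∀ f, ∃ g, phiW l k g = T * phiW l k f := by
    induction T using DQ_induction with
    | hgen u =>
      intro f
      refine ⟨MvPolynomial.X u * f + Polynomial.C (1 / 2 : k) • hsign l k u •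
        MvPolynomial.pderiv (revCoord u) f, ?_⟩
      rw [gen_mul_phiW, map_add, map_smul, map_smul]
    | hr a => exact fun f => ⟨a • f, by rw [map_smul, Algebra.smul_def]⟩
    | hadd T U hT hU =>
      intro f
      obtain ⟨g, hg⟩ := hT f
      obtain ⟨g', hg'⟩ := hU f
      exact ⟨g + g', by rw [map_add, hg, hg', add_mul]⟩
    | hmul T U hT hU =>
      intro f
      obtain ⟨g, hg⟩ := hU f
      obtain ⟨g', hg'⟩ := hT g
      exact ⟨g', by rw [hg', hg, mul_assoc]⟩
  obtain ⟨g, hg⟩ := key 1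
  exact ⟨g, by rw [hg, phiW_one, mul_one]⟩

theorem phiW_bijective [CharZero k] : Function.Bijective (phiW l k) :=
  ⟨phiW_injective l k, phiW_surjective l k⟩

/-! ### The symbol map -/

/-- The symbol of an operator, as a function. -/
noncomputable def symbFun [CharZero k] (T : DQ l k) : MvPolynomial (DCoord l) k :=
  atZero k _ ((LinearEquiv.ofBijective (phiW l k) (phiW_bijective l k)).symm T)

theorem symbFun_phiW [CharZero k] (f : MvPolynomial (DCoord l) (Polynomial k)) :
    symbFun l k (phiW l k f) = atZero k _ f :=
  congrArg (atZero k _) ((LinearEquiv.ofBijective (phiW l k) (phiW_bijective l k)).symm_apply_apply f)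

theorem symbFun_add [CharZero k] (T U : DQ l k) :
    symbFun l k (T + U) = symbFun l k T + symbFun l k U := by
  unfold symbFun
  rw [map_add, map_add]

theorem atZero_X {σ : Type*} (u : σ) :
    atZero k σ (MvPolynomial.X u) = MvPolynomial.X u := MvPolynomial.map_X _ _

theorem symbFun_algebraMap [CharZero k] (a : Polynomial k) :
    symbFun l k (algebraMap (Polynomial k) (DQ l k) a) = MvPolynomial.C (a.eval 0) := by
  rw [← phiW_C, symbFun_phiW]
  exact MvPolynomial.map_C _ _

/-- The correction term in `gen_mul_phiW` carries a factor `h` and disappears at `h = 0`. -/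
theorem symbFun_gen_mul [CharZero k] (u : DCoord l) (T : DQ l k) :
    symbFun l k (gen l k u * T) = MvPolynomial.X u * symbFun l k T := by
  obtain ⟨f, rfl⟩ := phiW_surjective l k T
  rw [gen_mul_phiW, ← map_smul, ← map_smul, ← map_add, symbFun_phiW, symbFun_phiW, map_add,
    map_mul, atZero_X, atZero_smul, atZero_smul]
  simp [hsign]

theorem symbFun_mul [CharZero k] (T U : DQ l k) :
    symbFun l k (T * U) = symbFun l k T * symbFun l k U := by
  have hone : symbFun l k 1 = 1 := by
    rw [← map_one (algebraMap (Polynomial k) (DQ l k)), symbFun_algebraMap]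
    simp
  induction T using DQ_induction generalizing U with
  | hgen u =>
    have h := symbFun_gen_mul l k u 1
    rw [mul_one, hone, mul_one] at h
    rw [symbFun_gen_mul, h]
  | hr a =>
    obtain ⟨f, rfl⟩ := phiW_surjective l k U
    rw [← Algebra.smul_def, ← map_smul, symbFun_phiW, atZero_smul, symbFun_algebraMap,
      symbFun_phiW]
  | hadd T T' hT hT' => rw [add_mul, symbFun_add, hT, hT', symbFun_add, add_mul]
  | hmul T T' hT hT' => rw [mul_assoc, hT, hT', hT, mul_assoc]

/-- The symbol homomorphism `D_Q → k[Rep_l(Q̄)]`. -/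
noncomputable def symb [CharZero k] : DQ l k →+* MvPolynomial (DCoord l) k where
  toFun := symbFun l k
  map_one' := by
    rw [← map_one (algebraMap (Polynomial k) (DQ l k)), symbFun_algebraMap]
    simp
  map_mul' := symbFun_mul l k
  map_zero' := by
    rw [← map_zero (algebraMap (Polynomial k) (DQ l k)), symbFun_algebraMap]
    simp
  map_add' := symbFun_add l k

theorem symb_phiW [CharZero k] (f : MvPolynomial (DCoord l) (Polynomial k)) :
    symb l k (phiW l k f) = atZero k _ f := symbFun_phiW l k f

theorem symb_algebraMap [CharZero k] (a : Polynomial k) :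
    symb l k (algebraMap (Polynomial k) (DQ l k) a) = MvPolynomial.C (a.eval 0) :=
  symbFun_algebraMap l k a

theorem symb_gen [CharZero k] (u : DCoord l) : symb l k (gen l k u) = MvPolynomial.X u := by
  rw [← mul_one (gen l k u)]
  exact (symbFun_gen_mul l k u 1).trans (by rw [show symbFun l k 1 = 1 from map_one (symb l k),
    mul_one])

/-! ### The diagram of trace representations -/

theorem atZero_traceNecklace (n : Necklace V) :
    atZero k _ (traceNecklace l (Polynomial k) n) = traceNecklace l k n := by
  obtain ⟨⟨a, p⟩, rfl⟩ := Quot.exists_rep n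
  have h : ∀ {b : Quiver.Symmetrify V} (p : Quiver.Path a b),
      (pathMatrix l (Polynomial k) p).map (atZero k _) = pathMatrix l k p := by
    intro b p
    induction p with
    | nil => exact Matrix.map_one _ (map_zero _) (map_one _)
    | cons p e ih =>
      rw [pathMatrix, Matrix.map_mul, ih, pathMatrix]
      congr 1
      ext1 i j
      exact atZero_X k _
  change atZero k _ (pathMatrix l (Polynomial k) p).trace = (pathMatrix l k p).trace
  rw [← h p, Matrix.trace, map_sum]
  rfl

theorem atZero_traceMap (P : SymL V (Polynomial k)) :
    atZero k _ (traceMap l (Polynomial k) P) = traceMap l k (atZero k _ P) := by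
  induction P using MvPolynomial.induction_on with
  | C a =>
    rw [traceMap, traceMap, atZero, atZero, MvPolynomial.map_C]
    simp
  | add P R hP hR => simp only [map_add, hP, hR]
  | mul_X P n hP =>
    simp only [map_mul, hP, atZero_X]
    rw [traceMap, traceMap, MvPolynomial.aeval_X, MvPolynomial.aeval_X, atZero_traceNecklace]

/-- For a fixed index function the summand is a single monomial with one coordinate for each
abstract edge, so orderings of its factors are orderings of the abstract edges. -/
theorem phiW_entryProd {N : ℕ} (D : Diagram V (Fin N)) {idx : Fin N → ℕ}
    (h : idx ∈ D.indices l) :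
    phiW l k (D.entryProd (entryVar l (Polynomial k)) idx (List.finRange N)) =
      Polynomial.C ((N ! : k)⁻¹) • ∑ σ : Equiv.Perm (Fin N),
        D.entryProd (entryOp l k) idx ((List.finRange N).map σ) := by
  let c : Fin N → DCoord l := fun x => ⟨D.edge x, ⟨idx x, (Diagram.mem_indices l).1 h x⟩,
    ⟨idx (D.next x), Diagram.next_lt l h x⟩⟩
  have h1 : D.entryProd (entryVar l (Polynomial k)) idx (List.finRange N) =
      MvPolynomial.monomial (∑ i, Finsupp.single (c i) 1) 1 := by
    rw [Diagram.entryProd, ← List.ofFn_eq_map, List.prod_ofFn, MvPolynomial.monomial_sum_one]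
    refine Finset.prod_congr rfl fun x _ => ?_
    exact dif_pos (⟨(Diagram.mem_indices l).1 h x, Diagram.next_lt l h x⟩ : _ ∧ _)
  rw [h1]
  refine (weyl_sum_single l k c).trans ?_
  congr 1
  refine Finset.sum_congr rfl fun σ _ => ?_
  rw [Diagram.entryProd, List.map_map, List.ofFn_eq_map]
  congr 1
  refine List.map_congr_left fun x _ => ?_
  rw [Function.comp_apply, entryOp, dif_pos ⟨(Diagram.mem_indices l).1 h _, Diagram.next_lt l h _⟩]
  rfl

theorem rho_PhiW [CharZero k] (P : SymL V (Polynomial k)) :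
    rho l k (PhiW k P) = phiW l k (traceMap l (Polynomial k) P) := by
  classical
  induction P using SymL_induction k with
  | h D =>
    have h1 : ∀ σ : Equiv.Perm (Fin D.size), rho l k (HDiagram.toAh k ⟨_, D.diag.relabel σ⟩) =
        Diagram.vertexProd l D.diag.verts • ∑ idx ∈ D.diag.indices l,
          D.diag.entryProd (entryOp l k) idx ((List.finRange D.size).map σ.symm) := by
      intro σ
      rw [rho_toAh, rhoDiagram_relabel, Diagram.indexSum]
    have h2 : rho l k (PhiW k (D.diag.sym (Polynomial k))) =
        Polynomial.C ((D.size ! : k)⁻¹) • Diagram.vertexProd l D.diag.verts •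
          ∑ idx ∈ D.diag.indices l, ∑ σ : Equiv.Perm (Fin D.size),
            D.diag.entryProd (entryOp l k) idx ((List.finRange D.size).map σ) := by
      rw [Diagram.PhiW_sym, D.diag.average_eq k D.size (Fintype.card_fin _), map_smul, map_sum,
        Finset.sum_congr rfl fun σ _ => h1 σ, ← Finset.smul_sum, Finset.sum_comm]
      congr 2
      refine Finset.sum_congr rfl fun idx _ => ?_
      -- Heights `σ` list the edges in the order `σ⁻¹`, so the two sums differ by inversion of the
      -- permutation.
      exact Equiv.sum_comp (Equiv.inv (Equiv.Perm (Fin D.size))) fun σ =>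
        D.diag.entryProd (entryOp l k) idx ((List.finRange D.size).map σ)
    have h3 : phiW l k (D.diag.indexSum l (entryVar l (Polynomial k)) (List.finRange D.size)) =
        Diagram.vertexProd l D.diag.verts • Polynomial.C ((D.size ! : k)⁻¹) •
          ∑ idx ∈ D.diag.indices l, ∑ σ : Equiv.Perm (Fin D.size),
            D.diag.entryProd (entryOp l k) idx ((List.finRange D.size).map σ) := by
      rw [Diagram.indexSum, map_nsmul, map_sum,
        Finset.smul_sum (r := Polynomial.C ((D.size ! : k)⁻¹))]
      congr 1
      exact Finset.sum_congr rfl fun idx hidx => phiW_entryProd l k D.diag hidx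
    rw [h2, traceMap_sym]
    exact (smul_comm (Polynomial.C ((D.size ! : k)⁻¹)) (Diagram.vertexProd l D.diag.verts)
      _).trans h3.symm
  | hadd a b ha hb => simp only [map_add, ha, hb]
  | hsmul c a ha => simp only [map_smul, ha]

/-- As `PhiW` is surjective, this square follows from the other three commutativities and from
`pr_PhiW`. -/
theorem symb_rho [CharZero k] (a : Ah k V) : symb l k (rho l k a) = traceMap l k (pr k a) := by
  obtain ⟨P, rfl⟩ := PhiW_surjective k a
  rw [rho_PhiW, symb_phiW, atZero_traceMap, pr_PhiW]

end PhiW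

end

end NecklaceMoyal

theorem mainTheorem1 {V : Type*} [Quiver V] (k : Type*) [Field k] [CharZero k] :
    -- `Φ_W` of any collection of necklaces is the average over all its height assignments
    (∀ (X : Type) [Fintype X] (D : NecklaceMoyal.Diagram V X),
      NecklaceMoyal.PhiW k (D.sym (Polynomial k)) = D.average k) ∧
    -- `P *_h R` of any two collections of necklaces is given by the cut-and-glue formula
    (∀ (X Y : Type) [Fintype X] [Fintype Y] (D : NecklaceMoyal.Diagram V X)
      (D' : NecklaceMoyal.Diagram V Y),
      NecklaceMoyal.star k (D.sym (Polynomial k)) (D'.sym (Polynomial k)) = D.moyal k D') ∧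
    -- `Φ_W` is multiplicative
    (∀ P R : NecklaceMoyal.SymL V (Polynomial k),
      NecklaceMoyal.PhiW k (NecklaceMoyal.star k P R) =
        NecklaceMoyal.PhiW k P * NecklaceMoyal.PhiW k R) ∧
    -- `*_h` is an associative product with unit `1`, and `Φ_W` is a unital bijection
    (∀ P R S : NecklaceMoyal.SymL V (Polynomial k),
      NecklaceMoyal.star k (NecklaceMoyal.star k P R) S =
        NecklaceMoyal.star k P (NecklaceMoyal.star k R S)) ∧
    (∀ P : NecklaceMoyal.SymL V (Polynomial k),
      NecklaceMoyal.star k 1 P = P ∧ NecklaceMoyal.star k P 1 = P) ∧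
    NecklaceMoyal.PhiW (V := V) k 1 = 1 ∧
    Function.Bijective (NecklaceMoyal.PhiW (V := V) k) ∧
    -- the diagram with the trace representations
    ∃ pr : NecklaceMoyal.Ah k V →+* NecklaceMoyal.SymL V k,
      (∀ D : NecklaceMoyal.HDiagram V, pr (D.toAh k) = D.diag.sym k) ∧
      (∀ c : Polynomial k, pr (algebraMap _ _ c) = MvPolynomial.C (c.eval 0)) ∧
      (∀ P, pr (NecklaceMoyal.PhiW k P) = NecklaceMoyal.atZero k _ P) ∧
      ∀ l : V → ℕ,
        ∃ (rho : NecklaceMoyal.Ah k V →ₐ[Polynomial k] NecklaceMoyal.DQ l k)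
          (symb : NecklaceMoyal.DQ l k →+* MvPolynomial (NecklaceMoyal.DCoord l) k),
          (∀ D : NecklaceMoyal.HDiagram V, rho (D.toAh k) = NecklaceMoyal.rhoDiagram l k D) ∧
          (∀ (a : NecklaceMoyal.DEdge V) (i : Fin (l a.left)) (j : Fin (l a.right)),
            symb (NecklaceMoyal.coord l k a i j) = MvPolynomial.X ⟨a, i, j⟩) ∧
          (∀ c : Polynomial k, symb (algebraMap _ _ c) = MvPolynomial.C (c.eval 0)) ∧
          Function.Bijective (NecklaceMoyal.phiW l k) ∧
          (∀ P, rho (NecklaceMoyal.PhiW k P) =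
            NecklaceMoyal.phiW l k (NecklaceMoyal.traceMap l (Polynomial k) P)) ∧
          (∀ P, NecklaceMoyal.atZero k _ (NecklaceMoyal.traceMap l (Polynomial k) P) =
            NecklaceMoyal.traceMap l k (NecklaceMoyal.atZero k _ P)) ∧
          (∀ f, symb (NecklaceMoyal.phiW l k f) = NecklaceMoyal.atZero k _ f) ∧
          (∀ a, symb (rho a) = NecklaceMoyal.traceMap l k (pr a)) := by
  refine ⟨fun X _ D => NecklaceMoyal.Diagram.PhiW_sym k D,
    fun X Y _ _ D D' => NecklaceMoyal.star_sym k D D', NecklaceMoyal.PhiW_star k,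
    NecklaceMoyal.star_assoc k, NecklaceMoyal.one_star k, NecklaceMoyal.PhiW_one k,
    NecklaceMoyal.PhiW_bijective k, NecklaceMoyal.pr k, NecklaceMoyal.pr_toAh k,
    NecklaceMoyal.pr_algebraMap k, NecklaceMoyal.pr_PhiW k, fun l =>
    ⟨NecklaceMoyal.rho l k, NecklaceMoyal.symb l k, NecklaceMoyal.rho_toAh l k,
      fun a i j => NecklaceMoyal.symb_gen l k ⟨a, i, j⟩, NecklaceMoyal.symb_algebraMap l k,
      NecklaceMoyal.phiW_bijective l k, NecklaceMoyal.rho_PhiW l k,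
      NecklaceMoyal.atZero_traceMap l k, NecklaceMoyal.symb_phiW l k,
      NecklaceMoyal.symb_rho l k⟩⟩
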